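/- **Notation.** Work over $\mathbb{Q}(q,t)$. Draw partitions in the French convention; a cell with coleg $i$ (cells below it) and coarm $j$ (cells to its left) has weight $t^iq^j$, and $T_\lambda=\prod_{(i,j)\in\lambda}t^iq^j$. Let $\widetilde H_\lambda(x;q,t)$ be the modified Macdonald polynomials and $\nabla$ the linear operator on symmetric functions with $\nabla\widetilde H_\lambda=T_\lambda\widetilde H_\lambda$ for all $\lambda$. For $\lambda\vdash n$ let $\mathbf M_\lambda\subset\mathbb Q[x_1,\dots,x_n;y_1,\dots,y_n]$ be the span of all partial derivatives of $\Delta_\lambda=\det\|x_i^{p_j}y_i^{q_j}\|$, where $(p_j,q_j)$ runs over the pairs (coleg, coarm) of the cells of $\lambda$, and let $\mathcal F$ denote the bivariate Frobenius characteristic of bigraded modules for the diagonal action of $S_n$ ($t$ records the $x$-degree, $q$ the $y$-degree). Let $\mu\vdash n+1$ have $m$ corner cells, numbered from left to right (top to bottom), the $i$-th one having coleg $l_i$ and coarm $a_i$; let $\alpha^{(i)}$ be $\mu$ without its $i$-th corner, $T_i=T_{\alpha^{(i)}}$, $\mathbf V=\sum_i\mathbf M_{\alpha^{(i)}}$, and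 $$x_0=\tfrac1{tq},\quad x_i=t^{l_i}q^{a_i}\ (1\le i\le m),\qquad u_i=t^{l_{i+1}}q^{a_i}\ (0\le i\le m),\ \text{ with } a_0=l_{m+1}=-1,$$ $$\Phi_\mu=\sum_{j=1}^m\Bigl(\prod_{s\ne j}\frac1{1-T_j/T_s}\Bigr)\widetilde H_{\alpha^{(j)}}.$$ **Assumptions.** (SF) $\mathbf V$ has a basis $\mathcal B$ of bihomogeneous polynomials with subsets $\mathcal B_1,\dots,\mathcal B_m$ such that $\mathcal B_i$ spans $\mathbf M_{\alpha^{(i)}}$; for each word $\epsilon\in\{0,1\}^m$ the span $\mathbf M^\epsilon$ of the $b\in\mathcal B$ that lie in $\mathcal B_i$ exactly when $\epsilon_i=1$ is $S_n$-invariant; and whenever $\epsilon_i=1$, the image of $\mathbf M^\epsilon$ under $P\mapsto P(\partial)\Delta_{\alpha^{(i)}}$ is isomorphic, as a bigraded $S_n$-module, to $\mathbf M^{\tau_i\epsilon}$, where $\tau_i$ complements all letters but the $i$-th. ($C=\widetilde H$) $\mathcal F\,\mathbf M_{\alpha^{(i)}}=\widetilde H_{\alpha^{(i)}}$ for $i=1,\dots,m$.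 **Bergeron–Haiman assignment.** Every cell of the top row is assigned $\mathbf M_{\alpha^{(1)}}$. Let $A$ be a row and $B$ the row just below it, of lengths $a\le b$, and $c=b-a$. If $c=0$, then $B$ gets the same modules as $A$. If $c\ge1$ and $\mathbf A_1,\dots,\mathbf A_a$ are the modules of $A$, put $\mathbf A'_s=\mathbf A_s$ for $1\le s\le a$, $\mathbf A'_s=\mathbf V$ for $s\le0$, $\mathbf A'_s=0$ for $s>a$; the $s$-th cell of $B$ gets $\mathbf A'_s+(\mathbf A'_{s-c}\cap\mathbf M_{\alpha^{(i)}})$, where the $i$-th corner is the end of $B$. For a row $R$ let $L_R=\sum_sq^{s-1}\mathcal F(\mathbf R_s)$, with $\mathbf R_s$ the module of its $s$-th cell. **Statement.** 1. For each row $R$ there is a unique polynomial $\Pi_R(z)\in\mathbb Q(q,t)[z]$ of degree $<m$ with $L_R=\Pi_R(\nabla)\Phi_\mu$. 2. If $B$ is a row, other than the top one, that ends in the $i$-th corner of $\mu$, $A$ is the row just above it and $c$ is the difference of their lengths, then $$\Pi_B(z)=\Pi_A(z)\,\frac{q^c-z/T_i}{1-z/T_i}+\frac{q^c-1}{q-1}\prod_{j\ne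 i}\Bigl(1-\frac z{T_j}\Bigr).$$ 3. For every row $R$ of the same length as the row of the $i$-th corner, $$\Pi_R(z)=\prod_{j=1}^m\Bigl(1-\frac z{T_j}\Bigr)\cdot\frac1{1-q}\Bigl(1-\prod_{s=1}^i\frac{x_s}{u_{s-1}}\,\frac{1-u_{s-1}z/T_\mu}{1-x_sz/T_\mu}\Bigr).$$ 4. If $\mathbf M_{ij}$ is the module assigned to the cell $(i,j)$ (coleg $i$, coarm $j$), then $$\sum_{(i,j)\in\mu}t^iq^j\,\mathcal F(\mathbf M_{ij})=\frac1{(1-1/t)(1-1/q)}\,\frac{T_\mu}{\nabla}\Bigl\{\prod_{s=0}^m\Bigl(1-\frac{\nabla}{T_\mu}u_s\Bigr)-\prod_{s=0}^m\Bigl(1-\frac{\nabla}{T_\mu}x_s\Bigr)\Bigr\}\Phi_\mu ,$$ where the expression in braces is a polynomial in $\nabla$ without constant term. Consequently, if $\mathcal F\,\mathbf M_\mu=\widetilde H_\mu$ and $\partial_{p_1}\mathcal F\,\mathbf M_\mu=\sum_{(i,j)\in\mu}t^iq^j\mathcal F(\mathbf M_{ij})$, then $\partial_{p_1}\widetilde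 H_\mu$ equals the right-hand side. -/

import Mathlib

noncomputable section

namespace ScienceFiction

open MvPolynomial

/-! ### Symmetric functions over `ℚ(q,t)` -/

/-- The field `ℚ(q,t)` of rational functions in two indeterminates. -/
abbrev QT : Type := FractionRing (MvPolynomial (Fin 2) ℚ)

/-- The indeterminate `q`. -/
def qq : QT := algebraMap (MvPolynomial (Fin 2) ℚ) QT (X 0)

/-- The indeterminate `t`. -/
def tt : QT := algebraMap (MvPolynomial (Fin 2) ℚ) QT (X 1)

/-- The ring `Λ` of symmetric functions over `ℚ(q,t)`, as the polynomial ring in the power sums: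
the variable with index `k ≥ 1` is the power sum `p_k`. -/
abbrev SymF : Type := MvPolynomial ℕ+ QT

/-- The power sum `p_k` for a natural number `k ≥ 1`. -/
def pk (k : ℕ) : SymF := X k.toPNat'

/-- The operator `∂_{p₁}`, the Hall adjoint of multiplication by `p₁`. -/
def dp1 : SymF →ₗ[QT] SymF := (pderiv (1 : ℕ+) : Derivation QT SymF SymF).toLinearMap

/-- `z_ν = ∏_k k^{m_k} m_k!`, where `m_k` is the multiplicity of `k` in `ν`. -/
def zee (ν : Multiset ℕ) : ℕ :=
  ∏ k ∈ ν.toFinset, k ^ ν.count k * (ν.count k).factorial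

/-- The complete homogeneous symmetric function `h_n = ∑_{ν ⊢ n} p_ν / z_ν`. -/
def hsym (n : ℕ) : SymF :=
  ∑ ν : Nat.Partition n, C ((zee ν.parts : QT)⁻¹) * (ν.parts.map pk).prod

/-- `h_k` for an integer index, with `h_k = 0` for `k < 0`. -/
def hInt (k : ℤ) : SymF := if k < 0 then 0 else hsym k.toNat

/-- The Schur function `S_lam = det (h_{lam_i - i + j})`.  In a Young diagram of Mathlib the cell
`(i, j)` has coleg `i` and coarm `j` (both counted from `0`), so row `0` is the longest row. -/
def schur (lam : YoungDiagram) : SymF :=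
  Matrix.det (Matrix.of fun i j : Fin (lam.colLen 0) =>
    hInt ((lam.rowLen i : ℤ) - (i : ℤ) + (j : ℤ)))

/-- Strict dominance `ν < lam` of partitions of the same number. -/
def DomLT (ν lam : YoungDiagram) : Prop :=
  ν.card = lam.card ∧ ν ≠ lam ∧
    ∀ k : ℕ, ∑ i ∈ Finset.range k, ν.rowLen i ≤ ∑ i ∈ Finset.range k, lam.rowLen i

/-- The scalar product `⟨p_ν, p_ν'⟩_{q,t} = δ_{ν ν'} z_ν ∏_i (1 - q^{ν_i}) / (1 - t^{ν_i})`.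
The exponent vector `d` of a monomial stands for `p_ν = ∏_k p_k ^ d_k`. -/
def qtForm (q t : QT) (f g : SymF) : QT :=
  ∑ d ∈ f.support, f.coeff d * g.coeff d *
    d.prod (fun k m => ((k : ℕ) : QT) ^ m * (m.factorial : QT) *
      ((1 - q ^ (k : ℕ)) / (1 - t ^ (k : ℕ))) ^ m)

/-- Families `(P_lam)` of the form `P_lam = S_lam + ∑_{ν < lam} ξ_{ν lam} S_ν`. -/
def UnitriFamily : Type :=
  {P : YoungDiagram → SymF // ∀ lam, P lam - schur lam ∈
    Submodule.span QT {f | ∃ ν, DomLT ν lam ∧ f = schur ν}}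

instance : Nonempty UnitriFamily := ⟨⟨schur, fun lam => by simp⟩⟩

/-- The Macdonald polynomials `P_lam(x; q, t)`: by Macdonald's theorem there is exactly one
family that is unitriangular with respect to the Schur functions and orthogonal with respect to
`⟨ , ⟩_{q,t}` (for algebraically independent parameters); this is that family. -/
def macP (q t : QT) : YoungDiagram → SymF :=
  (Classical.epsilon fun P : UnitriFamily =>
    ∀ lam ν, lam ≠ ν → qtForm q t (P.1 lam) (P.1 ν) = 0).1

/-- `h_lam(q,t) = ∏_{s ∈ lam} (1 - q^{arm(s)} t^{leg(s)+1})`. -/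
def hookH (q t : QT) (lam : YoungDiagram) : QT :=
  ∏ s ∈ lam.cells, (1 - q ^ (lam.rowLen s.1 - s.2 - 1) * t ^ (lam.colLen s.2 - s.1 - 1 + 1))

/-- The integral form `J_lam = h_lam P_lam`. -/
def macJ (q t : QT) (lam : YoungDiagram) : SymF := C (hookH q t lam) * macP q t lam

/-- The plethystic substitution `f ↦ f[X / (1 - t)]`, i.e. `p_k ↦ p_k / (1 - t^k)`. -/
def plethDiv (t : QT) : SymF →ₐ[QT] SymF :=
  aeval fun k : ℕ+ => C ((1 - t ^ (k : ℕ))⁻¹) * X k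

/-- `H_lam(x; q, t) = J_lam[X / (1 - t); q, t]`. -/
def macH (q t : QT) (lam : YoungDiagram) : SymF := plethDiv t (macJ q t lam)

/-- `n(lam) = ∑_i (i - 1) lam_i`. -/
def nStat (lam : YoungDiagram) : ℕ := ∑ s ∈ lam.cells, s.1

/-- The modified Macdonald polynomial `H̃_lam(x; q, t) = t^{n(lam)} H_lam(x; q, 1/t)`. -/
def Ht (lam : YoungDiagram) : SymF := C (tt ^ nStat lam) * macH qq tt⁻¹ lam

/-- `T_lam = ∏_{(i,j) ∈ lam} t^i q^j` (coleg `i`, coarm `j`). -/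
def Tw (lam : YoungDiagram) : QT := ∏ s ∈ lam.cells, tt ^ s.1 * qq ^ s.2

/-- The operator `∇`: the linear operator on `Λ` with `∇ H̃_lam = T_lam H̃_lam` for all `lam`
(the `H̃_lam` form a basis of `Λ`). -/
def nabla : SymF →ₗ[QT] SymF :=
  Classical.epsilon fun D : SymF →ₗ[QT] SymF => ∀ lam, D (Ht lam) = Tw lam • Ht lam

/-! ### Garsia–Haiman modules and bigraded Frobenius characteristics -/

/-- `ℚ[x_1, …, x_n; y_1, …, y_n]`: `Sum.inl i` is `x_i` and `Sum.inr i` is `y_i`. -/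
abbrev XY (n : ℕ) : Type := MvPolynomial (Fin n ⊕ Fin n) ℚ

/-- The diagonal action of a permutation. -/
def act {n : ℕ} (σ : Equiv.Perm (Fin n)) : XY n →ₗ[ℚ] XY n :=
  (rename (Sum.map σ σ) : XY n →ₐ[ℚ] XY n).toLinearMap

/-- The space of bihomogeneous polynomials of degree `d.1` in the `x_i` and `d.2` in the `y_i`. -/
def bihom (n : ℕ) (d : ℕ × ℕ) : Submodule ℚ (XY n) :=
  weightedHomogeneousSubmodule ℚ
    (Sum.elim (fun _ => ((1, 0) : ℕ × ℕ)) (fun _ => ((0, 1) : ℕ × ℕ)) : Fin n ⊕ Fin n → ℕ × ℕ) d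

/-- The biexponents of `lam` in lexicographic order. -/
def biexp (lam : YoungDiagram) : List (ℕ ×ₗ ℕ) :=
  (lam.cells.map toLex.toEmbedding).sort (· ≤ ·)

/-- `Δ_lam = det (x_i^{p_j} y_i^{q_j})`, for `lam` a partition of `n`. -/
def Delta (n : ℕ) (lam : YoungDiagram) : XY n :=
  Matrix.det (Matrix.of fun i j : Fin n =>
    (X (Sum.inl i) : XY n) ^ (ofLex ((biexp lam).getD j (toLex (0, 0)))).1 *
      X (Sum.inr i) ^ (ofLex ((biexp lam).getD j (toLex (0, 0)))).2)

/-- The partial derivative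
`∂_{x_1}^{d(x_1)} ⋯ ∂_{x_n}^{d(x_n)} ∂_{y_1}^{d(y_1)} ⋯ ∂_{y_n}^{d(y_n)}`. -/
def dmon {n : ℕ} (d : Fin n ⊕ Fin n →₀ ℕ) : Module.End ℚ (XY n) :=
  ((List.finRange n).map fun i =>
      ((pderiv (Sum.inl i) : Derivation ℚ (XY n) (XY n)).toLinearMap : Module.End ℚ (XY n))
        ^ d (Sum.inl i)).prod *
    ((List.finRange n).map fun i =>
      ((pderiv (Sum.inr i) : Derivation ℚ (XY n) (XY n)).toLinearMap : Module.End ℚ (XY n))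
        ^ d (Sum.inr i)).prod

/-- `P ↦ P(∂)`, the differential operator obtained by replacing each variable in `P` by the
corresponding partial derivative. -/
def diffOp (n : ℕ) : XY n →ₗ[ℚ] Module.End ℚ (XY n) :=
  Finsupp.linearCombination ℚ (fun d : Fin n ⊕ Fin n →₀ ℕ => dmon d) ∘ₗ
    (basisMonomials (Fin n ⊕ Fin n) ℚ).repr.toLinearMap

/-- The Garsia–Haiman module `M_lam`, the linear span of all the partial derivatives of `Δ_lam`,
for `lam` a partition of `n`. -/
def ghM (n : ℕ) (lam : YoungDiagram) : Submodule ℚ (XY n) :=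
  Submodule.span ℚ (Set.range fun d : Fin n ⊕ Fin n →₀ ℕ => dmon d (Delta n lam))

/-- The flip map `P ↦ P(∂) Δ_lam` of `M_lam`. -/
def flipMap (n : ℕ) (lam : YoungDiagram) : XY n →ₗ[ℚ] XY n :=
  (diffOp n).flip (Delta n lam)

open Classical in
/-- The character at `σ` of the bihomogeneous component of bidegree `d` of a module `M` that is
stable under the diagonal action (and `0` if that component is not stable under `σ`). -/
def bichar {n : ℕ} (M : Submodule ℚ (XY n)) (d : ℕ × ℕ) (σ : Equiv.Perm (Fin n)) : ℚ :=
  if h : ∀ p ∈ M ⊓ bihom n d, act σ p ∈ M ⊓ bihom n d then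
    LinearMap.trace ℚ (M ⊓ bihom n d : Submodule ℚ (XY n)) ((act σ).restrict h)
  else 0

/-- The bivariate Frobenius characteristic
`F(M) = (1/n!) ∑_σ (∑_{h,k} t^h q^k char_{h,k}(σ)) p_{type(σ)}`
of a finite-dimensional bigraded module `M`. -/
def frob (n : ℕ) (M : Submodule ℚ (XY n)) : SymF :=
  C ((n.factorial : QT)⁻¹) * ∑ σ : Equiv.Perm (Fin n),
    C (∑ᶠ d : ℕ × ℕ, tt ^ d.1 * qq ^ d.2 * algebraMap ℚ QT (bichar M d σ)) *
      (σ.partition.parts.map pk).prod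

/-- `M` and `N` are isomorphic as bigraded `S_n`-modules. -/
def BigradedIso {n : ℕ} (M N : Submodule ℚ (XY n)) : Prop :=
  ∃ e : M ≃ₗ[ℚ] N,
    (∀ (σ : Equiv.Perm (Fin n)) (p p' : M), (p' : XY n) = act σ p →
      (e p' : XY n) = act σ (e p)) ∧
    ∀ (d : ℕ × ℕ) (p : M), (p : XY n) ∈ bihom n d → (e p : XY n) ∈ bihom n d

/-! ### Corners, predecessors and corner weights -/

/-- The number of rows. -/
def nRows (μ : YoungDiagram) : ℕ := μ.colLen 0

/-- The rows that end in a corner cell. -/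
def cornerRows (μ : YoungDiagram) : Finset ℕ :=
  (Finset.range (nRows μ)).filter fun r => μ.rowLen (r + 1) < μ.rowLen r

/-- The number `m` of corners. -/
def nCorners (μ : YoungDiagram) : ℕ := (cornerRows μ).card

/-- The coleg of the `i`-th corner cell.  The corners are numbered from left to right (that is,
from the top row to the bottom row), starting from `0`. -/
def coleg (μ : YoungDiagram) (i : Fin (nCorners μ)) : ℕ :=
  (cornerRows μ).orderEmbOfFin rfl i.rev

/-- The coarm of the `i`-th corner cell. -/
def coarm (μ : YoungDiagram) (i : Fin (nCorners μ)) : ℕ := μ.rowLen (coleg μ i) - 1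

/-- The diagram without the cell at the end of row `r`, when this cell is a corner
(in general, without all the cells weakly above and to the right of it). -/
def delEnd (μ : YoungDiagram) (r : ℕ) : YoungDiagram where
  cells := μ.cells.filter fun s => ¬ ((r, μ.rowLen r - 1) ≤ s)
  isLowerSet := by
    intro a b hba ha
    simp only [Finset.coe_filter, Set.mem_ofPred_eq] at ha ⊢
    exact ⟨μ.isLowerSet hba ha.1, fun h => ha.2 (h.trans hba)⟩

/-- The predecessor `α^{(i)}` of `μ`, obtained by removing the `i`-th corner cell. -/
def predec (μ : YoungDiagram) (i : Fin (nCorners μ)) : YoungDiagram := delEnd μ (coleg μ i)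

/-- `T_i = T_{α^{(i)}}`. -/
def Ti (μ : YoungDiagram) (i : Fin (nCorners μ)) : QT := Tw (predec μ i)

/-- The weights `x_0 = 1/(tq)` and `x_i = t^{l_i} q^{a_i}` for `1 ≤ i ≤ m`. -/
def xw (μ : YoungDiagram) : Fin (nCorners μ + 1) → QT :=
  Fin.cons (tt * qq)⁻¹ fun i => tt ^ coleg μ i * qq ^ coarm μ i

/-- The weights `u_0 = t^{l_1}/q`, `u_i = t^{l_{i+1}} q^{a_i}` for `1 ≤ i ≤ m - 1` and
`u_m = q^{a_m}/t`; uniformly `u_i = t^{l_{i+1}} q^{a_i}` with `a_0 = l_{m+1} = -1`. -/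
def uw (μ : YoungDiagram) (s : Fin (nCorners μ + 1)) : QT :=
  tt ^ ((Fin.snoc (fun i => (coleg μ i : ℤ)) (-1) : Fin (nCorners μ + 1) → ℤ) s) *
    qq ^ ((Fin.cons (-1) (fun i => (coarm μ i : ℤ)) : Fin (nCorners μ + 1) → ℤ) s)

/-- `Φ_μ = ∑_j (∏_{s ≠ j} 1 / (1 - T_j/T_s)) H̃_{α^{(j)}}`. -/
def PhiMu (μ : YoungDiagram) : SymF :=
  ∑ j, (∏ s ∈ Finset.univ.erase j, (1 - Ti μ j / Ti μ s)⁻¹) • Ht (predec μ j)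

/-! ### The science fiction heuristic -/

/-- The module `V_μ`, the sum of the modules `M_{α^{(i)}}`, for `μ` a partition of `n + 1`. -/
def Vmod (n : ℕ) (μ : YoungDiagram) : Submodule ℚ (XY n) := ⨆ i, ghM n (predec μ i)

/-- `M^ε`, the span of the `b ∈ B` that lie in `B_i` exactly for the `i` with `ε_i = 1`. -/
def Meps {n m : ℕ} (B : Set (XY n)) (Bi : Fin m → Set (XY n)) (ε : Fin m → Bool) :
    Submodule ℚ (XY n) :=
  Submodule.span ℚ {b | b ∈ B ∧ ∀ i, b ∈ Bi i ↔ ε i = true}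

/-- The operator `τ_i`, which complements all but the `i`-th letter of a word. -/
def tau {m : ℕ} (i : Fin m) (ε : Fin m → Bool) : Fin m → Bool :=
  fun j => if j = i then ε j else !(ε j)

/-- `B` is a bihomogeneous basis of `V_μ` (`μ` a partition of `n + 1`) with subsets `B_i` such that
`B_i` spans `M_{α^{(i)}}`, each `M^ε` is `S_n`-invariant, and
`flip_i M^ε ≅ M^{τ_i ε}` as bigraded `S_n`-modules whenever `ε_i = 1`. -/
structure IsSFBasis (n : ℕ) (μ : YoungDiagram) (B : Set (XY n))
    (Bi : Fin (nCorners μ) → Set (XY n)) : Prop where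
  bihomogeneous : ∀ b ∈ B, ∃ d, b ∈ bihom n d
  linearIndependent : LinearIndepOn ℚ id B
  span_eq : Submodule.span ℚ B = Vmod n μ
  subset : ∀ i, Bi i ⊆ B
  span_subset_eq : ∀ i, Submodule.span ℚ (Bi i) = ghM n (predec μ i)
  invariant : ∀ ε σ, ∀ p ∈ Meps B Bi ε, act σ p ∈ Meps B Bi ε
  flip : ∀ ε i, ε i = true →
    BigradedIso ((Meps B Bi ε).map (flipMap n (predec μ i))) (Meps B Bi (tau i ε))

/-! ### The Bergeron–Haiman assignment -/

/-- The assignment of a row `A` of length `a` extended by `V` to the left of the row and by `0`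
to the right of it (cells are counted from `0`). -/
def extendRow {n : ℕ} (V : Submodule ℚ (XY n)) (a : ℕ) (A : ℕ → Submodule ℚ (XY n)) (s : ℤ) :
    Submodule ℚ (XY n) :=
  if s < 0 then V else if s < (a : ℤ) then A s.toNat else ⊥

/-- The modules assigned to the cells of the row at distance `k` from the top row (`μ` a partition
of `n + 1`).  All the cells of the top row get `M_{α^{(1)}}`.  If the rows `A` and (below it) `B`
have the same length then so do their assignments agree; if `A` has length `a` and `B` has length
`b > a`, then with `c = b - a` the cell `s` of `B` gets `A'_s ∨ (A'_{s-c} ∩ M_{α^{(i)}})`, where the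
cell at the end of row `B` is the `i`-th corner. -/
def bhAux (n : ℕ) (μ : YoungDiagram) : ℕ → ℕ → Submodule ℚ (XY n)
  | 0 => fun _ => ghM n (delEnd μ (nRows μ - 1))
  | k + 1 =>
    let r := nRows μ - 1 - (k + 1)
    let a := μ.rowLen (r + 1)
    let b := μ.rowLen r
    if b = a then bhAux n μ k
    else fun s =>
      extendRow (Vmod n μ) a (bhAux n μ k) s ⊔
        (extendRow (Vmod n μ) a (bhAux n μ k) ((s : ℤ) - ((b - a : ℕ) : ℤ)) ⊓ ghM n (delEnd μ r))

/-- The module assigned to the cell `(r, s)` of `μ`. -/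
def bh (n : ℕ) (μ : YoungDiagram) (r s : ℕ) : Submodule ℚ (XY n) :=
  bhAux n μ (nRows μ - 1 - r) s

/-- `L = ∑_s q^s F(M_{r,s})`, the contribution of row `r`. -/
def rowL (n : ℕ) (μ : YoungDiagram) (r : ℕ) : SymF :=
  ∑ s ∈ Finset.range (μ.rowLen r), qq ^ s • frob n (bh n μ r s)

/-- `∑_{(i,j) ∈ μ} t^i q^j F(M_{i,j})`. -/
def bhSum (n : ℕ) (μ : YoungDiagram) : SymF :=
  ∑ c ∈ μ.cells, (tt ^ c.1 * qq ^ c.2) • frob n (bh n μ c.1 c.2)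

/-- `P` is a polynomial of degree `< m` with `L = P(∇) Φ_μ` for the row `r`. -/
def IsRowPoly (n : ℕ) (μ : YoungDiagram) (r : ℕ) (P : Polynomial QT) : Prop :=
  P.degree < (nCorners μ : WithBot ℕ) ∧ Polynomial.aeval nabla P (PhiMu μ) = rowL n μ r

/-- The polynomial
`(1/M) (T_μ/z) {∏_{s=0}^m (1 - u_s z/T_μ) - ∏_{s=0}^m (1 - x_s z/T_μ)}`, `M = (1 - 1/t)(1 - 1/q)`
(the expression in braces has constant term `0`, and `divX` divides it by `z`). -/
def finalPoly (μ : YoungDiagram) : Polynomial QT :=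
  Polynomial.C (Tw μ / ((1 - 1 / tt) * (1 - 1 / qq))) *
    ((∏ s, (1 - Polynomial.C (uw μ s / Tw μ) * Polynomial.X)) -
      ∏ s, (1 - Polynomial.C (xw μ s / Tw μ) * Polynomial.X)).divX

end ScienceFiction

end

open ScienceFiction

/-! ### Linear independence of the modified Macdonald polynomials and the action of ∇ -/

namespace ScienceFiction

open MvPolynomial

/-! Encode a word ε by the set `S` of its letters equal to 1, and let M^S be the span of the basis
elements with word `S`. The map flip_i is injective on M_{α^(i)}, complements bidegrees with respect
to the bidegree of Δ_{α^(i)} and twists the action by the sign. If i ∈ S and j ∉ S, flipping at i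
and then at j leads from `S` to S − i + j; the two signs and the two inversions of (t, q) cancel,
leaving F(M^{S−i+j}) = (T_j/T_i) F(M^S) (`IsSFBasis.frob_swap`).

This exchange relation, with the sums ∑_{S∋i} F(M^S) = H̃_{α^(i)}, determines every F(M^S) with S ≠
∅: by exchange F(M^S)/∏_{s∈S} T_s depends only on |S|, and the m sums are then m independent
conditions by Lagrange interpolation at the distinct T_i (`eq_zero_of_exchange`). The polynomials
∏_{s∉S}(−z/T_s), evaluated at ∇ and applied to Φ_μ, satisfy the same relations, so F(M^S) =
∏_{s∉S}(−∇/T_s) Φ_μ (`IsSFBasis.frob_word`). Independence of the H̃ makes P ↦ P(∇)Φ_μ injective in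
degree < m, which gives uniqueness.

Sums and intersections of spans of parts of a basis are spans of unions and intersections, so every
assigned module is given by a set of words (`IsSFBasis.bhAux_eq`). The words of a row do not
constrain the letters of lower corners; toggling such a letter i shows that keeping only the words
with i ∈ S divides the polynomial by 1 − z/T_i. With inclusion–exclusion this is the recursion
(`rowPoly_succ`).

Put D = ∏_j (1 − z/T_j). Writing (1−q)Π = D(1 − G) makes the recursion multiplicative in G, which
solves it (`algebraMap_rowPoly`). The sum over rows then telescopes (`telescoped_sum`), and the
boundary terms supply the factors of x_0 and u_m (`sum_rowPoly_eq_finalPoly`). -/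

/-- A family that is unitriangular (up to nonzero scalars) with respect to a linearly independent
family is linearly independent. -/
theorem linearIndependent_of_triangular {K V I J : Type*} [Field K] [AddCommGroup V] [Module K V]
    (r : J → J → Prop) [IsStrictOrder J r] {v : J → V} (hv : LinearIndependent K v)
    {ι : I → J} (hι : Function.Injective ι) {c : I → K} (hc : ∀ i, c i ≠ 0) {u : I → V}
    (h : ∀ i, u i - c i • v (ι i) ∈ Submodule.span K (v '' {j | r (ι i) j})) :
    LinearIndependent K u := by
  classical
  rw [linearIndependent_iff']
  intro s g hg
  by_contra! hne
  obtain ⟨i₁, hi₁s, hi₁⟩ := hne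
  set T : Finset J := (s.filter fun i => g i ≠ 0).image ι with hT
  have hTne : (T : Set J).Nonempty := ⟨ι i₁, by simp only [hT, Finset.coe_image]; exact
    ⟨i₁, by simp [hi₁s, hi₁], rfl⟩⟩
  -- Choose an `r`-minimal leading index among the terms with nonzero coefficient. It occurs in no
  -- tail by minimality and irreflexivity, and in no other leading term by injectivity of `ι`; so
  -- the relation puts `v (ι i₀)` in the span of the other vectors.
  have hwf : (T : Set J).WellFoundedOn r := T.wellFoundedOn
  obtain ⟨⟨j₀, hj₀⟩, -, hmin⟩ := hwf.has_min Set.univ ⟨⟨_, hTne.some_mem⟩, trivial⟩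
  simp only [hT, Finset.coe_image, Set.mem_image, Finset.mem_coe, Finset.mem_filter] at hj₀
  obtain ⟨i₀, ⟨hi₀s, hi₀⟩, rfl⟩ := hj₀
  have hmin' : ∀ i ∈ s, g i ≠ 0 → ¬ r (ι i) (ι i₀) := fun i his hgi =>
    hmin ⟨ι i, by simp only [hT, Finset.coe_image]; exact ⟨i, by simp [his, hgi], rfl⟩⟩ trivial
  have hsub : ∀ i ∈ s, g i ≠ 0 → u i - c i • v (ι i) ∈
      Submodule.span K (v '' {j | j ≠ ι i₀}) := fun i his hgi =>
    Submodule.span_mono (Set.image_mono fun j (hj : r (ι i) j) => by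
      rintro rfl; exact hmin' i his hgi hj) (h i)
  have hmem : ∀ i ∈ s.erase i₀, g i • u i ∈ Submodule.span K (v '' {j | j ≠ ι i₀}) := by
    intro i hi
    rw [Finset.mem_erase] at hi
    by_cases hgi : g i = 0
    · simp [hgi]
    refine Submodule.smul_mem _ _ ?_
    have := Submodule.add_mem _ (hsub i hi.2 hgi) (Submodule.smul_mem _ (c i)
      (Submodule.subset_span (s := v '' {j | j ≠ ι i₀})
        ⟨ι i, fun he => hi.1 (hι he), rfl⟩))
    simpa using this
  have key : v (ι i₀) ∈ Submodule.span K (v '' {j | j ≠ ι i₀}) := by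
    have h1 : g i₀ • u i₀ = - ∑ i ∈ s.erase i₀, g i • u i := by
      rw [eq_neg_iff_add_eq_zero, Finset.add_sum_erase s (fun i => g i • u i) hi₀s, hg]
    have h2 : u i₀ ∈ Submodule.span K (v '' {j | j ≠ ι i₀}) := by
      have : g i₀ • u i₀ ∈ Submodule.span K (v '' {j | j ≠ ι i₀}) := by
        rw [h1]; exact Submodule.neg_mem _ (Submodule.sum_mem _ hmem)
      exact (Submodule.smul_mem_iff _ hi₀).1 this
    have h3 := Submodule.sub_mem _ h2 (hsub i₀ hi₀s hi₀)
    rw [sub_sub_cancel] at h3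
    exact (Submodule.smul_mem_iff _ (hc i₀)).1 h3
  exact hv.notMem_span_image (s := {j | j ≠ ι i₀}) (by simp) key

/-! ### The complete homogeneous symmetric functions -/

/-- The span of the power sums `p_ν` with at least `k` parts. -/
noncomputable def partsGE (k : ℕ) : Submodule QT SymF :=
  Submodule.span QT ((fun d : ℕ+ →₀ ℕ => (monomial d 1 : SymF)) '' {d | k ≤ d.degree})

theorem monomial_mem_partsGE {k : ℕ} {d : ℕ+ →₀ ℕ} (h : k ≤ d.degree) :
    (monomial d 1 : SymF) ∈ partsGE k :=
  Submodule.subset_span ⟨d, h, rfl⟩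

theorem partsGE_anti {k l : ℕ} (h : k ≤ l) : partsGE l ≤ partsGE k :=
  Submodule.span_mono (Set.image_mono fun _ hd => h.trans hd)

theorem mul_mem_partsGE {k l : ℕ} {f g : SymF} (hf : f ∈ partsGE k) (hg : g ∈ partsGE l) :
    f * g ∈ partsGE (k + l) := by
  have h := Submodule.mul_mem_mul hf hg
  rw [partsGE, partsGE, Submodule.span_mul_span] at h
  refine Submodule.span_mono ?_ h
  rintro _ ⟨_, ⟨d, hd, rfl⟩, _, ⟨e, he, rfl⟩, rfl⟩
  exact ⟨d + e, by simpa using add_le_add hd he, by simp [monomial_mul]⟩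

theorem map_pk_prod_mem (s : Multiset ℕ) : (s.map pk).prod ∈ partsGE (Multiset.card s) := by
  induction s using Multiset.induction with
  | empty => simpa using monomial_mem_partsGE (d := 0) (k := 0) (by simp)
  | cons a s ih =>
    rw [Multiset.map_cons, Multiset.prod_cons, Multiset.card_cons, add_comm]
    exact mul_mem_partsGE (monomial_mem_partsGE (d := Finsupp.single a.toPNat' 1) (by simp)) ih

/-- Only the one-part partition contributes p_n, with coefficient 1/n; all other partitions of n
have at least two parts. -/
theorem hsym_sub_mem (n : ℕ+) : ∃ c : QT, c ≠ 0 ∧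
    hsym n - c • (monomial (Finsupp.single n 1) 1 : SymF) ∈ partsGE 2 := by
  classical
  refine ⟨((zee {(n : ℕ)} : QT)⁻¹), ?_, ?_⟩
  · simp [zee]
  have hn : (n : ℕ) ≠ 0 := n.ne_zero
  rw [hsym, ← Finset.add_sum_erase _ _ (Finset.mem_univ (Nat.Partition.indiscrete n)),
    Nat.Partition.indiscrete_parts hn]
  have h1 : C ((zee {(n : ℕ)} : QT)⁻¹) * (Multiset.map pk {(n : ℕ)}).prod =
      ((zee {(n : ℕ)} : QT)⁻¹) • (monomial (Finsupp.single n 1) 1 : SymF) := by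
    rw [← smul_eq_C_mul, Multiset.map_singleton, Multiset.prod_singleton]
    simp [pk, X]
  rw [h1, add_sub_cancel_left]
  refine Submodule.sum_mem _ fun ν hν => ?_
  rw [← smul_eq_C_mul]
  refine Submodule.smul_mem _ _ (partsGE_anti ?_ (map_pk_prod_mem _))
  by_contra! hlt
  refine (Finset.mem_erase.1 hν).1 ?_
  ext1
  rw [Nat.Partition.indiscrete_parts hn]
  have hs := ν.parts_sum
  interval_cases hc : Multiset.card ν.parts
  · rw [Multiset.card_eq_zero] at hc
    rw [hc] at hs
    exact absurd hs.symm hn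
  · obtain ⟨a, ha⟩ := Multiset.card_eq_one.1 hc
    rw [ha] at hs ⊢
    simpa using hs

theorem hsym_zero : hsym 0 = 1 := by
  rw [hsym, Fintype.sum_unique]
  have : (default : Nat.Partition 0).parts = 0 := by
    have := (default : Nat.Partition 0).parts_sum
    rw [Multiset.eq_zero_iff_forall_notMem]
    intro a ha
    have h1 := (default : Nat.Partition 0).parts_pos ha
    have h2 := Multiset.le_sum_of_mem ha
    omega
  rw [this]
  simp [zee]

/-- The substitution `p_k ↦ h_k`. -/
noncomputable def hSubst : SymF →ₐ[QT] SymF := aeval fun k : ℕ+ => hsym k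

/-- `h_ν`, for the partition with `d_k` parts equal to `k`. -/
noncomputable def hprod (d : ℕ+ →₀ ℕ) : SymF := hSubst (monomial d 1)

theorem hprod_add (d e : ℕ+ →₀ ℕ) : hprod (d + e) = hprod d * hprod e := by
  rw [hprod, hprod, hprod, ← map_mul, monomial_mul, one_mul]

theorem hprod_zero : hprod 0 = 1 := by simp [hprod]

theorem hprod_single (k : ℕ+) : hprod (Finsupp.single k 1) = hsym k := by
  have : (monomial (Finsupp.single k 1) 1 : SymF) = X k := rfl
  rw [hprod, this, hSubst, aeval_X]

theorem mem_partsGE_of_sub {f : SymF} {d : ℕ+ →₀ ℕ} {c : QT}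
    (h : f - c • (monomial d 1 : SymF) ∈ partsGE (d.degree + 1)) : f ∈ partsGE d.degree := by
  have := Submodule.add_mem _ (partsGE_anti (Nat.le_succ _) h)
    (Submodule.smul_mem _ c (monomial_mem_partsGE (d := d) le_rfl))
  simpa using this

/-- The filtration by number of parts is multiplicative, so the leading terms of the factors h_k,
which are multiples of p_k, multiply to a nonzero multiple of p_ν. -/
theorem hprod_sub_mem (d : ℕ+ →₀ ℕ) : ∃ c : QT, c ≠ 0 ∧
    hprod d - c • (monomial d 1 : SymF) ∈ partsGE (d.degree + 1) := by
  induction d using Finsupp.induction_linear with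
  | zero => exact ⟨1, one_ne_zero, by simp [hprod_zero]⟩
  | add a b ha hb =>
    obtain ⟨c, hc, hc'⟩ := ha
    obtain ⟨e, he, he'⟩ := hb
    refine ⟨c * e, mul_ne_zero hc he, ?_⟩
    have h1 := mul_mem_partsGE hc' (mem_partsGE_of_sub he')
    have h2 := mul_mem_partsGE
      (Submodule.smul_mem _ c (monomial_mem_partsGE (d := a) le_rfl)) he'
    have h3 := Submodule.add_mem _ (partsGE_anti (k := (a + b).degree + 1)
      (by rw [map_add]; omega) h1) (partsGE_anti (k := (a + b).degree + 1) (by rw [map_add]; omega) h2)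
    convert h3 using 1
    have : (monomial (a + b) 1 : SymF) = monomial a 1 * monomial b 1 := by
      rw [monomial_mul, one_mul]
    rw [hprod_add, this]
    simp only [smul_eq_C_mul, C_mul]
    ring
  | single k n =>
    induction n with
    | zero => exact ⟨1, one_ne_zero, by simp [hprod_zero]⟩
    | succ n ih =>
      obtain ⟨c, hc, hc'⟩ := ih
      obtain ⟨e, he, he'⟩ := hsym_sub_mem k
      rw [← hprod_single] at he'
      refine ⟨c * e, mul_ne_zero hc he, ?_⟩
      have h1 := mul_mem_partsGE hc' (mem_partsGE_of_sub (d := Finsupp.single k 1)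
        (by simpa using he'))
      have h2 := mul_mem_partsGE (Submodule.smul_mem _ c
        (monomial_mem_partsGE (d := Finsupp.single k n) le_rfl)) he'
      have h3 := Submodule.add_mem _ (partsGE_anti (k := n + 1 + 1)
        (by simp) h1) (partsGE_anti (k := n + 1 + 1) (by simp) h2)
      rw [Finsupp.degree_single]
      convert h3 using 1
      have : (monomial (Finsupp.single k (n + 1)) 1 : SymF) =
          monomial (Finsupp.single k n) 1 * monomial (Finsupp.single k 1) 1 := by
        rw [monomial_mul, one_mul, Finsupp.single_add]
      rw [Finsupp.single_add, hprod_add, ← Finsupp.single_add, this]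
      simp only [smul_eq_C_mul, C_mul]
      ring

instance {J : Type*} (f : J → ℕ) : IsStrictOrder J (fun a b => f a < f b) where
  irrefl _ := lt_irrefl _
  trans _ _ _ := lt_trans

theorem linearIndependent_hprod : LinearIndependent QT hprod := by
  choose c hc hc' using hprod_sub_mem
  exact linearIndependent_of_triangular (fun a b : ℕ+ →₀ ℕ => a.degree < b.degree)
    (basisMonomials ℕ+ QT).linearIndependent Function.injective_id hc fun d => by
      simpa [partsGE, Nat.succ_le_iff] using hc' d

/-! ### Linear independence of the Schur functions -/

/-- The exponent vector of `h_k`. -/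
noncomputable def partExp (k : ℤ) : ℕ+ →₀ ℕ := if 0 < k then Finsupp.single k.toNat.toPNat' 1 else 0

/-- The sum of the squares of the parts. -/
noncomputable def sqSum : (ℕ+ →₀ ℕ) →+ ℕ := Finsupp.liftAddHom fun k => AddMonoidHom.mulRight ((k : ℕ) ^ 2)

theorem sqSum_partExp {k : ℤ} (hk : 0 ≤ k) : (sqSum (partExp k) : ℤ) = k ^ 2 := by
  rw [partExp]
  split_ifs with h
  · have h1 : (k.toNat.toPNat' : ℕ) = k.toNat := by
      rw [Nat.toPNat'_coe, if_pos (by omega)]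
    rw [sqSum, Finsupp.liftAddHom_apply_single, AddMonoidHom.mulRight_apply, one_mul, h1]
    push_cast
    rw [Int.toNat_of_nonneg hk]
  · have : k = 0 := by omega
    simp [this]

theorem hInt_eq {k : ℤ} (hk : 0 ≤ k) : hInt k = hprod (partExp k) := by
  rw [hInt, if_neg (by omega), partExp]
  split_ifs with h
  · rw [hprod_single, Nat.toPNat'_coe, if_pos (by omega)]
  · have : k = 0 := by omega
    rw [this, hprod_zero]
    exact hsym_zero

theorem prod_hInt {ι : Type*} (s : Finset ι) (k : ι → ℤ) :
    (∀ i ∈ s, 0 ≤ k i) → ∏ i ∈ s, hInt (k i) = hprod (∑ i ∈ s, partExp (k i)) := by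
  classical
  induction s using Finset.induction_on with
  | empty => simp [hprod_zero]
  | insert a s ha ih =>
    intro h
    rw [Finset.prod_insert ha, Finset.sum_insert ha, hprod_add, hInt_eq (h a (by simp)),
      ih fun i hi => h i (by simp [hi])]

/-- The exponent vector of `h_lam`. -/
noncomputable def shape (lam : YoungDiagram) : ℕ+ →₀ ℕ :=
  ∑ i : Fin (lam.colLen 0), partExp (lam.rowLen i)

theorem shape_apply (lam : YoungDiagram) (k : ℕ+) : shape lam k = lam.rowLens.count (k : ℕ) := by
  have h1 : shape lam = (lam.rowLens.map fun n : ℕ => partExp n).sum := by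
    rw [shape, YoungDiagram.rowLens, List.map_map,
      Fin.sum_univ_eq_sum_range fun i => partExp (lam.rowLen i)]
    rfl
  rw [h1]
  generalize lam.rowLens = L
  induction L with
  | nil => simp
  | cons a L ih =>
    rw [List.map_cons, List.sum_cons, Finsupp.add_apply, ih, List.count_cons, add_comm]
    congr 1
    rw [partExp]
    by_cases ha : 0 < a
    · rw [if_pos (by exact_mod_cast ha), Finsupp.single_apply]
      refine if_congr ?_ rfl rfl
      rw [Int.toNat_natCast, ← PNat.coe_inj, Nat.toPNat'_coe, if_pos ha, beq_iff_eq]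
    · have : a = 0 := by omega
      subst this
      simp [k.ne_zero.symm]

theorem shape_injective : Function.Injective shape := by
  intro lam ν h
  have : lam.rowLens = ν.rowLens := by
    refine List.Perm.eq_of_sortedGE lam.rowLens_sorted ν.rowLens_sorted ?_
    rw [List.perm_iff_count]
    intro a
    by_cases ha : 0 < a
    · have h1 := shape_apply lam ⟨a, ha⟩
      rw [h] at h1
      exact h1.symm.trans (shape_apply ν ⟨a, ha⟩)
    · have h0 : ∀ κ : YoungDiagram, List.count a κ.rowLens = 0 := fun κ =>
        List.count_eq_zero_of_not_mem fun hm => ha (κ.pos_of_mem_rowLens a hm)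
      rw [h0, h0]
  have h2 : YoungDiagram.equivListRowLens lam = YoungDiagram.equivListRowLens ν :=
    Subtype.ext this
  exact YoungDiagram.equivListRowLens.injective h2

theorem perm_eq_one_of_monotone {n : ℕ} {σ : Equiv.Perm (Fin n)}
    (h : ∀ i j, σ i < σ j → i ≤ j) : σ = 1 := by
  have hm : StrictMono σ.symm := by
    intro a b hab
    refine lt_of_le_of_ne (h _ _ (by simpa using hab)) fun he => hab.ne (σ.symm.injective he)
  have h1 : (hm.orderIsoOfSurjective _ σ.symm.surjective) = OrderIso.refl (Fin n) :=
    Subsingleton.elim _ _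
  ext i
  have h2 := DFunLike.congr_fun h1 (σ i)
  simp only [StrictMono.coe_orderIsoOfSurjective, Equiv.symm_apply_apply, OrderIso.refl_apply] at h2
  rw [← h2]
  rfl

/-- Expand the Jacobi–Trudi determinant: σ = 1 gives h_lam, and σ gives the product of the h with
indices (lam_i − i) + σ(i). Since lam_i − i strictly decreases while i increases, the rearrangement
inequality makes ∑ (lam_i − i)σ(i), hence the sum of the squared indices, strictly larger for σ ≠ 1.
-/
theorem schur_sub_mem (lam : YoungDiagram) : schur lam - (1 : QT) • hprod (shape lam) ∈
    Submodule.span QT (hprod '' {e | sqSum (shape lam) < sqSum e}) := by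
  rw [schur, ← Matrix.det_transpose, Matrix.det_apply,
    ← Finset.add_sum_erase _ _ (Finset.mem_univ (1 : Equiv.Perm (Fin (lam.colLen 0))))]
  have h1 : (∏ i : Fin (lam.colLen 0), hInt ((lam.rowLen i : ℤ) - (i : ℤ) + (i : ℤ))) =
      hprod (shape lam) := by
    simp only [sub_add_cancel]
    rw [prod_hInt _ _ (by simp), shape]
  simp only [Matrix.transpose_apply, Matrix.of_apply, Equiv.Perm.sign_one, one_smul,
    Equiv.Perm.one_apply, h1, add_sub_cancel_left]
  refine Submodule.sum_mem _ fun σ hσ => ?_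
  rw [Units.smul_def, ← Int.cast_smul_eq_zsmul QT]
  refine Submodule.smul_mem _ _ ?_
  -- A negative index makes the whole term vanish; otherwise the term is an honest h_ν.
  by_cases hneg : ∃ i : Fin (lam.colLen 0), (lam.rowLen i : ℤ) - (i : ℤ) + (σ i : ℤ) < 0
  · obtain ⟨i, hi⟩ := hneg
    rw [Finset.prod_eq_zero (Finset.mem_univ i) (by rw [hInt, if_pos hi])]
    exact Submodule.zero_mem _
  push Not at hneg
  rw [prod_hInt _ _ fun i _ => hneg i]
  refine Submodule.subset_span ⟨_, ?_, rfl⟩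
  rw [Set.mem_ofPred_eq, ← Int.ofNat_lt, shape, map_sum, map_sum]
  push_cast
  rw [Finset.sum_congr rfl fun i _ => sqSum_partExp (hneg i),
    Finset.sum_congr rfl fun (i : Fin (lam.colLen 0)) _ =>
      sqSum_partExp (k := (lam.rowLen i : ℤ)) (by positivity)]
  have hf : StrictAnti fun i : Fin (lam.colLen 0) => (lam.rowLen i : ℤ) - (i : ℤ) := by
    intro i j hij
    have h2 := lam.rowLen_anti i j hij.le
    have h3 : (i : ℕ) < j := hij
    simp only
    omega
  have hg : StrictMono fun i : Fin (lam.colLen 0) => (i : ℤ) := fun i j hij => by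
    have h3 : (i : ℕ) < j := hij
    simp only
    omega
  have hav : Antivary (fun i : Fin (lam.colLen 0) => (lam.rowLen i : ℤ) - (i : ℤ))
      fun i => (i : ℤ) := fun i j hij => hf.antitone (hg.lt_iff_lt.1 hij).le
  have key := (hav.sum_mul_lt_sum_mul_comp_perm_iff (σ := σ)).2 fun hanti => by
    refine (Finset.mem_erase.1 hσ).1 (perm_eq_one_of_monotone fun i j hij => ?_)
    exact hf.le_iff_ge.1 (hanti (hg hij))
  have hsq : ∑ i : Fin (lam.colLen 0), ((σ i : ℕ) : ℤ) ^ 2 = ∑ i : Fin (lam.colLen 0), ((i : ℕ) : ℤ) ^ 2 :=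
    Equiv.sum_comp σ fun i : Fin (lam.colLen 0) => ((i : ℕ) : ℤ) ^ 2
  have e1 : ∑ i : Fin (lam.colLen 0), ((lam.rowLen i : ℤ) - (i : ℤ) + (σ i : ℤ)) ^ 2 =
      ∑ i : Fin (lam.colLen 0), ((lam.rowLen i : ℤ) - (i : ℤ)) ^ 2 + ∑ i : Fin (lam.colLen 0), ((σ i : ℕ) : ℤ) ^ 2
        + 2 * ∑ i : Fin (lam.colLen 0), ((lam.rowLen i : ℤ) - (i : ℤ)) * (σ i : ℤ) := by
    rw [Finset.mul_sum, ← Finset.sum_add_distrib, ← Finset.sum_add_distrib]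
    exact Finset.sum_congr rfl fun i _ => by ring
  have e2 : ∑ i : Fin (lam.colLen 0), (lam.rowLen i : ℤ) ^ 2 =
      ∑ i : Fin (lam.colLen 0), ((lam.rowLen i : ℤ) - (i : ℤ)) ^ 2 + ∑ i : Fin (lam.colLen 0), ((i : ℕ) : ℤ) ^ 2
        + 2 * ∑ i : Fin (lam.colLen 0), ((lam.rowLen i : ℤ) - (i : ℤ)) * (i : ℤ) := by
    rw [Finset.mul_sum, ← Finset.sum_add_distrib, ← Finset.sum_add_distrib]
    exact Finset.sum_congr rfl fun i _ => by ring
  rw [e1, e2, hsq]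
  simp only [smul_eq_mul] at key
  linarith

theorem linearIndependent_schur : LinearIndependent QT schur :=
  linearIndependent_of_triangular (fun a b : ℕ+ →₀ ℕ => sqSum a < sqSum b)
    linearIndependent_hprod shape_injective (fun _ => one_ne_zero) schur_sub_mem

/-! ### Linear independence of the modified Macdonald polynomials -/

theorem rowLen_injective {lam ν : YoungDiagram} (h : ∀ k, lam.rowLen k = ν.rowLen k) :
    lam = ν := by
  ext ⟨i, j⟩
  rw [YoungDiagram.mem_cells, YoungDiagram.mem_cells, YoungDiagram.mem_iff_lt_rowLen,
    YoungDiagram.mem_iff_lt_rowLen, h]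

instance : IsStrictOrder YoungDiagram (fun lam ν => DomLT ν lam) where
  irrefl _ h := h.2.1 rfl
  trans a b c hab hbc := by
    refine ⟨hbc.1.trans hab.1, ?_, fun k => (hbc.2.2 k).trans (hab.2.2 k)⟩
    rintro rfl
    have hs : ∀ k, ∑ i ∈ Finset.range k, c.rowLen i = ∑ i ∈ Finset.range k, b.rowLen i :=
      fun k => le_antisymm (hbc.2.2 k) (hab.2.2 k)
    refine hbc.2.1 (rowLen_injective fun k => ?_)
    have h1 := hs (k + 1)
    rw [Finset.sum_range_succ, Finset.sum_range_succ, hs k] at h1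
    omega

/-- Triangularity alone suffices. The conclusion therefore applies to `macP` whichever family the
choice operator returns, and the existence of an orthogonal family is not needed. -/
theorem UnitriFamily.linearIndependent (P : UnitriFamily) : LinearIndependent QT P.1 :=
  linearIndependent_of_triangular (fun lam ν => DomLT ν lam) linearIndependent_schur
    Function.injective_id (fun _ => one_ne_zero) fun lam => by
      have := P.2 lam
      rw [one_smul, id_eq]
      have he : schur '' {j | DomLT j lam} = {f | ∃ ν, DomLT ν lam ∧ f = schur ν} := by
        ext f
        constructor
        · rintro ⟨ν, hν, rfl⟩; exact ⟨ν, hν, rfl⟩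
        · rintro ⟨ν, hν, rfl⟩; exact ⟨ν, hν, rfl⟩
      rwa [he]

theorem linearIndependent_macP (q t : QT) : LinearIndependent QT (macP q t) :=
  UnitriFamily.linearIndependent _

theorem qq_ne_zero : qq ≠ 0 := by
  rw [qq, Ne, IsFractionRing.to_map_eq_zero_iff]
  exact X_ne_zero 0

theorem tt_ne_zero : tt ≠ 0 := by
  rw [tt, Ne, IsFractionRing.to_map_eq_zero_iff]
  exact X_ne_zero 1

theorem tt_pow_mul_qq_pow_inj {a b c d : ℕ} (h : tt ^ a * qq ^ b = tt ^ c * qq ^ d) :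
    a = c ∧ b = d := by
  have h1 : (X 1 ^ a * X 0 ^ b : MvPolynomial (Fin 2) ℚ) = X 1 ^ c * X 0 ^ d := by
    apply IsFractionRing.injective (MvPolynomial (Fin 2) ℚ) QT
    simpa only [map_mul, map_pow, tt, qq] using h
  simp only [X_pow_eq_monomial, monomial_mul, one_mul] at h1
  have h2 := monomial_left_injective (one_ne_zero) h1
  exact ⟨by simpa using DFunLike.congr_fun h2 1, by simpa using DFunLike.congr_fun h2 0⟩

theorem tt_pow_mul_qq_pow_ne_one {a b : ℕ} (h : a ≠ 0 ∨ b ≠ 0) : tt ^ a * qq ^ b ≠ 1 := fun he => by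
  have := tt_pow_mul_qq_pow_inj (c := 0) (d := 0) (he.trans (by simp))
  omega

theorem tt_pow_ne_qq_pow {a b : ℕ} (h : a ≠ 0 ∨ b ≠ 0) : tt ^ a ≠ qq ^ b := fun he => by
  have := tt_pow_mul_qq_pow_inj (a := a) (b := 0) (c := 0) (d := b) (by simpa using he)
  omega

theorem plethDiv_injective {t : QT} (ht : ∀ k : ℕ+, 1 - t ^ (k : ℕ) ≠ 0) :
    Function.Injective (plethDiv t) := by
  set ψ : SymF →ₐ[QT] SymF := aeval fun k : ℕ+ => C (1 - t ^ (k : ℕ)) * X k with hψ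
  have h1 : ψ.comp (plethDiv t) = AlgHom.id QT SymF := by
    refine algHom_ext fun k => ?_
    rw [AlgHom.comp_apply, plethDiv, aeval_X, map_mul, hψ, aeval_X, ← algebraMap_eq,
      AlgHom.commutes, algebraMap_eq, ← mul_assoc, ← C_mul, inv_mul_cancel₀ (ht k), C_1, one_mul,
      AlgHom.id_apply]
  have h2 : ∀ f, ψ (plethDiv t f) = f := fun f => by
    rw [← AlgHom.comp_apply, h1, AlgHom.id_apply]
  intro f g hfg
  rw [← h2 f, hfg, h2]

theorem linearIndependent_Ht : LinearIndependent QT Ht := by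
  have hk : ∀ k : ℕ+, 1 - tt⁻¹ ^ (k : ℕ) ≠ 0 := fun k h => by
    rw [sub_eq_zero, inv_pow, eq_comm, inv_eq_one] at h
    exact tt_pow_mul_qq_pow_ne_one (a := k) (b := 0) (Or.inl k.ne_zero) (by simpa using h)
  have hh : ∀ lam, tt ^ nStat lam * hookH qq tt⁻¹ lam ≠ 0 := fun lam => by
    refine mul_ne_zero (pow_ne_zero _ tt_ne_zero) (Finset.prod_ne_zero_iff.2 fun s _ h => ?_)
    rw [sub_eq_zero, inv_pow, eq_comm, mul_inv_eq_one₀ (pow_ne_zero _ tt_ne_zero)] at h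
    exact tt_pow_ne_qq_pow (Or.inl (Nat.succ_ne_zero _)) h.symm
  have h1 : LinearIndependent QT (plethDiv tt⁻¹ ∘ macP qq tt⁻¹) :=
    (linearIndependent_macP qq tt⁻¹).map' (plethDiv tt⁻¹).toLinearMap
      (LinearMap.ker_eq_bot.2 (plethDiv_injective hk))
  have h2 := h1.units_smul fun lam => Units.mk0 _ (hh lam)
  convert h2 using 1
  ext1 lam
  rw [Pi.smul_apply', Units.smul_def, Units.val_mk0, Ht, macH, macJ, map_mul, algHom_C,
    algebraMap_eq, ← mul_assoc, ← C_mul, smul_eq_C_mul, Function.comp_apply]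

/-- The choice defining `nabla` is not vacuous, because the H̃_lam are independent. Only this
eigenvalue property is used later. -/
theorem nabla_Ht (lam : YoungDiagram) : nabla (Ht lam) = Tw lam • Ht lam := by
  classical
  have hex : ∃ D : SymF →ₗ[QT] SymF, ∀ lam, D (Ht lam) = Tw lam • Ht lam := by
    -- Extend the H̃_lam to a basis and prescribe the value 0 on the added vectors.
    refine ⟨(Module.Basis.extend linearIndependent_Ht.linearIndepOn_id).constr QT fun f =>
      if h : ∃ lam, Ht lam = f then Tw h.choose • (f : SymF) else 0, fun lam => ?_⟩
    have h1 := Module.Basis.extend_apply_self linearIndependent_Ht.linearIndepOn_id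
      ⟨Ht lam, Module.Basis.subset_extend _ ⟨lam, rfl⟩⟩
    have hx : ∃ ν, Ht ν = Ht lam := ⟨lam, rfl⟩
    refine (congrArg _ h1.symm).trans ?_
    rw [Module.Basis.constr_basis]
    refine (dif_pos hx).trans ?_
    rw [linearIndependent_Ht.injective hx.choose_spec]
  exact Classical.epsilon_spec hex lam

theorem aeval_nabla_Ht (P : Polynomial QT) (lam : YoungDiagram) :
    Polynomial.aeval nabla P (Ht lam) = P.eval (Tw lam) • Ht lam := by
  induction P using Polynomial.induction_on' with
  | add p q hp hq => rw [map_add, LinearMap.add_apply, hp, hq, Polynomial.eval_add, add_smul]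
  | monomial k a =>
    have hpow : ∀ k, (nabla ^ k) (Ht lam) = Tw lam ^ k • Ht lam := fun k => by
      induction k with
      | zero => simp
      | succ k ih => rw [pow_succ', Module.End.mul_apply, ih, map_smul, nabla_Ht, smul_smul, pow_succ]
    rw [Polynomial.aeval_monomial, Module.End.mul_apply, hpow, Polynomial.eval_monomial,
      Module.algebraMap_end_apply, smul_smul]

end ScienceFiction

/-! ### Garsia–Haiman modules: differential operators, the flip maps, bidegrees -/

namespace ScienceFiction

open MvPolynomial

/-! ### Normalized coefficients and differential operators -/

variable {n : ℕ}

/-- `e! = ∏_v e_v!`. -/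
def fac (e : Fin n ⊕ Fin n →₀ ℕ) : ℚ := ∏ v, ((e v).factorial : ℚ)

theorem fac_pos (e : Fin n ⊕ Fin n →₀ ℕ) : 0 < fac e :=
  Finset.prod_pos fun v _ => by exact_mod_cast (e v).factorial_pos

theorem fac_add_single (e : Fin n ⊕ Fin n →₀ ℕ) (i : Fin n ⊕ Fin n) :
    fac (e + Finsupp.single i 1) = fac e * (e i + 1) := by
  rw [fac, fac, ← Finset.mul_prod_erase _ _ (Finset.mem_univ i),
    ← Finset.mul_prod_erase Finset.univ (fun v => ((e v).factorial : ℚ)) (Finset.mem_univ i)]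
  rw [Finset.prod_congr rfl fun v hv => by
    rw [Finsupp.add_apply, Finsupp.single_eq_of_ne (Finset.ne_of_mem_erase hv), add_zero]]
  rw [Finsupp.add_apply, Finsupp.single_eq_same, Nat.factorial_succ]
  push_cast
  ring

/-- The coefficient of `x^e / e!`. -/
noncomputable def nc (e : Fin n ⊕ Fin n →₀ ℕ) : XY n →ₗ[ℚ] ℚ := fac e • lcoeff ℚ e

theorem nc_apply (e : Fin n ⊕ Fin n →₀ ℕ) (P : XY n) : nc e P = fac e * coeff e P := rfl

theorem nc_ne_zero_iff {e : Fin n ⊕ Fin n →₀ ℕ} {P : XY n} : nc e P ≠ 0 ↔ coeff e P ≠ 0 := by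
  rw [nc_apply, mul_ne_zero_iff, and_iff_right (fac_pos e).ne']

theorem nc_ext {P Q : XY n} (h : ∀ e, nc e P = nc e Q) : P = Q := by
  ext e
  exact mul_left_cancel₀ (fac_pos e).ne' (h e)

/-- The operator `D` shifts normalized coefficients by `f`. -/
def IsShift (D : Module.End ℚ (XY n)) (f : Fin n ⊕ Fin n →₀ ℕ) : Prop :=
  ∀ e P, nc e (D P) = nc (e + f) P

theorem IsShift.one : IsShift (1 : Module.End ℚ (XY n)) 0 := fun e P => by simp

theorem IsShift.mul {D E : Module.End ℚ (XY n)} {f g : Fin n ⊕ Fin n →₀ ℕ} (hD : IsShift D f)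
    (hE : IsShift E g) : IsShift (D * E) (f + g) := fun e P => by
  rw [Module.End.mul_apply, hD, hE, add_assoc]

theorem IsShift.pow {D : Module.End ℚ (XY n)} {f : Fin n ⊕ Fin n →₀ ℕ} (hD : IsShift D f) (k : ℕ) :
    IsShift (D ^ k) (k • f) := by
  induction k with
  | zero => rw [pow_zero, zero_smul]; exact IsShift.one
  | succ k ih => rw [pow_succ, succ_nsmul]; exact ih.mul hD

theorem IsShift.list_prod {ι : Type*} {D : ι → Module.End ℚ (XY n)}
    {f : ι → Fin n ⊕ Fin n →₀ ℕ} (h : ∀ i, IsShift (D i) (f i)) (L : List ι) :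
    IsShift (L.map D).prod (L.map f).sum := by
  induction L with
  | nil => exact IsShift.one
  | cons a L ih => rw [List.map_cons, List.map_cons, List.prod_cons, List.sum_cons]
                   exact (h a).mul ih

theorem isShift_pderiv (i : Fin n ⊕ Fin n) :
    IsShift ((pderiv i : Derivation ℚ (XY n) (XY n)).toLinearMap : Module.End ℚ (XY n))
      (Finsupp.single i 1) := fun e P => by
  rw [nc_apply, nc_apply, fac_add_single, Derivation.coeFn_coe, coeff_pderiv]
  ring

theorem isShift_dmon (d : Fin n ⊕ Fin n →₀ ℕ) : IsShift (dmon d) d := by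
  have h := (IsShift.list_prod (fun i => (isShift_pderiv (Sum.inl i)).pow (d (Sum.inl i)))
    (List.finRange n)).mul (IsShift.list_prod
      (fun i => (isShift_pderiv (Sum.inr i)).pow (d (Sum.inr i))) (List.finRange n))
  have hd : d = ((List.finRange n).map fun i => d (Sum.inl i) • Finsupp.single (Sum.inl i) 1).sum +
      ((List.finRange n).map fun i => d (Sum.inr i) • Finsupp.single (Sum.inr i) 1).sum := by
    rw [← List.ofFn_eq_map, ← List.ofFn_eq_map, List.sum_ofFn, List.sum_ofFn]
    conv_lhs => rw [← Finsupp.univ_sum_single d]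
    rw [Fintype.sum_sum_type]
    simp only [Finsupp.smul_single, smul_eq_mul, mul_one]
  rw [← hd] at h
  exact h

/-- With x^e/e! as basis, differentiation is a pure translation of exponents. Commutativity and
equivariance of the operators thereby reduce to identities between exponents. -/
theorem nc_dmon (d e : Fin n ⊕ Fin n →₀ ℕ) (P : XY n) : nc e (dmon d P) = nc (e + d) P :=
  isShift_dmon d e P

theorem dmon_comm (d e : Fin n ⊕ Fin n →₀ ℕ) (P : XY n) :
    dmon d (dmon e P) = dmon e (dmon d P) :=
  nc_ext fun f => by rw [nc_dmon, nc_dmon, nc_dmon, nc_dmon, add_right_comm]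

theorem diffOp_monomial (d : Fin n ⊕ Fin n →₀ ℕ) (c : ℚ) :
    diffOp n (monomial d c) = c • dmon d := by
  have h1 : diffOp n (monomial d 1) = dmon d := by
    have h2 : (monomial d 1 : XY n) = basisMonomials (Fin n ⊕ Fin n) ℚ d :=
      (congrFun (coe_basisMonomials (Fin n ⊕ Fin n) ℚ) d).symm
    rw [h2, diffOp, LinearMap.comp_apply, LinearEquiv.coe_coe,
      Module.Basis.repr_self, Finsupp.linearCombination_single, one_smul]
  rw [← h1, ← map_smul, smul_monomial, smul_eq_mul, mul_one]

theorem diffOp_eq_sum (Q P : XY n) :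
    diffOp n Q P = ∑ d ∈ Q.support, coeff d Q • dmon d P := by
  conv_lhs => rw [Q.as_sum]
  simp only [map_sum, diffOp_monomial, LinearMap.sum_apply, LinearMap.smul_apply]

theorem nc_diffOp (Q P : XY n) (e : Fin n ⊕ Fin n →₀ ℕ) :
    nc e (diffOp n Q P) = ∑ d ∈ Q.support, coeff d Q * nc (e + d) P := by
  rw [diffOp_eq_sum, map_sum]
  exact Finset.sum_congr rfl fun d _ => by rw [map_smul, nc_dmon, smul_eq_mul]

theorem diffOp_comm (P Q R : XY n) : diffOp n P (diffOp n Q R) = diffOp n Q (diffOp n P R) := by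
  simp only [diffOp_eq_sum _ R, map_sum, map_smul]
  simp only [diffOp_eq_sum, Finset.smul_sum]
  rw [Finset.sum_comm]
  refine Finset.sum_congr rfl fun d _ => Finset.sum_congr rfl fun e _ => ?_
  rw [dmon_comm, smul_comm]

/-- The constant term of P(∂)P is ∑ d!·c_d², a positive definite form over ℚ. -/
theorem eq_zero_of_diffOp_self {P : XY n} (h : diffOp n P P = 0) : P = 0 := by
  have h1 : ∑ d ∈ P.support, coeff d P * (fac d * coeff d P) = 0 := by
    have := nc_diffOp P P 0
    rw [h, map_zero] at this
    simpa [nc_apply] using this.symm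
  rw [Finset.sum_eq_zero_iff_of_nonneg fun d _ => by
    have := (fac_pos d).le
    have h2 : coeff d P * (fac d * coeff d P) = fac d * (coeff d P) ^ 2 := by ring
    rw [h2]; positivity] at h1
  rw [← support_eq_empty, Finset.eq_empty_iff_forall_notMem]
  intro d hd
  have h2 := h1 d hd
  have h3 := mem_support_iff.1 hd
  exact mul_ne_zero h3 (mul_ne_zero (fac_pos d).ne' h3) h2

/-- Write P = Q(∂)Δ. If P(∂)Δ = 0, then P(∂)P = Q(∂)P(∂)Δ = 0, hence P = 0. This is the injectivity
of the flip on M_lam. -/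
theorem flipMap_eq_zero {lam : YoungDiagram} {P : XY n} (hP : P ∈ ghM n lam)
    (h : flipMap n lam P = 0) : P = 0 := by
  have h1 : ghM n lam ≤ LinearMap.range (flipMap n lam) := by
    rw [ghM, Submodule.span_le]
    rintro _ ⟨d, rfl⟩
    exact ⟨monomial d 1, by rw [flipMap, LinearMap.flip_apply, diffOp_monomial, one_smul]⟩
  obtain ⟨Q, rfl⟩ := h1 hP
  refine eq_zero_of_diffOp_self ?_
  have h2 : diffOp n (diffOp n Q (Delta n lam)) (Delta n lam) = 0 := h
  change diffOp n (diffOp n Q (Delta n lam)) (diffOp n Q (Delta n lam)) = 0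
  rw [diffOp_comm, h2, map_zero]

/-! ### The diagonal action -/

theorem sumMap_injective (σ : Equiv.Perm (Fin n)) : Function.Injective (Sum.map σ σ) :=
  σ.injective.sumMap σ.injective

theorem nc_act (σ : Equiv.Perm (Fin n)) (e : Fin n ⊕ Fin n →₀ ℕ) (P : XY n) :
    nc (e.mapDomain (Sum.map σ σ)) (act σ P) = nc e P := by
  have h1 : fac (e.mapDomain (Sum.map σ σ)) = fac e := by
    rw [fac, fac, ← Equiv.prod_comp (Equiv.sumCongr σ σ)]
    refine Finset.prod_congr rfl fun v _ => ?_
    rw [Equiv.sumCongr_apply, Finsupp.mapDomain_apply (sumMap_injective σ)]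
  rw [nc_apply, nc_apply, h1, act, AlgHom.toLinearMap_apply,
    coeff_rename_mapDomain _ (sumMap_injective σ)]

theorem exists_mapDomain_eq (σ : Equiv.Perm (Fin n)) (e : Fin n ⊕ Fin n →₀ ℕ) :
    ∃ f : Fin n ⊕ Fin n →₀ ℕ, f.mapDomain (Sum.map σ σ) = e :=
  ⟨e.mapDomain (Equiv.sumCongr σ σ).symm, by
    have h : Sum.map σ σ ∘ (Equiv.sumCongr σ σ).symm = id :=
      funext fun v => (Equiv.sumCongr σ σ).apply_symm_apply v
    rw [← Finsupp.mapDomain_comp, h, Finsupp.mapDomain_id]⟩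

theorem act_dmon (σ : Equiv.Perm (Fin n)) (d : Fin n ⊕ Fin n →₀ ℕ) (P : XY n) :
    act σ (dmon d P) = dmon (d.mapDomain (Sum.map σ σ)) (act σ P) := by
  refine nc_ext fun e => ?_
  obtain ⟨f, rfl⟩ := exists_mapDomain_eq σ e
  rw [nc_act, nc_dmon, nc_dmon, ← Finsupp.mapDomain_add, nc_act]

theorem act_diffOp (σ : Equiv.Perm (Fin n)) (Q P : XY n) :
    act σ (diffOp n Q P) = diffOp n (act σ Q) (act σ P) := by
  induction Q using MvPolynomial.induction_on' with
  | add p q hp hq => simp only [map_add, LinearMap.add_apply, hp, hq]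
  | monomial d c =>
    rw [diffOp_monomial, LinearMap.smul_apply, map_smul, act_dmon]
    conv_rhs => rw [act, AlgHom.toLinearMap_apply, rename_monomial, diffOp_monomial]
    rfl

theorem act_Delta (σ : Equiv.Perm (Fin n)) (lam : YoungDiagram) :
    act σ (Delta n lam) = ((Equiv.Perm.sign σ : ℤ) : ℚ) • Delta n lam := by
  rw [act, AlgHom.toLinearMap_apply, Delta, AlgHom.map_det]
  have h := Matrix.det_permute σ (Matrix.of fun i j : Fin n =>
    (X (Sum.inl i) : XY n) ^ (ofLex ((biexp lam).getD j (toLex (0, 0)))).1 *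
      X (Sum.inr i) ^ (ofLex ((biexp lam).getD j (toLex (0, 0)))).2)
  rw [Int.cast_smul_eq_zsmul, zsmul_eq_mul, ← h]
  congr 1
  ext1 i j
  simp

theorem act_flipMap (σ : Equiv.Perm (Fin n)) (lam : YoungDiagram) (P : XY n) :
    flipMap n lam (act σ P) = ((Equiv.Perm.sign σ : ℤ) : ℚ) • act σ (flipMap n lam P) := by
  rw [flipMap, LinearMap.flip_apply, LinearMap.flip_apply, act_diffOp, act_Delta, map_smul,
    smul_smul, ← Int.cast_mul]
  simp

/-! ### Bidegrees -/

/-- The bidegrees of the variables. -/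
abbrev wvar (n : ℕ) : Fin n ⊕ Fin n → ℕ × ℕ :=
  Sum.elim (fun _ => ((1, 0) : ℕ × ℕ)) (fun _ => ((0, 1) : ℕ × ℕ))

theorem mem_bihom {d : ℕ × ℕ} {P : XY n} :
    P ∈ bihom n d ↔ ∀ e, coeff e P ≠ 0 → Finsupp.weight (wvar n) e = d :=
  ⟨fun h _ he => h he, fun h e he => h e he⟩

theorem act_mem_bihom {d : ℕ × ℕ} {P : XY n} (hP : P ∈ bihom n d) (σ : Equiv.Perm (Fin n)) :
    act σ P ∈ bihom n d := by
  rw [mem_bihom] at hP ⊢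
  intro e he
  obtain ⟨f, rfl⟩ := exists_mapDomain_eq σ e
  rw [← nc_ne_zero_iff, nc_act, nc_ne_zero_iff] at he
  rw [← hP f he, Finsupp.weight_apply, Finsupp.weight_apply,
    Finsupp.sum_mapDomain_index (by simp) (by intros; rw [add_smul])]
  refine Finsupp.sum_congr fun v _ => ?_
  cases v <;> rfl

/-- The bidegree of `Δ_lam`. -/
def bideg (lam : YoungDiagram) : ℕ × ℕ := ∑ s ∈ lam.cells, s

theorem Tw_eq (lam : YoungDiagram) : Tw lam = tt ^ (bideg lam).1 * qq ^ (bideg lam).2 := by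
  rw [Tw, Finset.prod_mul_distrib, Finset.prod_pow_eq_pow_sum, Finset.prod_pow_eq_pow_sum, bideg,
    Prod.fst_sum, Prod.snd_sum]

theorem Delta_mem_bihom {lam : YoungDiagram} (h : lam.card = n) :
    Delta n lam ∈ bihom n (bideg lam) := by
  -- The cardinality hypothesis guarantees that the default value of `getD` in `Delta` is never
  -- used.
  have hlen : (biexp lam).length = n := by rw [biexp, Finset.length_sort, Finset.card_map, ← h]
  have hsum : ∑ j : Fin n, ofLex ((biexp lam).getD j (toLex (0, 0))) = bideg lam := by
    subst hlen
    have h1 : ((biexp lam).map ofLex).sum = bideg lam := by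
      rw [bideg, ← Multiset.sum_coe, ← Multiset.map_coe, biexp, Finset.sort_eq, Finset.map_val,
        Multiset.map_map]
      rfl
    rw [← h1, ← List.sum_ofFn]
    congr 1
    apply List.ext_getElem
    · simp
    · intro i h1 h2
      simp
  rw [Delta, Matrix.det_apply]
  refine Submodule.sum_mem _ fun σ _ => ?_
  rw [Units.smul_def, ← Int.cast_smul_eq_zsmul ℚ]
  refine Submodule.smul_mem _ _ ?_
  rw [← hsum]
  refine IsWeightedHomogeneous.prod _ _ _ fun j _ => ?_
  have := ((isWeightedHomogeneous_X ℚ (wvar n) (Sum.inl (σ j))).pow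
    (ofLex ((biexp lam).getD j (toLex (0, 0)))).1).mul
    ((isWeightedHomogeneous_X ℚ (wvar n) (Sum.inr (σ j))).pow
      (ofLex ((biexp lam).getD j (toLex (0, 0)))).2)
  convert this using 1
  · rfl
  · apply Prod.ext <;> simp

theorem dmon_coeff {lam : YoungDiagram} (h : lam.card = n) {d e : Fin n ⊕ Fin n →₀ ℕ}
    (he : nc (e + d) (Delta n lam) ≠ 0) :
    Finsupp.weight (wvar n) e + Finsupp.weight (wvar n) d = bideg lam := by
  rw [← map_add]
  exact mem_bihom.1 (Delta_mem_bihom h) _ (nc_ne_zero_iff.1 he)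

theorem flipMap_coeff {lam : YoungDiagram} (h : lam.card = n) {d : ℕ × ℕ} {P : XY n}
    (hP : P ∈ bihom n d) {e : Fin n ⊕ Fin n →₀ ℕ} (he : coeff e (flipMap n lam P) ≠ 0) :
    Finsupp.weight (wvar n) e + d = bideg lam := by
  rw [← nc_ne_zero_iff, flipMap, LinearMap.flip_apply, nc_diffOp] at he
  obtain ⟨f, hf, hne⟩ := Finset.exists_ne_zero_of_sum_ne_zero he
  rw [← mem_bihom.1 hP f (mem_support_iff.1 hf)]
  exact dmon_coeff h (right_ne_zero_of_mul hne)

/-- P(∂) lowers the bidegree of Δ_lam by d. The additive form of the relation avoids truncated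
subtraction in `ℕ × ℕ`. -/
theorem flipMap_mem_bihom {lam : YoungDiagram} (h : lam.card = n) {d d' : ℕ × ℕ} {P : XY n}
    (hP : P ∈ bihom n d) (hd : d + d' = bideg lam) : flipMap n lam P ∈ bihom n d' :=
  mem_bihom.2 fun e he => by
    have := flipMap_coeff h hP he
    rw [← hd, add_comm] at this
    exact add_left_cancel this

theorem exists_bideg_of_flipMap_ne {lam : YoungDiagram} (h : lam.card = n) {d : ℕ × ℕ} {P : XY n}
    (hP : P ∈ bihom n d) (hne : flipMap n lam P ≠ 0) : ∃ d', d + d' = bideg lam := by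
  obtain ⟨e, he⟩ := exists_coeff_ne_zero hne
  exact ⟨_, (add_comm _ _).trans (flipMap_coeff h hP he)⟩

end ScienceFiction

/-! ### Bigraded characters under direct sums and degree-complementing isomorphisms -/

namespace ScienceFiction

open MvPolynomial

variable {n : ℕ}

/-! ### Traces -/

theorem trace_of_intertwine {A A' : Type*} [AddCommGroup A] [Module ℚ A] [AddCommGroup A']
    [Module ℚ A'] (e : A ≃ₗ[ℚ] A') (f : A →ₗ[ℚ] A) (f' : A' →ₗ[ℚ] A') (s : ℚ)
    (h : ∀ a, f' (e a) = s • e (f a)) :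
    LinearMap.trace ℚ A' f' = s * LinearMap.trace ℚ A f := by
  have h1 : f' = s • e.conj f := by
    ext a
    obtain ⟨b, rfl⟩ := e.surjective a
    simp [h, LinearEquiv.conj_apply]
  rw [h1, map_smul, LinearMap.trace_conj', smul_eq_mul]

theorem trace_restrict_sup {A : Type*} [AddCommGroup A] [Module ℚ A] {P Q : Submodule ℚ A}
    [FiniteDimensional ℚ P] [FiniteDimensional ℚ Q] (hPQ : Disjoint P Q) (f : A →ₗ[ℚ] A)
    (hP : ∀ p ∈ P, f p ∈ P) (hQ : ∀ p ∈ Q, f p ∈ Q) (h : ∀ p ∈ P ⊔ Q, f p ∈ P ⊔ Q) :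
    LinearMap.trace ℚ _ (f.restrict h) =
      LinearMap.trace ℚ _ (f.restrict hP) + LinearMap.trace ℚ _ (f.restrict hQ) := by
  set g : (P × Q) →ₗ[ℚ] (P ⊔ Q : Submodule ℚ A) :=
    (Submodule.inclusion le_sup_left).coprod (Submodule.inclusion le_sup_right) with hg
  have hg' : ∀ x : P × Q, ((g x : (P ⊔ Q : Submodule ℚ A)) : A) = x.1 + x.2 := fun x => rfl
  have hbij : Function.Bijective g := by
    constructor
    · rw [injective_iff_map_eq_zero]
      intro x hx
      have h1 : (x.1 : A) + x.2 = 0 := by rw [← hg', hx]; rfl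
      have h2 : (x.1 : A) = 0 := Submodule.disjoint_def.1 hPQ _ x.1.2 (by
        rw [eq_neg_of_add_eq_zero_left h1]; exact Q.neg_mem x.2.2)
      have h3 : (x.2 : A) = 0 := by rwa [h2, zero_add] at h1
      exact Prod.ext (Subtype.ext h2) (Subtype.ext h3)
    · rintro ⟨x, hx⟩
      obtain ⟨p, hp, q, hq, rfl⟩ := Submodule.mem_sup.1 hx
      exact ⟨(⟨p, hp⟩, ⟨q, hq⟩), rfl⟩
  rw [trace_of_intertwine (LinearEquiv.ofBijective g hbij)
    ((f.restrict hP).prodMap (f.restrict hQ)) (f.restrict h) 1, one_mul, LinearMap.trace_prodMap']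
  intro a
  rw [one_smul]
  apply Subtype.ext
  change f (g a : A) = g _
  rw [hg', hg', map_add]
  rfl

instance (d : ℕ × ℕ) : FiniteDimensional ℚ (bihom n d) := by
  have h : bihom n d ≤ restrictTotalDegree (Fin n ⊕ Fin n) ℚ (d.1 + d.2) := by
    intro P hP
    rw [mem_restrictTotalDegree, totalDegree, Finset.sup_le_iff]
    intro e he
    have h1 := mem_bihom.1 hP e (mem_support_iff.1 he)
    rw [← h1, Finsupp.weight_apply, Finsupp.sum, Finsupp.sum, Prod.fst_sum, Prod.snd_sum,
      ← Finset.sum_add_distrib]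
    refine Finset.sum_le_sum fun v _ => ?_
    cases v <;> simp
  exact Submodule.finiteDimensional_of_le h

instance (M : Submodule ℚ (XY n)) (d : ℕ × ℕ) :
    FiniteDimensional ℚ (M ⊓ bihom n d : Submodule ℚ (XY n)) :=
  Submodule.finiteDimensional_of_le inf_le_right

open Classical in
/-- The trace of a permutation on a submodule (`0` if the submodule is not stable). -/
noncomputable def actTrace (P : Submodule ℚ (XY n)) (σ : Equiv.Perm (Fin n)) : ℚ :=
  if h : ∀ p ∈ P, act σ p ∈ P then LinearMap.trace ℚ P ((act σ).restrict h) else 0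

theorem bichar_eq_actTrace (M : Submodule ℚ (XY n)) (d : ℕ × ℕ) (σ : Equiv.Perm (Fin n)) :
    bichar M d σ = actTrace (M ⊓ bihom n d) σ := rfl

theorem actTrace_bot (σ : Equiv.Perm (Fin n)) : actTrace (⊥ : Submodule ℚ (XY n)) σ = 0 := by
  rw [actTrace]
  split_ifs
  · rw [Subsingleton.elim ((act σ).restrict _) 0, map_zero]
  · rfl

theorem actTrace_sup {P Q : Submodule ℚ (XY n)} [FiniteDimensional ℚ P] [FiniteDimensional ℚ Q]
    (hPQ : Disjoint P Q) {σ : Equiv.Perm (Fin n)}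
    (hP : ∀ p ∈ P, act σ p ∈ P) (hQ : ∀ p ∈ Q, act σ p ∈ Q) :
    actTrace (P ⊔ Q) σ = actTrace P σ + actTrace Q σ := by
  have h : ∀ p ∈ P ⊔ Q, act σ p ∈ P ⊔ Q := fun p hp => by
    obtain ⟨p₁, hp₁, q, hq, rfl⟩ := Submodule.mem_sup.1 hp
    rw [map_add]
    exact Submodule.add_mem_sup (hP p₁ hp₁) (hQ q hq)
  rw [actTrace, actTrace, actTrace, dif_pos h, dif_pos hP, dif_pos hQ,
    trace_restrict_sup hPQ]

/-! ### Bigraded submodules -/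

/-- The bihomogeneous component of bidegree `d`. -/
noncomputable abbrev bicomp (d : ℕ × ℕ) : XY n →ₗ[ℚ] XY n :=
  weightedHomogeneousComponent (wvar n) d

theorem bicomp_same {d : ℕ × ℕ} {P : XY n} (h : P ∈ bihom n d) : bicomp d P = P :=
  weightedHomogeneousComponent_eq_self h

theorem bicomp_ne {d d' : ℕ × ℕ} {P : XY n} (h : P ∈ bihom n d) (hd : d' ≠ d) :
    bicomp d' P = 0 :=
  IsWeightedHomogeneous.weightedHomogeneousComponent_ne d' h hd

theorem bicomp_mem_bihom (d : ℕ × ℕ) (P : XY n) : bicomp d P ∈ bihom n d :=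
  weightedHomogeneousComponent_mem _ _ _

theorem bicomp_mem_span {s : Set (XY n)} (hs : ∀ b ∈ s, ∃ d, b ∈ bihom n d) {P : XY n}
    (hP : P ∈ Submodule.span ℚ s) (d : ℕ × ℕ) : bicomp d P ∈ Submodule.span ℚ s := by
  induction hP using Submodule.span_induction with
  | mem b hb =>
    obtain ⟨d', hd'⟩ := hs b hb
    by_cases h : d = d'
    · subst h; rw [bicomp_same hd']; exact Submodule.subset_span hb
    · rw [bicomp_ne hd' h]; exact Submodule.zero_mem _
  | zero => rw [map_zero]; exact Submodule.zero_mem _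
  | add x y _ _ hx hy => rw [map_add]; exact Submodule.add_mem _ hx hy
  | smul c x _ hx => rw [map_smul]; exact Submodule.smul_mem _ _ hx

/-- Stability under taking components is what makes the bidegree-d part of the sum equal to the sum
of the bidegree-d parts. -/
theorem bichar_sup {M N : Submodule ℚ (XY n)} (hMN : Disjoint M N) {σ : Equiv.Perm (Fin n)}
    (hM : ∀ p ∈ M, act σ p ∈ M) (hN : ∀ p ∈ N, act σ p ∈ N) {d : ℕ × ℕ}
    (hMd : ∀ p ∈ M, bicomp d p ∈ M) (hNd : ∀ p ∈ N, bicomp d p ∈ N) :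
    bichar (M ⊔ N) d σ = bichar M d σ + bichar N d σ := by
  have h : (M ⊔ N) ⊓ bihom n d = (M ⊓ bihom n d) ⊔ (N ⊓ bihom n d) := by
    refine le_antisymm ?_ (sup_le (inf_le_inf_right _ le_sup_left)
      (inf_le_inf_right _ le_sup_right))
    rintro x ⟨hx, hxd⟩
    obtain ⟨p, hp, q, hq, rfl⟩ := Submodule.mem_sup.1 hx
    rw [← bicomp_same hxd, map_add]
    exact Submodule.add_mem_sup ⟨hMd p hp, bicomp_mem_bihom d p⟩ ⟨hNd q hq, bicomp_mem_bihom d q⟩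
  rw [bichar_eq_actTrace, h, actTrace_sup (hMN.mono inf_le_left inf_le_left)
    (fun p hp => ⟨hM p hp.1, act_mem_bihom hp.2 σ⟩) fun p hp => ⟨hN p hp.1, act_mem_bihom hp.2 σ⟩]
  rfl

/-- A degree-complementing injective map on the span of a set of bihomogeneous polynomials
commutes with taking components. -/
theorem bicomp_map_span {s : Set (XY n)} (hs : ∀ b ∈ s, ∃ d, b ∈ bihom n d)
    (g : Submodule.span ℚ s →ₗ[ℚ] XY n) {D : ℕ × ℕ}
    (hg : ∀ d d' (p : Submodule.span ℚ s), (p : XY n) ∈ bihom n d → d + d' = D → g p ∈ bihom n d')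
    (hz : ∀ d (p : Submodule.span ℚ s), (p : XY n) ∈ bihom n d → (∀ d', d + d' ≠ D) → g p = 0)
    (p : Submodule.span ℚ s) (d' : ℕ × ℕ) :
    (∀ d, d + d' = D → bicomp d' (g p) = g ⟨bicomp d p, bicomp_mem_span hs p.2 d⟩) ∧
      ((∀ d, d + d' ≠ D) → bicomp d' (g p) = 0) := by
  obtain ⟨p, hp⟩ := p
  induction hp using Submodule.span_induction with
  | mem b hb =>
    obtain ⟨d₀, hd₀⟩ := hs b hb
    have hb' := Submodule.subset_span (R := ℚ) hb
    by_cases hex : ∃ d₀', d₀ + d₀' = D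
    · obtain ⟨d₀', h0⟩ := hex
      have hgb := hg d₀ d₀' ⟨b, hb'⟩ hd₀ h0
      refine ⟨fun d hd => ?_, fun hno => ?_⟩
      · by_cases he : d = d₀
        · subst he
          have : d' = d₀' := add_left_cancel (hd.trans h0.symm)
          subst this
          rw [bicomp_same hgb]
          congr 2
          exact (bicomp_same hd₀).symm
        · have : d' ≠ d₀' := fun h => he (add_right_cancel (h ▸ hd.trans h0.symm))
          rw [bicomp_ne hgb this]
          have h2 : (⟨bicomp d b, bicomp_mem_span hs hb' d⟩ : Submodule.span ℚ s) = 0 :=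
            Subtype.ext (bicomp_ne hd₀ he)
          rw [h2, map_zero]
      · exact bicomp_ne hgb fun h => hno d₀ (h ▸ h0)
    · push Not at hex
      rw [hz d₀ ⟨b, hb'⟩ hd₀ hex, map_zero]
      refine ⟨fun d hd => ?_, fun _ => rfl⟩
      have h2 : (⟨bicomp d b, bicomp_mem_span hs hb' d⟩ : Submodule.span ℚ s) = 0 :=
        Subtype.ext (bicomp_ne hd₀ fun h => hex d' (h ▸ hd))
      rw [h2, map_zero]
  | zero =>
    have h0 : (⟨0, Submodule.zero_mem _⟩ : Submodule.span ℚ s) = 0 := rfl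
    rw [h0, map_zero, map_zero]
    refine ⟨fun d _ => ?_, fun _ => rfl⟩
    have h2 : (⟨bicomp d ((0 : Submodule.span ℚ s) : XY n), bicomp_mem_span hs
      (Submodule.zero_mem _) d⟩ : Submodule.span ℚ s) = 0 := Subtype.ext (map_zero _)
    exact (congrArg g h2).trans (map_zero g) |>.symm
  | add x y hx hy ihx ihy =>
    have h1 : (⟨x + y, Submodule.add_mem _ hx hy⟩ : Submodule.span ℚ s) = ⟨x, hx⟩ + ⟨y, hy⟩ := rfl
    rw [h1, map_add, map_add]
    refine ⟨fun d hd => ?_, fun h => by rw [ihx.2 h, ihy.2 h, add_zero]⟩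
    rw [ihx.1 d hd, ihy.1 d hd, ← map_add]
    exact congrArg g (Subtype.ext (map_add _ _ _).symm)
  | smul c x hx ihx =>
    have h1 : (⟨c • x, Submodule.smul_mem _ c hx⟩ : Submodule.span ℚ s) = c • ⟨x, hx⟩ := rfl
    rw [h1, map_smul, map_smul]
    refine ⟨fun d hd => ?_, fun h => by rw [ihx.2 h, smul_zero]⟩
    rw [ihx.1 d hd, ← map_smul]
    exact congrArg g (Subtype.ext (map_smul _ _ _).symm)

/-- The bigraded characters of two submodules related by a degree-complementing isomorphism that
is equivariant up to the sign character. -/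
theorem bichar_of_equiv {s : Set (XY n)} (hs : ∀ b ∈ s, ∃ d, b ∈ bihom n d)
    {N : Submodule ℚ (XY n)} (g : Submodule.span ℚ s ≃ₗ[ℚ] N) {D : ℕ × ℕ}
    (hg : ∀ d d' (p : Submodule.span ℚ s), (p : XY n) ∈ bihom n d → d + d' = D → (g p : XY n) ∈ bihom n d')
    (hz : ∀ d (p : Submodule.span ℚ s), (p : XY n) ∈ bihom n d → (∀ d', d + d' ≠ D) → g p = 0)
    {σ : Equiv.Perm (Fin n)} {c : ℚ}
    (hM : ∀ p ∈ Submodule.span ℚ s, act σ p ∈ Submodule.span ℚ s) (hN : ∀ p ∈ N, act σ p ∈ N)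
    (hσ : ∀ p p' : Submodule.span ℚ s, (p' : XY n) = act σ p →
      act σ (g p) = c • (g p' : XY n)) :
    (∀ d d', d + d' = D → bichar N d' σ = c * bichar (Submodule.span ℚ s) d σ) ∧
      (∀ d, (∀ d', d + d' ≠ D) → bichar (Submodule.span ℚ s) d σ = 0 ∧ bichar N d σ = 0) := by
  have key := bicomp_map_span hs (N.subtype ∘ₗ g.toLinearMap) (D := D) hg
    fun d p hp h => by rw [LinearMap.comp_apply]; exact congrArg N.subtype (hz d p hp h)
  constructor
  · intro d d' hd
    -- Taking the component of bidegree d' after `g` is taking the component of bidegree d before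
    -- it, so injectivity of `g` transports homogeneity back.
    have hback : ∀ p : Submodule.span ℚ s, (g p : XY n) ∈ bihom n d' → (p : XY n) ∈ bihom n d := by
      intro p hp
      have h1 := (key p d').1 d hd
      have h2 : bicomp d' (g p : XY n) = g p := bicomp_same hp
      have h3 : g p = g ⟨bicomp d p, bicomp_mem_span hs p.2 d⟩ := Subtype.ext (h2.symm.trans h1)
      rw [g.injective h3]
      exact bicomp_mem_bihom d _
    have hPs : ∀ p ∈ Submodule.span ℚ s ⊓ bihom n d, act σ p ∈ Submodule.span ℚ s ⊓ bihom n d :=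
      fun p hp => ⟨hM p hp.1, act_mem_bihom hp.2 σ⟩
    have hQs : ∀ p ∈ N ⊓ bihom n d', act σ p ∈ N ⊓ bihom n d' :=
      fun p hp => ⟨hN p hp.1, act_mem_bihom hp.2 σ⟩
    rw [bichar_eq_actTrace, bichar_eq_actTrace, actTrace, actTrace, dif_pos hPs, dif_pos hQs]
    let e : (Submodule.span ℚ s ⊓ bihom n d : Submodule ℚ (XY n)) →ₗ[ℚ]
        (N ⊓ bihom n d' : Submodule ℚ (XY n)) :=
      LinearMap.codRestrict _ (N.subtype ∘ₗ g.toLinearMap ∘ₗ Submodule.inclusion inf_le_left)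
        fun p => ⟨(g _).2, hg d d' ⟨p, p.2.1⟩ p.2.2 hd⟩
    have he : ∀ p, (e p : XY n) = g ⟨p, p.2.1⟩ := fun p => rfl
    have hbij : Function.Bijective e := by
      constructor
      · intro p p' h
        have h1 : (e p : XY n) = e p' := congrArg _ h
        rw [he, he] at h1
        have h2 := congrArg Subtype.val (g.injective (Subtype.ext h1))
        exact Subtype.ext h2
      · rintro ⟨q, hqN, hqd⟩
        obtain ⟨p, hp⟩ := g.surjective ⟨q, hqN⟩
        refine ⟨⟨p, p.2, hback p (by rw [hp]; exact hqd)⟩, Subtype.ext ?_⟩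
        rw [he]
        exact congrArg Subtype.val hp
    refine trace_of_intertwine (LinearEquiv.ofBijective e hbij) _ _ c fun p => Subtype.ext ?_
    change act σ (e p : XY n) = c • (e _ : XY n)
    rw [he, he]
    exact hσ ⟨p, p.2.1⟩ ⟨act σ p, hM _ p.2.1⟩ rfl
  · intro d hd
    rw [bichar_eq_actTrace, bichar_eq_actTrace]
    -- A bidegree not below `D` has no complement: `g` would kill such elements, and it is
    -- injective.
    have h1 : Submodule.span ℚ s ⊓ bihom n d = ⊥ := by
      rw [eq_bot_iff]
      rintro p ⟨hp, hpd⟩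
      have := hz d ⟨p, hp⟩ hpd hd
      rw [LinearEquiv.map_eq_zero_iff] at this
      exact congrArg Subtype.val this
    have h2 : N ⊓ bihom n d = ⊥ := by
      rw [eq_bot_iff]
      rintro q ⟨hq, hqd⟩
      obtain ⟨p, hp⟩ := g.surjective ⟨q, hq⟩
      have h3 := (key p d).2 fun d' h => hd d' ((add_comm _ _).trans h)
      have h4 : bicomp d (g p : XY n) = 0 := h3
      rw [hp, bicomp_same hqd] at h4
      exact h4
    rw [h1, h2, actTrace_bot]
    exact ⟨rfl, rfl⟩

end ScienceFiction

/-! ### Corners, the modules attached to words, and the exchange relation -/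

namespace ScienceFiction

open MvPolynomial

variable {n : ℕ}

/-! ### Corners -/

section Corners

variable (μ : YoungDiagram)

theorem coleg_mem (i : Fin (nCorners μ)) : coleg μ i ∈ cornerRows μ :=
  Finset.orderEmbOfFin_mem _ rfl _

theorem coleg_lt (i : Fin (nCorners μ)) : coleg μ i < nRows μ :=
  Finset.mem_range.1 (Finset.mem_filter.1 (coleg_mem μ i)).1

theorem rowLen_succ_coleg_lt (i : Fin (nCorners μ)) :
    μ.rowLen (coleg μ i + 1) < μ.rowLen (coleg μ i) :=
  (Finset.mem_filter.1 (coleg_mem μ i)).2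

theorem coleg_strictAnti : StrictAnti (coleg μ) := fun i j hij => by
  have : j.rev < i.rev := Fin.rev_lt_rev.2 hij
  exact ((cornerRows μ).orderEmbOfFin rfl).strictMono this

theorem exists_coleg_eq {r : ℕ} (h : r ∈ cornerRows μ) : ∃ i, coleg μ i = r := by
  have : r ∈ Set.range ((cornerRows μ).orderEmbOfFin rfl) := by
    rw [Finset.range_orderEmbOfFin]; exact h
  obtain ⟨i, hi⟩ := this
  exact ⟨i.rev, by rw [← hi]; exact congrArg _ i.rev_rev⟩

variable {μ}

theorem delEnd_cells {r : ℕ} (h : μ.rowLen (r + 1) < μ.rowLen r) :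
    (delEnd μ r).cells = μ.cells.erase (r, μ.rowLen r - 1) := by
  ext ⟨a, b⟩
  simp only [delEnd, Finset.mem_filter, Finset.mem_erase, YoungDiagram.mem_cells,
    YoungDiagram.mem_iff_lt_rowLen, Prod.mk_le_mk, ne_eq, Prod.mk.injEq]
  constructor
  · rintro ⟨h1, h2⟩
    refine ⟨?_, h1⟩
    rintro ⟨rfl, rfl⟩
    exact h2 ⟨le_rfl, le_rfl⟩
  · rintro ⟨h1, h2⟩
    refine ⟨h2, ?_⟩
    rintro ⟨h3, h4⟩
    have h5 := μ.rowLen_anti r a h3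
    rcases h3.eq_or_lt with rfl | h6
    · exact h1 ⟨rfl, by omega⟩
    · have := μ.rowLen_anti (r + 1) a h6
      omega

theorem corner_mem {r : ℕ} (h : μ.rowLen (r + 1) < μ.rowLen r) :
    (r, μ.rowLen r - 1) ∈ μ.cells := by
  rw [YoungDiagram.mem_cells, YoungDiagram.mem_iff_lt_rowLen]
  omega

theorem card_predec (hμ : μ.card = n + 1) (i : Fin (nCorners μ)) : (predec μ i).card = n := by
  have h := rowLen_succ_coleg_lt μ i
  rw [YoungDiagram.card, predec, delEnd_cells h, Finset.card_erase_of_mem (corner_mem h)]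
  exact congrArg (· - 1) hμ

theorem Ti_mul (i : Fin (nCorners μ)) : tt ^ coleg μ i * qq ^ coarm μ i * Ti μ i = Tw μ := by
  have h := rowLen_succ_coleg_lt μ i
  rw [Ti, Tw, predec, delEnd_cells h, Tw]
  exact Finset.mul_prod_erase μ.cells (fun s => tt ^ s.1 * qq ^ s.2) (corner_mem h)

theorem Tw_ne_zero (lam : YoungDiagram) : Tw lam ≠ 0 :=
  Finset.prod_ne_zero_iff.2 fun _ _ =>
    mul_ne_zero (pow_ne_zero _ tt_ne_zero) (pow_ne_zero _ qq_ne_zero)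

theorem Ti_ne_zero (i : Fin (nCorners μ)) : Ti μ i ≠ 0 := Tw_ne_zero _

/-- T_μ = x_i T_i, and the corner weights x_i differ because the colegs do. The distinct T_i serve
as interpolation nodes later. -/
theorem Ti_injective : Function.Injective (Ti μ) := fun i j h => by
  have h1 := (Ti_mul i).trans (Ti_mul j).symm
  rw [h] at h1
  exact (coleg_strictAnti μ).injective
    (tt_pow_mul_qq_pow_inj (mul_right_cancel₀ (Ti_ne_zero j) h1)).1

theorem predec_injective : Function.Injective (predec μ) := fun _ _ h =>
  Ti_injective (congrArg Tw h)

end Corners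

/-! ### The submodules spanned by parts of a science fiction basis -/

open Classical in
/-- The word of a basis element, as the set of the `i` with `b ∈ B_i`. -/
noncomputable def wordOf {m : ℕ} (Bi : Fin m → Set (XY n)) (b : XY n) : Finset (Fin m) :=
  Finset.univ.filter fun i => b ∈ Bi i

/-- The span of the elements of `B` whose words belong to `E`. -/
noncomputable abbrev wordSpan {m : ℕ} (B : Set (XY n)) (Bi : Fin m → Set (XY n)) (E : Finset (Finset (Fin m))) :
    Submodule ℚ (XY n) :=
  Submodule.span ℚ {b | b ∈ B ∧ wordOf Bi b ∈ E}

theorem wordSpan_union {m : ℕ} (B : Set (XY n)) (Bi : Fin m → Set (XY n))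
    (E F : Finset (Finset (Fin m))) :
    wordSpan B Bi (E ∪ F) = wordSpan B Bi E ⊔ wordSpan B Bi F := by
  rw [wordSpan, wordSpan, wordSpan, ← Submodule.span_union]
  congr 1
  ext b
  simp only [Finset.mem_union, Set.mem_ofPred_eq, Set.mem_union]
  tauto

theorem wordSpan_empty {m : ℕ} (B : Set (XY n)) (Bi : Fin m → Set (XY n)) :
    wordSpan B Bi ∅ = ⊥ := by
  simp [wordSpan]

theorem Meps_eq {m : ℕ} (B : Set (XY n)) (Bi : Fin m → Set (XY n)) (S : Finset (Fin m)) :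
    Meps B Bi (fun i => decide (i ∈ S)) = wordSpan B Bi {S} := by
  rw [Meps, wordSpan]
  congr 1
  ext b
  simp only [decide_eq_true_eq, Finset.mem_singleton, Set.mem_ofPred_eq, wordOf,
    Finset.ext_iff, Finset.mem_filter, Finset.mem_univ, true_and]

/-- Coordinates with respect to an independent set turn spans of subsets into spaces of functions
with prescribed support. This makes the intersections in the Bergeron–Haiman assignment computable.
-/
theorem span_inter_of_linearIndepOn {B s t : Set (XY n)} (h : LinearIndepOn ℚ id B)
    (hs : s ⊆ B) (ht : t ⊆ B) :
    Submodule.span ℚ s ⊓ Submodule.span ℚ t = Submodule.span ℚ (s ∩ t) := by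
  have key : ∀ u : Set (XY n), u ⊆ B → Submodule.span ℚ u =
      (Finsupp.supported ℚ ℚ {b : B | (b : XY n) ∈ u}).map
        (Finsupp.linearCombination ℚ fun b : B => (b : XY n)) := by
    intro u hu
    rw [← Finsupp.span_image_eq_map_linearCombination]
    congr 1
    ext b
    constructor
    · exact fun hb => ⟨⟨b, hu hb⟩, hb, rfl⟩
    · rintro ⟨c, hc, rfl⟩; exact hc
  have hinj : Function.Injective (Finsupp.linearCombination ℚ fun b : B => (b : XY n)) := h
  rw [key s hs, key t ht, key (s ∩ t) (Set.inter_subset_left.trans hs),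
    ← Submodule.map_inf _ hinj, ← Finsupp.supported_inter]
  rfl

theorem tau_decide {m : ℕ} {S : Finset (Fin m)} {i : Fin m} (hi : i ∈ S) :
    tau i (fun j => decide (j ∈ S)) = fun j => decide (j ∈ insert i Sᶜ) := by
  funext j
  by_cases h : j = i
  · subst h; simp [tau, hi]
  · simp [tau, h]

section SF

variable {μ : YoungDiagram} {B : Set (XY n)} {Bi : Fin (nCorners μ) → Set (XY n)}

theorem IsSFBasis.wordSpan_inter (h : IsSFBasis n μ B Bi)
    (E F : Finset (Finset (Fin (nCorners μ)))) :
    wordSpan B Bi (E ∩ F) = wordSpan B Bi E ⊓ wordSpan B Bi F := by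
  rw [wordSpan, wordSpan, wordSpan, span_inter_of_linearIndepOn h.linearIndependent
    (fun b hb => hb.1) fun b hb => hb.1]
  congr 1
  ext b
  simp only [Finset.mem_inter, Set.mem_ofPred_eq, Set.mem_inter_iff]
  tauto

theorem IsSFBasis.homogeneous (h : IsSFBasis n μ B Bi) (E : Finset (Finset (Fin (nCorners μ)))) :
    ∀ b ∈ {b | b ∈ B ∧ wordOf Bi b ∈ E}, ∃ d, b ∈ bihom n d :=
  fun b hb => h.bihomogeneous b hb.1

theorem IsSFBasis.act_mem (h : IsSFBasis n μ B Bi) (E : Finset (Finset (Fin (nCorners μ))))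
    (σ : Equiv.Perm (Fin n)) : ∀ p ∈ wordSpan B Bi E, act σ p ∈ wordSpan B Bi E := by
  intro p hp
  have h1 : ∀ S ∈ E, wordSpan B Bi {S} ≤ wordSpan B Bi E := fun S hS =>
    Submodule.span_mono fun b hb => ⟨hb.1, by rw [Finset.mem_singleton.1 hb.2]; exact hS⟩
  induction hp using Submodule.span_induction with
  | mem b hb =>
    refine h1 _ hb.2 ?_
    rw [← Meps_eq]
    refine h.invariant _ σ b ?_
    rw [Meps_eq]
    exact Submodule.subset_span ⟨hb.1, Finset.mem_singleton_self _⟩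
  | zero => rw [map_zero]; exact Submodule.zero_mem _
  | add x y _ _ hx hy => rw [map_add]; exact Submodule.add_mem _ hx hy
  | smul c x _ hx => rw [map_smul]; exact Submodule.smul_mem _ _ hx

theorem IsSFBasis.ghM_eq (h : IsSFBasis n μ B Bi) (i : Fin (nCorners μ)) :
    ghM n (predec μ i) = wordSpan B Bi (Finset.univ.filter fun S => i ∈ S) := by
  rw [← h.span_subset_eq i, wordSpan]
  congr 1
  ext b
  simp only [wordOf, Finset.mem_filter, Finset.mem_univ, true_and, Set.mem_ofPred_eq]
  exact ⟨fun hb => ⟨h.subset i hb, hb⟩, fun hb => hb.2⟩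

/-- V is the sum of the spans of the `Bi`, so only basis elements with a nonempty word are needed.
-/
theorem IsSFBasis.Vmod_eq (h : IsSFBasis n μ B Bi) :
    Vmod n μ = wordSpan B Bi (Finset.univ.erase ∅) := by
  apply le_antisymm
  · refine iSup_le fun i => ?_
    rw [h.ghM_eq i]
    refine Submodule.span_mono fun b hb => ⟨hb.1, ?_⟩
    rw [Finset.mem_erase]
    exact ⟨Finset.ne_empty_of_mem (Finset.mem_filter.1 hb.2).2, Finset.mem_univ _⟩
  · refine Submodule.span_le.2 fun b hb => ?_
    obtain ⟨i, hi⟩ := Finset.nonempty_iff_ne_empty.2 (Finset.mem_erase.1 hb.2).1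
    refine le_iSup (fun i => ghM n (predec μ i)) i ?_
    rw [h.ghM_eq i]
    exact Submodule.subset_span ⟨hb.1, Finset.mem_filter.2 ⟨Finset.mem_univ _, hi⟩⟩

theorem IsSFBasis.bichar_wordSpan (h : IsSFBasis n μ B Bi)
    (E : Finset (Finset (Fin (nCorners μ)))) (d : ℕ × ℕ) (σ : Equiv.Perm (Fin n)) :
    bichar (wordSpan B Bi E) d σ = ∑ S ∈ E, bichar (wordSpan B Bi {S}) d σ := by
  induction E using Finset.induction_on with
  | empty => rw [wordSpan_empty, Finset.sum_empty, bichar_eq_actTrace, bot_inf_eq, actTrace_bot]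
  | insert S E hS ih =>
    have hdisj : Disjoint (wordSpan B Bi {S}) (wordSpan B Bi E) := by
      rw [disjoint_iff, ← h.wordSpan_inter, Finset.singleton_inter_of_notMem hS, wordSpan_empty]
    rw [Finset.sum_insert hS, ← ih, Finset.insert_eq, wordSpan_union,
      bichar_sup hdisj (h.act_mem _ σ) (h.act_mem _ σ)
        (fun p hp => bicomp_mem_span (h.homogeneous _) hp d)
        fun p hp => bicomp_mem_span (h.homogeneous _) hp d]

theorem exists_flipEquiv {lam : YoungDiagram} {M : Submodule ℚ (XY n)} (hM : M ≤ ghM n lam) :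
    ∃ f : M ≃ₗ[ℚ] M.map (flipMap n lam), ∀ p, (f p : XY n) = flipMap n lam p := by
  have hbij : Function.Bijective ((flipMap n lam).submoduleMap M) := by
    refine ⟨?_, LinearMap.submoduleMap_surjective _ _⟩
    rw [injective_iff_map_eq_zero]
    intro p hp
    exact Subtype.ext (flipMap_eq_zero (hM p.2) (congrArg Subtype.val hp))
  exact ⟨LinearEquiv.ofBijective _ hbij, fun p => rfl⟩

/-- The flip at i is injective on M^S, complements bidegrees and twists by the sign; composed with
the isomorphism of the science fiction hypothesis it maps M^S onto M^{τ_i S}, and τ_i sends `S` to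
{i} ∪ Sᶜ. -/
theorem IsSFBasis.exists_flip (h : IsSFBasis n μ B Bi) (hμ : μ.card = n + 1)
    {S : Finset (Fin (nCorners μ))} {i : Fin (nCorners μ)} (hi : i ∈ S) (σ : Equiv.Perm (Fin n)) :
    (∀ d d', d + d' = bideg (predec μ i) → bichar (wordSpan B Bi {insert i Sᶜ}) d' σ =
      ((Equiv.Perm.sign σ : ℤ) : ℚ) * bichar (wordSpan B Bi {S}) d σ) ∧
    (∀ d, (∀ d', d + d' ≠ bideg (predec μ i)) → bichar (wordSpan B Bi {S}) d σ = 0 ∧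
      bichar (wordSpan B Bi {insert i Sᶜ}) d σ = 0) := by
  have hflip := h.flip (fun j => decide (j ∈ S)) i (by simpa using hi)
  rw [tau_decide hi, Meps_eq, Meps_eq] at hflip
  obtain ⟨e, he, hed⟩ := hflip
  have hle : wordSpan B Bi {S} ≤ ghM n (predec μ i) := by
    rw [h.ghM_eq i]
    exact Submodule.span_mono fun b hb => ⟨hb.1, by
      rw [Finset.mem_singleton.1 hb.2]; exact Finset.mem_filter.2 ⟨Finset.mem_univ _, hi⟩⟩
  obtain ⟨f, hfv⟩ := exists_flipEquiv hle
  have hcard := card_predec hμ i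
  refine bichar_of_equiv (h.homogeneous {S}) (f.trans e) ?_ ?_ (h.act_mem {S} σ)
    (h.act_mem _ σ) ?_
  · intro d d' p hp hd
    rw [LinearEquiv.trans_apply]
    refine hed d' (f p) ?_
    rw [hfv]
    exact flipMap_mem_bihom hcard hp hd
  · intro d p hp hd
    have h0 : f p = 0 := by
      by_contra hne
      obtain ⟨d', hd'⟩ := exists_bideg_of_flipMap_ne hcard hp
        (fun h0 => hne (Subtype.ext ((hfv p).trans h0)))
      exact hd d' hd'
    rw [LinearEquiv.trans_apply, h0, map_zero]
  · intro p p' hpp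
    -- The isomorphism `e` is equivariant for the untwisted action, so the sign is carried by its
    -- argument.
    have h1 := he σ (f p) (((Equiv.Perm.sign σ : ℤ) : ℚ) • f p') (by
      rw [Submodule.coe_smul, hfv, hfv, hpp, act_flipMap, smul_smul, ← Int.cast_mul]
      simp)
    rw [LinearEquiv.trans_apply, LinearEquiv.trans_apply, ← h1, map_smul, Submodule.coe_smul]

end SF

/-! ### Frobenius characteristics -/

/-- The graded character `∑_{h,k} x^h y^k char_{h,k}(σ)`. -/
noncomputable def charSum (M : Submodule ℚ (XY n)) (σ : Equiv.Perm (Fin n)) (x y : QT) : QT :=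
  ∑ᶠ d : ℕ × ℕ, x ^ d.1 * y ^ d.2 * algebraMap ℚ QT (bichar M d σ)

theorem frob_eq (M : Submodule ℚ (XY n)) : frob n M =
    C ((n.factorial : QT)⁻¹) * ∑ σ : Equiv.Perm (Fin n),
      C (charSum M σ tt qq) * (σ.partition.parts.map pk).prod := rfl

theorem frob_eq_sum {ι : Type*} (s : Finset ι) (c : ι → QT) (N : ι → Submodule ℚ (XY n))
    (M : Submodule ℚ (XY n))
    (h : ∀ σ, charSum M σ tt qq = ∑ i ∈ s, c i * charSum (N i) σ tt qq) :
    frob n M = ∑ i ∈ s, c i • frob n (N i) := by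
  simp only [frob_eq, h, smul_eq_C_mul, map_sum, Finset.sum_mul, Finset.mul_sum, C_mul]
  rw [Finset.sum_comm]
  refine Finset.sum_congr rfl fun i _ => Finset.sum_congr rfl fun σ _ => ?_
  ring

section SF

variable {μ : YoungDiagram} {B : Set (XY n)} {Bi : Fin (nCorners μ) → Set (XY n)}

/-- Complementing bidegrees inverts both grading variables up to the factor x^{D.1} y^{D.2}. The
variables are kept general because the identity is used a second time at t⁻¹, q⁻¹. -/
theorem IsSFBasis.charSum_flip (h : IsSFBasis n μ B Bi) (hμ : μ.card = n + 1)
    {S : Finset (Fin (nCorners μ))} {i : Fin (nCorners μ)} (hi : i ∈ S) (σ : Equiv.Perm (Fin n))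
    {x y : QT} (hx : x ≠ 0) (hy : y ≠ 0) :
    charSum (wordSpan B Bi {insert i Sᶜ}) σ x y =
      ((Equiv.Perm.sign σ : ℤ) : QT) * (x ^ (bideg (predec μ i)).1 * y ^ (bideg (predec μ i)).2) *
        charSum (wordSpan B Bi {S}) σ x⁻¹ y⁻¹ := by
  obtain ⟨h1, h2⟩ := h.exists_flip hμ hi σ
  set D := bideg (predec μ i)
  have hle : ∀ d, (∃ d', d + d' = D) ↔ d ≤ D := fun d => by
    rw [le_iff_exists_add]; exact exists_congr fun d' => eq_comm
  have hnot : ∀ d, d ∉ Finset.Iic D → ∀ d', d + d' ≠ D := fun d hd d' hd' =>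
    hd (Finset.mem_Iic.2 ((hle d).1 ⟨d', hd'⟩))
  -- Bidegrees not below `D` carry zero characters, so both sums live on `Finset.Iic D`, where d ↦ D
  -- − d is an involution.
  rw [charSum, charSum, finsum_eq_sum_of_support_subset (s := Finset.Iic D),
    finsum_eq_sum_of_support_subset (s := Finset.Iic D), Finset.mul_sum]
  · refine Finset.sum_nbij' (fun d => D - d) (fun d => D - d) ?_ ?_ ?_ ?_ ?_
    · intro d _; exact Finset.mem_Iic.2 tsub_le_self
    · intro d _; exact Finset.mem_Iic.2 tsub_le_self
    · intro d hd; exact tsub_tsub_cancel_of_le (Finset.mem_Iic.1 hd)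
    · intro d hd; exact tsub_tsub_cancel_of_le (Finset.mem_Iic.1 hd)
    · intro d hd
      have hd := Finset.mem_Iic.1 hd
      rw [h1 (D - d) d (tsub_add_cancel_of_le hd), map_mul, map_intCast]
      have e1 : x ^ D.1 * (x⁻¹) ^ (D - d).1 = x ^ d.1 := by
        have : D.1 = d.1 + (D - d).1 := by
          rw [Prod.fst_sub]; have := (Prod.le_def.1 hd).1; omega
        rw [inv_pow, mul_inv_eq_iff_eq_mul₀ (pow_ne_zero _ hx), ← pow_add, ← this]
      have e2 : y ^ D.2 * (y⁻¹) ^ (D - d).2 = y ^ d.2 := by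
        have : D.2 = d.2 + (D - d).2 := by
          rw [Prod.snd_sub]; have := (Prod.le_def.1 hd).2; omega
        rw [inv_pow, mul_inv_eq_iff_eq_mul₀ (pow_ne_zero _ hy), ← pow_add, ← this]
      rw [← e1, ← e2]
      ring
  · intro d hd
    by_contra hn
    exact hd (by simp only [(h2 d (hnot d hn)).1, map_zero, mul_zero])
  · intro d hd
    by_contra hn
    exact hd (by simp only [(h2 d (hnot d hn)).2, map_zero, mul_zero])

/-- Flip at i to reach {i} ∪ Sᶜ, which contains j, then flip at j. The signs square to 1 and the
inversions undo each other, so only T_j · T_i⁻¹ remains. -/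
theorem IsSFBasis.frob_swap (h : IsSFBasis n μ B Bi) (hμ : μ.card = n + 1)
    {S : Finset (Fin (nCorners μ))} {i j : Fin (nCorners μ)} (hi : i ∈ S) (hj : j ∉ S) :
    frob n (wordSpan B Bi {insert j (S.erase i)}) =
      (Ti μ j / Ti μ i) • frob n (wordSpan B Bi {S}) := by
  have key := frob_eq_sum {()} (fun _ => Ti μ j / Ti μ i) (fun _ => wordSpan B Bi {S})
    (wordSpan B Bi {insert j (S.erase i)}) fun σ => by
      have hj' : j ∈ insert i Sᶜ := Finset.mem_insert_of_mem (Finset.mem_compl.2 hj)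
      have h1 := h.charSum_flip hμ hj' σ tt_ne_zero qq_ne_zero
      rw [h.charSum_flip hμ hi σ (inv_ne_zero tt_ne_zero) (inv_ne_zero qq_ne_zero),
        inv_inv, inv_inv, ← Tw_eq] at h1
      have hc : insert j (insert i Sᶜ)ᶜ = insert j (S.erase i) := by
        rw [Finset.compl_insert, compl_compl]
      have hs : ((Equiv.Perm.sign σ : ℤ) : QT) * ((Equiv.Perm.sign σ : ℤ) : QT) = 1 := by
        rw [← Int.cast_mul]; simp
      rw [hc] at h1
      rw [Finset.sum_singleton, h1, inv_pow, inv_pow, ← mul_inv, ← Tw_eq, Ti, Ti, div_eq_mul_inv]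
      linear_combination (Tw (predec μ j) * (Tw (predec μ i))⁻¹ *
        charSum (wordSpan B Bi {S}) σ tt qq) * hs
  rwa [Finset.sum_singleton] at key

theorem IsSFBasis.frob_wordSpan (h : IsSFBasis n μ B Bi) (hμ : μ.card = n + 1)
    {E : Finset (Finset (Fin (nCorners μ)))} (hE : ∅ ∉ E) :
    frob n (wordSpan B Bi E) = ∑ S ∈ E, frob n (wordSpan B Bi {S}) := by
  have key := frob_eq_sum E (fun _ => 1) (fun S => wordSpan B Bi {S}) (wordSpan B Bi E)
    fun σ => by
      simp only [charSum, h.bichar_wordSpan E, one_mul, map_sum, Finset.mul_sum]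
      -- Finiteness of the support is where nonempty words matter: a letter i ∈ S bounds the
      -- bidegrees of M^S by that of Δ_{α^(i)}.
      refine finsum_sum_comm _ _ fun S hS => ?_
      obtain ⟨i, hi⟩ := Finset.nonempty_iff_ne_empty.2 (ne_of_mem_of_not_mem hS hE)
      refine (Finset.Iic (bideg (predec μ i))).finite_toSet.subset fun d hd => ?_
      by_contra hn
      have h0 := ((h.exists_flip hμ hi σ).2 d fun d' hd' => hn
        (Finset.mem_coe.2 (Finset.mem_Iic.2 (le_iff_exists_add.2 ⟨d', hd'.symm⟩)))).1
      exact hd (by simp only [h0, map_zero, mul_zero])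
  simpa only [one_smul] using key

end SF

end ScienceFiction

/-! ### From the exchange relation to polynomials in ∇ -/

namespace ScienceFiction

open Polynomial

/-! ### Families indexed by words with the exchange property -/

section Words

variable {K : Type*} [Field K] {m : ℕ}

/-- `∏_{s ∉ S} (-z / T_s)`. -/
noncomputable def wordPoly (T : Fin m → K) (S : Finset (Fin m)) : K[X] :=
  ∏ s ∈ Sᶜ, (-(C (T s)⁻¹ * X))

theorem sum_filter_mem {A : Type*} [AddCommMonoid A] (i : Fin m) (f : Finset (Fin m) → A) :
    ∑ S ∈ Finset.univ.filter (fun S => i ∈ S), f S =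
      ∑ S ∈ (Finset.univ.erase i).powerset, f (insert i S) := by
  refine Finset.sum_nbij' (fun S => S.erase i) (fun S => insert i S) ?_ ?_ ?_ ?_ ?_
  · intro S _
    exact Finset.mem_powerset.2 (Finset.erase_subset_erase i (Finset.subset_univ S))
  · intro S _; exact Finset.mem_filter.2 ⟨Finset.mem_univ _, Finset.mem_insert_self _ _⟩
  · intro S hS; exact Finset.insert_erase (Finset.mem_filter.1 hS).2
  · intro S hS
    exact Finset.erase_insert fun h => by
      simpa using Finset.mem_powerset.1 hS h
  · intro S hS; simp only [Finset.insert_erase (Finset.mem_filter.1 hS).2]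

theorem compl_insert_eq_sdiff (i : Fin m) (S : Finset (Fin m)) :
    (insert i S)ᶜ = Finset.univ.erase i \ S := by
  ext j
  simp only [Finset.mem_compl, Finset.mem_insert, Finset.mem_sdiff, Finset.mem_erase,
    Finset.mem_univ, and_true]
  tauto

/-- Expand the product over subsets: a letter in `S` selects the term 1 of its factor, a missing
letter selects −z/T_s. -/
theorem sum_wordPoly (T : Fin m → K) (i : Fin m) :
    ∑ S ∈ Finset.univ.filter (fun S => i ∈ S), wordPoly T S =
      ∏ s ∈ Finset.univ.erase i, (1 - C (T s)⁻¹ * X) := by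
  simp only [sub_eq_add_neg]
  rw [sum_filter_mem, Finset.prod_add]
  refine Finset.sum_congr rfl fun S _ => ?_
  rw [wordPoly, compl_insert_eq_sdiff, Finset.prod_const_one, one_mul]

theorem degree_wordPoly_lt (T : Fin m → K) {S : Finset (Fin m)} (hS : S ≠ ∅) :
    (wordPoly T S).degree < (m : WithBot ℕ) := by
  obtain ⟨i, hi⟩ := Finset.nonempty_iff_ne_empty.2 hS
  have h1 : (wordPoly T S).degree ≤ ((Sᶜ.card : ℕ) : WithBot ℕ) := by
    rw [wordPoly]
    refine (degree_prod_le _ _).trans ((Finset.sum_le_card_nsmul _ _ 1 fun s _ => ?_).trans_eq ?_)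
    · rw [degree_neg]
      exact degree_C_mul_X_le _
    · rw [nsmul_eq_mul, mul_one]
  refine h1.trans_lt ?_
  rw [Nat.cast_lt]
  refine (Finset.card_lt_univ_of_notMem (x := i) ?_).trans_eq (Fintype.card_fin m)
  simpa using hi

theorem wordPoly_swap {T : Fin m → K} (hT : ∀ i, T i ≠ 0) {S : Finset (Fin m)} {i j : Fin m}
    (hi : i ∈ S) (hj : j ∉ S) :
    wordPoly T (insert j (S.erase i)) = (T j / T i) • wordPoly T S := by
  have hij : i ≠ j := fun h => hj (h ▸ hi)
  have h1 : (insert j (S.erase i))ᶜ = insert i (Sᶜ.erase j) := by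
    ext k
    simp only [Finset.mem_compl, Finset.mem_insert, Finset.mem_erase]
    by_cases hki : k = i
    · subst hki; simp [hij]
    · by_cases hkj : k = j <;> simp [hki, hkj, hij.symm]
  have h2 : Sᶜ = insert j (Sᶜ.erase j) := (Finset.insert_erase (Finset.mem_compl.2 hj)).symm
  rw [wordPoly, wordPoly, h1, Finset.prod_insert (by simp [hi]), h2,
    Finset.prod_insert (Finset.notMem_erase _ _), Finset.erase_insert (Finset.notMem_erase _ _),
    smul_eq_C_mul, ← mul_assoc]
  congr 1
  rw [mul_neg, ← mul_assoc, ← C_mul]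
  congr 3
  field_simp [hT i, hT j]

variable {V : Type*} [AddCommGroup V] [Module K V]

/-- Each exchange of an element of S ∖ S' for one of S' ∖ S shrinks S ∖ S'. -/
theorem eq_of_card_eq_of_exchange {A : Type*} {G : Finset (Fin m) → A}
    (h : ∀ S i j, i ∈ S → j ∉ S → G (insert j (S.erase i)) = G S) {S S' : Finset (Fin m)}
    (hc : S.card = S'.card) : G S = G S' := by
  induction hk : (S \ S').card generalizing S with
  | zero =>
    rw [Finset.card_eq_zero, Finset.sdiff_eq_empty_iff_subset] at hk
    rw [Finset.eq_of_subset_of_card_le hk hc.ge]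
  | succ k ih =>
    obtain ⟨i, hi⟩ : (S \ S').Nonempty := Finset.card_pos.1 (by omega)
    have hk' : (S' \ S).card = k + 1 := by
      rw [← hk]; exact (Finset.card_sdiff_comm hc).symm
    obtain ⟨j, hj⟩ : (S' \ S).Nonempty := Finset.card_pos.1 (by omega)
    rw [Finset.mem_sdiff] at hi hj
    rw [← h S i j hi.1 hj.2]
    have hj' : j ∉ S.erase i := fun hm => hj.2 (Finset.mem_of_mem_erase hm)
    refine ih ?_ ?_
    · rw [Finset.card_insert_of_notMem hj', Finset.card_erase_of_mem hi.1, ← hc]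
      have := Finset.card_pos.2 ⟨i, hi.1⟩
      omega
    · have h1 : insert j (S.erase i) \ S' = (S \ S').erase i := by
        ext k
        simp only [Finset.mem_sdiff, Finset.mem_insert, Finset.mem_erase]
        constructor
        · rintro ⟨rfl | hk1, hk2⟩
          · exact absurd hj.1 hk2
          · exact ⟨hk1.1, hk1.2, hk2⟩
        · rintro ⟨h1, h2, h3⟩
          exact ⟨Or.inr ⟨h1, h2⟩, h3⟩
      rw [h1, Finset.card_erase_of_mem (Finset.mem_sdiff.2 hi), hk]
      rfl

/-- A linear map on polynomials of degree less than `m` that kills a Lagrange basis is zero. -/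
theorem eq_zero_of_lagrange {T : Fin m → K} (hT : Function.Injective T) (L : K[X] →ₗ[K] V)
    (hL : ∀ i, L (∏ s ∈ Finset.univ.erase i, (C (T s) - X)) = 0) {P : K[X]}
    (hP : P.degree < (m : WithBot ℕ)) : L P = 0 := by
  have h1 : P = Lagrange.interpolate Finset.univ T fun i => P.eval (T i) :=
    Lagrange.eq_interpolate hT.injOn (by rwa [Finset.card_univ, Fintype.card_fin])
  rw [h1, Lagrange.interpolate_apply, map_sum]
  refine Finset.sum_eq_zero fun i _ => ?_
  have h2 : Lagrange.basis Finset.univ T i =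
      C (∏ s ∈ Finset.univ.erase i, -(T i - T s)⁻¹) *
        ∏ s ∈ Finset.univ.erase i, (C (T s) - X) := by
    rw [Lagrange.basis, map_prod, ← Finset.prod_mul_distrib]
    refine Finset.prod_congr rfl fun s _ => ?_
    rw [Lagrange.basisDivisor, C_neg]
    ring
  rw [h2, ← mul_assoc, ← C_mul, ← smul_eq_C_mul, map_smul, hL, smul_zero]

/-- After division by T_S = ∏_{s∈S} T_s the exchange relation says F(S) = T_S φ(|S|). Regard φ as a
linear functional L with values in `V` on polynomials. The sum over the words containing i is then
T_i · L(∏_{s≠i}(T_s − z)). These products are multiples of the Lagrange basis, so L vanishes in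
degree < m, that is, φ(k) = 0 for 1 ≤ k ≤ m. -/
theorem eq_zero_of_exchange {T : Fin m → K} (hT : Function.Injective T) (hT0 : ∀ i, T i ≠ 0)
    {F : Finset (Fin m) → V}
    (hF : ∀ S i j, i ∈ S → j ∉ S → F (insert j (S.erase i)) = (T j / T i) • F S)
    (hsum : ∀ i, ∑ S ∈ Finset.univ.filter (fun S => i ∈ S), F S = 0) {S : Finset (Fin m)}
    (hS : S ≠ ∅) : F S = 0 := by
  set TS : Finset (Fin m) → K := fun S => ∏ s ∈ S, T s with hTS
  have hTS0 : ∀ S, TS S ≠ 0 := fun S => Finset.prod_ne_zero_iff.2 fun s _ => hT0 s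
  have hG : ∀ S i j, i ∈ S → j ∉ S →
      (TS (insert j (S.erase i)))⁻¹ • F (insert j (S.erase i)) = (TS S)⁻¹ • F S := by
    intro S i j hi hj
    rw [hF S i j hi hj, smul_smul]
    congr 1
    have h1 : TS S = T i * TS (S.erase i) := (Finset.mul_prod_erase S T hi).symm
    have h2 : TS (insert j (S.erase i)) = T j * TS (S.erase i) :=
      Finset.prod_insert fun hm => hj (Finset.mem_of_mem_erase hm)
    have := hTS0 (S.erase i)
    rw [h1, h2]
    field_simp [hT0 i, hT0 j]
  have hphi : ∃ φ : ℕ → V, ∀ S, F S = TS S • φ S.card := by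
    classical
    refine ⟨fun k => if h : ∃ S : Finset (Fin m), S.card = k then
      (TS h.choose)⁻¹ • F h.choose else 0, fun S => ?_⟩
    have hex : ∃ S' : Finset (Fin m), S'.card = S.card := ⟨S, rfl⟩
    simp only [dif_pos hex]
    have h1 : (TS hex.choose)⁻¹ • F hex.choose = (TS S)⁻¹ • F S :=
      eq_of_card_eq_of_exchange (G := fun S => (TS S)⁻¹ • F S) hG hex.choose_spec
    rw [h1, smul_inv_smul₀ (hTS0 S)]
  obtain ⟨φ, hφ⟩ := hphi
  have hm : 0 < m := by
    obtain ⟨i, -⟩ := Finset.nonempty_iff_ne_empty.2 hS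
    exact i.pos
  -- L is chosen so that (−z)^k ↦ φ(m − k): in the expansion of ∏_{s≠i}(T_s − z), the subset `S`
  -- leaves the power (−z)^{m−1−|S|}, which L sends to φ(|S| + 1).
  set L : K[X] →ₗ[K] V := (Polynomial.basisMonomials K).constr K
    fun k => ((-1 : K) ^ k) • φ (m - k) with hLdef
  have hLX : ∀ (c : K) k, L (C c * (-X) ^ k) = c • φ (m - k) := by
    intro c k
    have h1 : (C c * (-X) ^ k : K[X]) = (c * (-1) ^ k) • Polynomial.basisMonomials K k := by
      rw [Polynomial.coe_basisMonomials, smul_monomial, smul_eq_mul, mul_one, neg_pow,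
        ← C_mul_X_pow_eq_monomial, C_mul, C_pow, C_neg, C_1, mul_assoc]
    rw [h1, map_smul, hLdef, Module.Basis.constr_basis, smul_smul, mul_assoc, ← mul_pow]
    simp
  have hL : ∀ i, L (∏ s ∈ Finset.univ.erase i, (C (T s) - X)) = 0 := by
    intro i
    have h1 := hsum i
    rw [sum_filter_mem] at h1
    simp only [sub_eq_add_neg]
    rw [Finset.prod_add, map_sum]
    -- The factor T_i completes T_S to the product over `insert i S`.
    have h2 : T i • ∑ S ∈ (Finset.univ.erase i).powerset,
        L ((∏ s ∈ S, C (T s)) * ∏ s ∈ Finset.univ.erase i \ S, -X) = 0 := by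
      rw [← h1, Finset.smul_sum]
      refine Finset.sum_congr rfl fun S hS => ?_
      have hiS : i ∉ S := fun h => by simpa using Finset.mem_powerset.1 hS h
      have hins : TS (insert i S) = T i * TS S := Finset.prod_insert hiS
      rw [Finset.prod_const, ← map_prod, hLX, hφ, hins, mul_smul, Finset.card_insert_of_notMem hiS,
        Finset.card_sdiff_of_subset (Finset.mem_powerset.1 hS),
        Finset.card_erase_of_mem (Finset.mem_univ i), Finset.card_univ, Fintype.card_fin]
      have hcard := Finset.card_le_card (Finset.mem_powerset.1 hS)
      rw [Finset.card_erase_of_mem (Finset.mem_univ i), Finset.card_univ, Fintype.card_fin] at hcard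
      congr 3
      omega
    exact (smul_eq_zero.1 h2).resolve_left (hT0 i)
  have hc1 : 0 < S.card := Finset.card_pos.2 (Finset.nonempty_iff_ne_empty.2 hS)
  have hc2 : S.card ≤ m := (Finset.card_le_univ S).trans_eq (Fintype.card_fin m)
  have h1 := eq_zero_of_lagrange hT L hL (P := C 1 * (-X) ^ (m - S.card)) (by
    rw [C_1, one_mul, degree_pow, degree_neg, degree_X, nsmul_eq_mul, mul_one, Nat.cast_lt]
    omega)
  rw [hLX, one_smul, Nat.sub_sub_self hc2] at h1
  rw [hφ, h1, smul_zero]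

end Words

/-! ### The operators attached to words -/

variable {n : ℕ} {μ : YoungDiagram}

/-- The coefficient of `H̃_{α^{(j)}}` in `Φ_μ`. -/
noncomputable def phiCoeff (μ : YoungDiagram) (j : Fin (nCorners μ)) : QT :=
  ∏ s ∈ Finset.univ.erase j, (1 - Ti μ j / Ti μ s)⁻¹

theorem phiCoeff_ne_zero (j : Fin (nCorners μ)) : phiCoeff μ j ≠ 0 := by
  refine Finset.prod_ne_zero_iff.2 fun s hs => inv_ne_zero fun h => Finset.ne_of_mem_erase hs ?_
  rw [sub_eq_zero, eq_comm, div_eq_one_iff_eq (Ti_ne_zero s)] at h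
  exact (Ti_injective h).symm

theorem aeval_nabla_PhiMu (P : QT[X]) :
    aeval nabla P (PhiMu μ) = ∑ j, (P.eval (Ti μ j) * phiCoeff μ j) • Ht (predec μ j) := by
  rw [PhiMu, map_sum]
  refine Finset.sum_congr rfl fun j _ => ?_
  rw [map_smul, aeval_nabla_Ht, smul_smul, mul_comm]
  rfl

/-- The coefficient of H̃_{α^(j)} in P(∇)Φ_μ is P(T_j) times a nonzero constant. Independence of the
H̃ recovers the values at m distinct nodes, which determine a polynomial of degree < m. -/
theorem aeval_nabla_PhiMu_injOn {P Q : QT[X]} (hP : P.degree < (nCorners μ : WithBot ℕ))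
    (hQ : Q.degree < (nCorners μ : WithBot ℕ))
    (h : aeval nabla P (PhiMu μ) = aeval nabla Q (PhiMu μ)) : P = Q := by
  have hli : LinearIndependent QT fun j => Ht (predec μ j) :=
    linearIndependent_Ht.comp _ predec_injective
  refine eq_of_degrees_lt_of_eval_index_eq Finset.univ (Ti_injective (μ := μ)).injOn
    (by rwa [Finset.card_univ, Fintype.card_fin]) (by rwa [Finset.card_univ, Fintype.card_fin])
    fun j _ => ?_
  rw [aeval_nabla_PhiMu, aeval_nabla_PhiMu, ← sub_eq_zero, ← Finset.sum_sub_distrib] at h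
  simp only [← sub_smul] at h
  have h1 := Fintype.linearIndependent_iff.1 hli _ h j
  rw [← sub_mul] at h1
  exact sub_eq_zero.1 ((mul_eq_zero.1 h1).resolve_right (phiCoeff_ne_zero j))

/-- This property explains the coefficients of Φ_μ: the operator kills H̃_{α^(j)} for j ≠ i, and its
eigenvalue on H̃_{α^(i)} is the inverse of the coefficient there. -/
theorem aeval_nabla_lagrange (i : Fin (nCorners μ)) :
    aeval nabla (∏ s ∈ Finset.univ.erase i, (1 - C (Ti μ s)⁻¹ * X)) (PhiMu μ) =
      Ht (predec μ i) := by
  have hev : ∀ j, (∏ s ∈ Finset.univ.erase i, (1 - C (Ti μ s)⁻¹ * X)).eval (Ti μ j) =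
      ∏ s ∈ Finset.univ.erase i, (1 - Ti μ j / Ti μ s) := fun j => by
    rw [eval_prod]
    refine Finset.prod_congr rfl fun s _ => ?_
    rw [eval_sub, eval_one, eval_C_mul, eval_X, div_eq_inv_mul]
  rw [aeval_nabla_PhiMu, Finset.sum_eq_single i]
  · rw [hev, phiCoeff, Finset.prod_inv_distrib, mul_inv_cancel₀, one_smul]
    have := phiCoeff_ne_zero i
    rwa [phiCoeff, Finset.prod_inv_distrib, Ne, inv_eq_zero] at this
  · intro j _ hj
    rw [hev, Finset.prod_eq_zero (Finset.mem_erase.2 ⟨hj, Finset.mem_univ j⟩), zero_mul, zero_smul]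
    rw [div_self (Ti_ne_zero j), sub_self]
  · intro h; exact absurd (Finset.mem_univ i) h

variable {B : Set (XY n)} {Bi : Fin (nCorners μ) → Set (XY n)}

/-- The difference of the two sides satisfies the exchange relation. Its sum over the words
containing i is H̃_{α^(i)} − H̃_{α^(i)}, by the decomposition of M_{α^(i)} and the assumption C = H̃
on one side, and by `aeval_nabla_lagrange` on the other. -/
theorem IsSFBasis.frob_word (h : IsSFBasis n μ B Bi) (hμ : μ.card = n + 1)
    (hCH : ∀ i, frob n (ghM n (predec μ i)) = Ht (predec μ i))
    {S : Finset (Fin (nCorners μ))} (hS : S ≠ ∅) :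
    frob n (wordSpan B Bi {S}) = aeval nabla (wordPoly (Ti μ) S) (PhiMu μ) := by
  refine sub_eq_zero.1 (eq_zero_of_exchange (Ti_injective (μ := μ)) Ti_ne_zero
    (F := fun S => frob n (wordSpan B Bi {S}) - aeval nabla (wordPoly (Ti μ) S) (PhiMu μ))
    ?_ ?_ hS)
  · intro S i j hi hj
    rw [h.frob_swap hμ hi hj, wordPoly_swap Ti_ne_zero hi hj, map_smul, LinearMap.smul_apply,
      smul_sub]
  · intro i
    rw [Finset.sum_sub_distrib, ← h.frob_wordSpan hμ (by simp), ← h.ghM_eq i, hCH,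
      ← LinearMap.sum_apply, ← map_sum, sum_wordPoly, aeval_nabla_lagrange, sub_self]

theorem IsSFBasis.frob_wordSpan_eq (h : IsSFBasis n μ B Bi) (hμ : μ.card = n + 1)
    (hCH : ∀ i, frob n (ghM n (predec μ i)) = Ht (predec μ i))
    {E : Finset (Finset (Fin (nCorners μ)))} (hE : ∅ ∉ E) :
    frob n (wordSpan B Bi E) = aeval nabla (∑ S ∈ E, wordPoly (Ti μ) S) (PhiMu μ) := by
  rw [h.frob_wordSpan hμ hE, map_sum, LinearMap.sum_apply]
  exact Finset.sum_congr rfl fun S hS => h.frob_word hμ hCH (ne_of_mem_of_not_mem hS hE)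

end ScienceFiction

/-! ### The Bergeron–Haiman assignment in terms of words, and the recursion for the rows -/

namespace ScienceFiction

open Polynomial

/-! ### The words of the Bergeron–Haiman assignment -/

section RowSet

variable (μ : YoungDiagram)

/-- The words with the letter `1` at the corner in row `r`. -/
def cornerWords (r : ℕ) : Finset (Finset (Fin (nCorners μ))) :=
  Finset.univ.filter fun S => ∃ i ∈ S, coleg μ i = r

/-- The words of the modules assigned to the `k`-th row from the top, extended to all integers;
for `k = 0` this is an empty row above the diagram. -/
def rowSet : ℕ → ℤ → Finset (Finset (Fin (nCorners μ)))
  -- Starting from V on the left and 0 on the right, the general step already produces M_{α^(1)} on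
  -- the top row. Rows of equal length are covered as well, since a shift by 0 adds no words.
  | 0, s => if s < 0 then Finset.univ.erase ∅ else ∅
  | k + 1, s => rowSet k s ∪
      (rowSet k (s - ((μ.rowLen (nRows μ - (k + 1)) - μ.rowLen (nRows μ - k) : ℕ) : ℤ)) ∩
        cornerWords μ (nRows μ - (k + 1)))

variable {μ}

theorem rowLen_nRows : μ.rowLen (nRows μ) = 0 := by
  by_contra h
  have h1 : (nRows μ, 0) ∈ μ := YoungDiagram.mem_iff_lt_rowLen.2 (Nat.pos_of_ne_zero h)
  exact lt_irrefl _ (YoungDiagram.mem_iff_lt_colLen.1 h1)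

theorem rowLen_pos {r : ℕ} (h : r < nRows μ) : 0 < μ.rowLen r :=
  YoungDiagram.mem_iff_lt_rowLen.1 (YoungDiagram.mem_iff_lt_colLen.2 h)

theorem rowLen_step_le (k : ℕ) : μ.rowLen (nRows μ - k) ≤ μ.rowLen (nRows μ - (k + 1)) :=
  μ.rowLen_anti _ _ (by omega)

theorem cornerWords_subset (r : ℕ) : cornerWords μ r ⊆ Finset.univ.erase ∅ := fun S hS => by
  obtain ⟨i, hi, -⟩ := (Finset.mem_filter.1 hS).2
  exact Finset.mem_erase.2 ⟨Finset.ne_empty_of_mem hi, Finset.mem_univ _⟩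

theorem cornerWords_coleg (i : Fin (nCorners μ)) :
    cornerWords μ (coleg μ i) = Finset.univ.filter fun S => i ∈ S := by
  refine Finset.filter_congr fun S _ => ⟨?_, fun h => ⟨i, h, rfl⟩⟩
  rintro ⟨j, hj, he⟩
  rwa [← (coleg_strictAnti μ).injective he]

theorem mem_cornerWords_insert {r : ℕ} {i : Fin (nCorners μ)} (hi : coleg μ i ≠ r)
    (S : Finset (Fin (nCorners μ))) : insert i S ∈ cornerWords μ r ↔ S ∈ cornerWords μ r := by
  simp only [cornerWords, Finset.mem_filter, Finset.mem_univ, true_and, Finset.mem_insert,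
    exists_eq_or_imp, hi, false_or]

theorem rowSet_of_neg (k : ℕ) {s : ℤ} (hs : s < 0) : rowSet μ k s = Finset.univ.erase ∅ := by
  induction k generalizing s with
  | zero => rw [rowSet, if_pos hs]
  | succ k ih =>
    rw [rowSet, ih hs, Finset.union_eq_left]
    exact Finset.inter_subset_right.trans (cornerWords_subset _)

theorem rowSet_of_ge (k : ℕ) {s : ℤ} (hs : (μ.rowLen (nRows μ - k) : ℤ) ≤ s) :
    rowSet μ k s = ∅ := by
  induction k generalizing s with
  | zero => rw [rowSet, if_neg (by omega)]
  | succ k ih =>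
    have h1 := rowLen_step_le (μ := μ) k
    rw [rowSet, ih (by omega), ih (by omega), Finset.empty_inter, Finset.union_empty]

theorem rowSet_antitone (k : ℕ) : Antitone (rowSet μ k) := by
  induction k with
  | zero =>
    intro s s' h
    rw [rowSet, rowSet]
    split_ifs with h1 h2
    · exact le_rfl
    · omega
    · exact Finset.empty_subset _
    · exact le_rfl
  | succ k ih =>
    intro s s' h
    rw [rowSet, rowSet]
    exact Finset.union_subset_union (ih h)
      (Finset.inter_subset_inter_right (ih (sub_le_sub_right h _)))

theorem empty_notMem_rowSet (k : ℕ) (s : ℤ) : ∅ ∉ rowSet μ k s := by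
  induction k generalizing s with
  | zero => rw [rowSet]; split_ifs <;> simp
  | succ k ih =>
    rw [rowSet, Finset.mem_union, Finset.mem_inter]
    rintro (h | h)
    · exact ih _ h
    · exact ih _ h.1

/-- The top k rows impose conditions only on the letters of their own corners, so the letter of a
lower corner is free. At negative positions this fails for S = ∅ alone, which explains the
hypothesis on s. -/
theorem mem_rowSet_insert {k : ℕ} (hk : k ≤ nRows μ) {s : ℤ} (hs : 0 ≤ s)
    {i : Fin (nCorners μ)} (hi : coleg μ i < nRows μ - k) (S : Finset (Fin (nCorners μ))) :
    insert i S ∈ rowSet μ k s ↔ S ∈ rowSet μ k s := by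
  induction k generalizing s with
  | zero => rw [rowSet, if_neg (by omega)]; simp
  | succ k ih =>
    rw [rowSet, Finset.mem_union, Finset.mem_union, Finset.mem_inter, Finset.mem_inter,
      ih (by omega) hs (by omega), mem_cornerWords_insert (by omega)]
    refine or_congr_right ?_
    generalize (s - ((μ.rowLen (nRows μ - (k + 1)) - μ.rowLen (nRows μ - k) : ℕ) : ℤ)) = s'
    -- The shifted position may be negative; the corner condition then already forces the word to be
    -- nonempty.
    rcases lt_or_ge s' 0 with h | h
    · rw [rowSet_of_neg k h]
      refine and_congr_left fun hS => ?_
      have hne := (Finset.mem_erase.1 (cornerWords_subset _ hS)).1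
      simp [hne]
    · rw [ih (by omega) h (by omega)]

variable {n : ℕ} {B : Set (XY n)} {Bi : Fin (nCorners μ) → Set (XY n)}

/-- Sums and intersections of spans of basis elements follow unions and intersections of word sets.
The index shifts by one because `rowSet` counts the empty row above the diagram. -/
theorem IsSFBasis.bhAux_eq (h : IsSFBasis n μ B Bi) {k : ℕ} (hk : k < nRows μ) {s : ℕ}
    (hs : s < μ.rowLen (nRows μ - 1 - k)) :
    bhAux n μ k s = wordSpan B Bi (rowSet μ (k + 1) s) := by
  induction k generalizing s with
  | zero =>
    have h1 : nRows μ - 1 ∈ cornerRows μ := by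
      rw [cornerRows, Finset.mem_filter, Finset.mem_range, Nat.sub_add_cancel hk, rowLen_nRows]
      exact ⟨by omega, rowLen_pos (by omega)⟩
    obtain ⟨i, hi⟩ := exists_coleg_eq μ h1
    have h2 : rowSet μ (0 + 1) s = Finset.univ.filter fun S => i ∈ S := by
      rw [Nat.sub_zero] at hs
      rw [rowSet, rowSet_of_ge 0 (by rw [Nat.sub_zero, rowLen_nRows]; omega), Finset.empty_union,
        Nat.sub_zero, rowLen_nRows, Nat.sub_zero, zero_add, rowSet_of_neg 0 (by omega), ← hi,
        cornerWords_coleg, Finset.inter_eq_right, ← cornerWords_coleg]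
      exact cornerWords_subset _
    rw [h2, ← h.ghM_eq i, predec, hi]
    rfl
  | succ k ih =>
    have hr : nRows μ - 1 - (k + 1) + 1 = nRows μ - 1 - k := by omega
    have hr1 : nRows μ - (k + 1 + 1) = nRows μ - 1 - (k + 1) := by omega
    have hr2 : nRows μ - (k + 1) = nRows μ - 1 - k := by omega
    rw [rowSet, hr1, hr2]
    simp only [bhAux]
    rw [hr]
    set r := nRows μ - 1 - (k + 1) with hrdef
    by_cases hc : μ.rowLen r = μ.rowLen (nRows μ - 1 - k)
    · rw [if_pos hc, ih (by omega) (by omega), hc, Nat.sub_self, Nat.cast_zero, sub_zero,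
        Finset.union_eq_left.2 Finset.inter_subset_left]
    · have hlt : μ.rowLen (r + 1) < μ.rowLen r := by
        have h1 := μ.rowLen_anti r (r + 1) (Nat.le_succ r)
        rw [hr] at h1 ⊢
        omega
      have h1 : r ∈ cornerRows μ := by
        rw [cornerRows, Finset.mem_filter, Finset.mem_range]
        exact ⟨by omega, hlt⟩
      obtain ⟨i, hi⟩ := exists_coleg_eq μ h1
      have hext : ∀ z : ℤ, extendRow (Vmod n μ) (μ.rowLen (nRows μ - 1 - k)) (bhAux n μ k) z =
          wordSpan B Bi (rowSet μ (k + 1) z) := by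
        intro z
        rw [extendRow]
        split_ifs with h2 h3
        · rw [rowSet_of_neg _ h2, h.Vmod_eq]
        · rw [ih (by omega) (by omega), Int.toNat_of_nonneg (by omega)]
        · rw [rowSet_of_ge _ (by rw [hr2]; omega), wordSpan_empty]
      have hgh : ghM n (delEnd μ r) = wordSpan B Bi (cornerWords μ r) := by
        rw [← hi, cornerWords_coleg, ← h.ghM_eq i, predec]
      rw [if_neg hc, hext, hext, hgh, ← h.wordSpan_inter, ← wordSpan_union]

end RowSet

/-! ### The polynomials of the rows -/

section RowPoly

variable (μ : YoungDiagram)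

/-- The polynomial of the `k`-th row from the top. -/
noncomputable def rowPoly (k : ℕ) : QT[X] :=
  ∑ s ∈ Finset.range (μ.rowLen (nRows μ - k)),
    C (qq ^ s) * ∑ S ∈ rowSet μ k s, wordPoly (Ti μ) S

/-- `∏_j (1 - z / T_j)`. -/
noncomputable def cornerPoly : QT[X] := ∏ j, (1 - C (Ti μ j)⁻¹ * X)

variable {μ} {n : ℕ} {B : Set (XY n)} {Bi : Fin (nCorners μ) → Set (XY n)}

theorem IsSFBasis.isRowPoly (h : IsSFBasis n μ B Bi) (hμ : μ.card = n + 1)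
    (hCH : ∀ i, frob n (ghM n (predec μ i)) = Ht (predec μ i)) {r : ℕ} (hr : r < nRows μ) :
    IsRowPoly n μ r (rowPoly μ (nRows μ - r)) := by
  constructor
  · rw [rowPoly]
    refine mem_degreeLT.1 (Submodule.sum_mem _ fun s _ => ?_)
    rw [← smul_eq_C_mul]
    exact Submodule.smul_mem _ _ (Submodule.sum_mem _ fun S hS =>
      mem_degreeLT.2 (degree_wordPoly_lt _ (ne_of_mem_of_not_mem hS (empty_notMem_rowSet _ _))))
  · rw [rowL, rowPoly, map_sum, LinearMap.sum_apply, Nat.sub_sub_self hr.le]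
    refine Finset.sum_congr rfl fun s hs => ?_
    have h1 : nRows μ - 1 - (nRows μ - 1 - r) = r := by omega
    have h2 : nRows μ - 1 - r + 1 = nRows μ - r := by omega
    rw [← smul_eq_C_mul, map_smul, LinearMap.smul_apply, bh,
      h.bhAux_eq (by omega) (by rw [h1]; exact Finset.mem_range.1 hs), h2,
      h.frob_wordSpan_eq hμ hCH (empty_notMem_rowSet _ _)]

theorem IsSFBasis.isRowPoly_iff (h : IsSFBasis n μ B Bi) (hμ : μ.card = n + 1)
    (hCH : ∀ i, frob n (ghM n (predec μ i)) = Ht (predec μ i)) {r : ℕ} (hr : r < nRows μ)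
    {P : QT[X]} : IsRowPoly n μ r P ↔ P = rowPoly μ (nRows μ - r) := by
  have h1 := h.isRowPoly hμ hCH hr
  constructor
  · exact fun hP => aeval_nabla_PhiMu_injOn hP.1 h1.1 (hP.2.trans h1.2.symm)
  · rintro rfl; exact h1

/-- Deleting the letter i pairs the words of `E` with i and those without it, and multiplies the
polynomial of a word by −z/T_i. -/
theorem mul_sum_wordPoly_filter {m : ℕ} {T : Fin m → QT} {i : Fin m}
    {E : Finset (Finset (Fin m))} (hE : ∀ S, insert i S ∈ E ↔ S ∈ E) :
    (1 - C (T i)⁻¹ * X) * ∑ S ∈ E.filter (fun S => i ∈ S), wordPoly T S =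
      ∑ S ∈ E, wordPoly T S := by
  have h1 : ∑ S ∈ E.filter (fun S => i ∉ S), wordPoly T S =
      -(C (T i)⁻¹ * X) * ∑ S ∈ E.filter (fun S => i ∈ S), wordPoly T S := by
    rw [Finset.mul_sum]
    refine Finset.sum_nbij' (fun S => insert i S) (fun S => S.erase i) ?_ ?_ ?_ ?_ ?_
    · intro S hS
      rw [Finset.mem_filter] at hS ⊢
      exact ⟨(hE S).2 hS.1, Finset.mem_insert_self _ _⟩
    · intro S hS
      rw [Finset.mem_filter] at hS ⊢
      refine ⟨(hE _).1 ?_, Finset.notMem_erase _ _⟩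
      rw [Finset.insert_erase hS.2]; exact hS.1
    · intro S hS; exact Finset.erase_insert (Finset.mem_filter.1 hS).2
    · intro S hS; exact Finset.insert_erase (Finset.mem_filter.1 hS).2
    · intro S hS
      have hi : i ∈ Sᶜ := Finset.mem_compl.2 (Finset.mem_filter.1 hS).2
      rw [wordPoly, wordPoly, Finset.compl_insert, Finset.mul_prod_erase Sᶜ
        (fun s => -(C (T s)⁻¹ * X)) hi]
  rw [← Finset.sum_filter_add_sum_filter_not E (fun S => i ∈ S), h1]
  ring

theorem mul_sum_wordPoly_univ (i : Fin (nCorners μ)) :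
    (1 - C (Ti μ i)⁻¹ * X) * ∑ S ∈ Finset.univ.filter (fun S => i ∈ S), wordPoly (Ti μ) S =
      cornerPoly μ := by
  rw [sum_wordPoly, cornerPoly]
  exact Finset.mul_prod_erase Finset.univ (fun j => (1 - C (Ti μ j)⁻¹ * X)) (Finset.mem_univ i)

theorem rowPoly_succ_of_eq {k : ℕ}
    (hk : μ.rowLen (nRows μ - (k + 1)) = μ.rowLen (nRows μ - k)) :
    rowPoly μ (k + 1) = rowPoly μ k := by
  rw [rowPoly, rowPoly, hk]
  refine Finset.sum_congr rfl fun s _ => ?_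
  rw [rowSet, hk, Nat.sub_self, Nat.cast_zero, sub_zero,
    Finset.union_eq_left.2 Finset.inter_subset_left]

/-- Let A_s be the words at position s of the upper row and U the words containing i. By
inclusion–exclusion and monotonicity in s, p(B_s) = p(A_s) + p(A_{s−c} ∩ U) − p(A_s ∩ U).
Multiplication by w = 1 − z/T_i turns p(A_s ∩ U) into p(A_s) when s ≥ 0, and into `cornerPoly` when
s < 0. Summing with weights q^s, the first c cells give the geometric sum and the others q^c times
the polynomial of the upper row. -/
theorem rowPoly_succ {k : ℕ} (hk : k < nRows μ) {i : Fin (nCorners μ)}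
    (hi : coleg μ i = nRows μ - (k + 1)) {c : ℕ}
    (hc : μ.rowLen (nRows μ - (k + 1)) = c + μ.rowLen (nRows μ - k)) :
    (1 - C (Ti μ i)⁻¹ * X) * rowPoly μ (k + 1) =
      (C (qq ^ c) - C (Ti μ i)⁻¹ * X) * rowPoly μ k +
        (∑ s ∈ Finset.range c, C (qq ^ s)) * cornerPoly μ := by
  set w : QT[X] := 1 - C (Ti μ i)⁻¹ * X with hw
  set a := μ.rowLen (nRows μ - k) with ha
  set p : Finset (Finset (Fin (nCorners μ))) → QT[X] := fun E => ∑ S ∈ E, wordPoly (Ti μ) S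
  set U : Finset (Finset (Fin (nCorners μ))) := Finset.univ.filter fun S => i ∈ S with hU
  have hpU : ∀ s : ℤ, 0 ≤ s → w * p (rowSet μ k s ∩ U) = p (rowSet μ k s) := by
    intro s hs
    have : rowSet μ k s ∩ U = (rowSet μ k s).filter fun S => i ∈ S := by
      ext S; simp [hU]
    rw [this]
    exact mul_sum_wordPoly_filter fun S => mem_rowSet_insert hk.le hs (by omega) S
  have hpV : ∀ s : ℤ, s < 0 → w * p (rowSet μ k s ∩ U) = cornerPoly μ := by
    intro s hs
    have : rowSet μ k s ∩ U = U := by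
      rw [rowSet_of_neg k hs, Finset.inter_eq_right, hU, ← cornerWords_coleg]
      exact cornerWords_subset _
    rw [this]
    exact mul_sum_wordPoly_univ i
  have hrow : ∀ k, rowPoly μ k = ∑ s ∈ Finset.range (μ.rowLen (nRows μ - k)),
      C (qq ^ s) * p (rowSet μ k s) := fun _ => rfl
  have hp0 : p ∅ = 0 := Finset.sum_empty
  have hpi : ∀ E F, p (E ∪ F) + p (E ∩ F) = p E + p F := fun _ _ => Finset.sum_union_inter
  clear_value p w
  have hstep : ∀ s : ℕ, w * p (rowSet μ (k + 1) s) =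
      w * p (rowSet μ k s) + w * p (rowSet μ k ((s : ℤ) - c) ∩ U) - p (rowSet μ k s) := by
    intro s
    have h1 : rowSet μ (k + 1) s = rowSet μ k s ∪ (rowSet μ k ((s : ℤ) - c) ∩ U) := by
      rw [rowSet, hc, Nat.add_sub_cancel, ← hi, cornerWords_coleg]
    -- The words of a row decrease from left to right, so those at s are among those at s − c and
    -- only the corner condition survives.
    have h2 : rowSet μ k s ∩ (rowSet μ k ((s : ℤ) - c) ∩ U) = rowSet μ k s ∩ U := by
      rw [← Finset.inter_assoc, Finset.inter_eq_left.2
        (rowSet_antitone k (show (s : ℤ) - c ≤ s by omega))]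
    have h3 : p (rowSet μ k s ∪ (rowSet μ k ((s : ℤ) - c) ∩ U)) +
        p (rowSet μ k s ∩ (rowSet μ k ((s : ℤ) - c) ∩ U)) =
        p (rowSet μ k s) + p (rowSet μ k ((s : ℤ) - c) ∩ U) := hpi _ _
    rw [h2] at h3
    rw [h1]
    linear_combination w * h3 - hpU s (by positivity)
  have hlhs : w * rowPoly μ (k + 1) =
      ∑ s ∈ Finset.range (c + a), C (qq ^ s) * (w * p (rowSet μ (k + 1) s)) := by
    rw [hrow, hc, Finset.mul_sum]
    exact Finset.sum_congr rfl fun s _ => mul_left_comm _ _ _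
  have hA : ∑ s ∈ Finset.range (c + a), C (qq ^ s) * p (rowSet μ k s) = rowPoly μ k := by
    rw [hrow, ← ha]
    symm
    apply Finset.sum_subset (Finset.range_subset_range.2 (Nat.le_add_left _ _))
    intro s _ hs
    rw [Finset.mem_range, not_lt] at hs
    have h1 : rowSet μ k s = ∅ := rowSet_of_ge k (by rw [← ha]; exact_mod_cast hs)
    rw [h1, hp0, mul_zero]
  have hB : ∑ s ∈ Finset.range (c + a), C (qq ^ s) * (w * p (rowSet μ k ((s : ℤ) - c) ∩ U)) =
      (∑ s ∈ Finset.range c, C (qq ^ s)) * cornerPoly μ + C (qq ^ c) * rowPoly μ k := by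
    -- The first c cells of the new row look at negative positions of the upper row, where V is
    -- placed.
    have hB1 : ∑ s ∈ Finset.range c, C (qq ^ s) * (w * p (rowSet μ k ((s : ℤ) - c) ∩ U)) =
        (∑ s ∈ Finset.range c, C (qq ^ s)) * cornerPoly μ := by
      rw [Finset.sum_mul]
      refine Finset.sum_congr rfl fun s hs => ?_
      rw [hpV _ (by have := Finset.mem_range.1 hs; omega)]
    have hB2 : ∑ s ∈ Finset.range a,
        C (qq ^ (c + s)) * (w * p (rowSet μ k (((c + s : ℕ) : ℤ) - c) ∩ U)) =
          C (qq ^ c) * rowPoly μ k := by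
      rw [hrow, ← ha, Finset.mul_sum]
      refine Finset.sum_congr rfl fun s _ => ?_
      have : ((c + s : ℕ) : ℤ) - c = s := by push_cast; ring
      rw [this, hpU _ (by positivity), pow_add, C_mul, mul_assoc]
    rw [Finset.sum_range_add, hB1, hB2]
  have hsum : w * rowPoly μ (k + 1) = w * rowPoly μ k +
      ((∑ s ∈ Finset.range c, C (qq ^ s)) * cornerPoly μ + C (qq ^ c) * rowPoly μ k) -
        rowPoly μ k := by
    rw [hlhs, ← hB]
    conv_rhs => rw [← hA]
    rw [Finset.mul_sum, ← Finset.sum_add_distrib, ← Finset.sum_sub_distrib]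
    refine Finset.sum_congr rfl fun s _ => ?_
    rw [hstep]
    ring
  rw [hsum, hw]
  ring

end RowPoly

end ScienceFiction

/-! ### Solving the recursion and summing over the rows -/

namespace ScienceFiction

open Polynomial

variable {μ : YoungDiagram}

/-! ### Corner weights -/

theorem rowLen_eq_of_no_corner {r R : ℕ} (hrR : r ≤ R) (hR : R ≤ nRows μ)
    (h : ∀ i, r ≤ coleg μ i → R ≤ coleg μ i) : μ.rowLen r = μ.rowLen R := by
  induction R, hrR using Nat.le_induction with
  | base => rfl
  | succ R hrR ih =>
    have h1 : μ.rowLen R = μ.rowLen (R + 1) := by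
      by_contra hne
      have h2 := μ.rowLen_anti R (R + 1) (Nat.le_succ R)
      have h3 : R ∈ cornerRows μ := by
        rw [cornerRows, Finset.mem_filter, Finset.mem_range]
        exact ⟨by omega, by omega⟩
      obtain ⟨i, hi⟩ := exists_coleg_eq μ h3
      have := h i (by omega)
      omega
    rw [← h1]
    exact ih (by omega) fun i hi => (Nat.le_succ R).trans (h i hi)

theorem coarm_cast (i : Fin (nCorners μ)) :
    (coarm μ i : ℤ) = (μ.rowLen (coleg μ i) : ℤ) - 1 := by
  have := rowLen_succ_coleg_lt μ i
  rw [coarm]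
  omega

/-- No corner lies strictly between two consecutive corner rows, so the previous coarm is one less
than the length of the row just above corner i. For the first corner that row is empty, in agreement
with a_0 = −1. -/
theorem uw_castSucc (i : Fin (nCorners μ)) :
    uw μ i.castSucc = tt ^ coleg μ i * qq ^ ((μ.rowLen (coleg μ i + 1) : ℤ) - 1) := by
  rw [uw, Fin.snoc_castSucc, zpow_natCast]
  congr 2
  by_cases h0 : (i : ℕ) = 0
  · have h1 : i.castSucc = 0 := Fin.ext h0
    rw [h1, Fin.cons_zero, rowLen_eq_of_no_corner (coleg_lt μ i) le_rfl, rowLen_nRows]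
    · rfl
    · intro j hj
      have h2 : i ≤ j := Fin.le_def.2 (by omega)
      have := (coleg_strictAnti μ).antitone h2
      omega
  · have hlt : (i : ℕ) - 1 < nCorners μ := by have := i.isLt; omega
    set j : Fin (nCorners μ) := ⟨(i : ℕ) - 1, hlt⟩ with hj
    have h1 : i.castSucc = j.succ := Fin.ext (by simp [hj]; omega)
    have hji : j < i := Fin.lt_def.2 (by simp [hj]; omega)
    rw [h1, Fin.cons_succ, coarm_cast]
    rw [rowLen_eq_of_no_corner (coleg_strictAnti μ hji) (coleg_lt μ j).le]
    intro l hl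
    have h2 : l < i := (coleg_strictAnti μ).lt_iff_gt.1 hl
    exact (coleg_strictAnti μ).antitone (Fin.le_def.2 (by have := Fin.lt_def.1 h2; simp [hj]; omega))

/-- The bottom row has the length of the last corner row, and l_{m+1} = −1 supplies t⁻¹. -/
theorem uw_last (hm : 0 < nCorners μ) :
    uw μ (Fin.last _) = tt⁻¹ * qq ^ ((μ.rowLen 0 : ℤ) - 1) := by
  set j : Fin (nCorners μ) := ⟨nCorners μ - 1, by omega⟩ with hj
  have h1 : Fin.last (nCorners μ) = j.succ := Fin.ext (by simp [hj]; omega)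
  rw [uw, Fin.snoc_last, zpow_neg_one, h1, Fin.cons_succ, coarm_cast,
    ← rowLen_eq_of_no_corner (Nat.zero_le _) (coleg_lt μ j).le]
  intro l _
  exact (coleg_strictAnti μ).antitone (Fin.le_def.2 (by have := l.isLt; simp [hj]; omega))

theorem xw_succ_div (i : Fin (nCorners μ)) : xw μ i.succ / Tw μ = (Ti μ i)⁻¹ := by
  rw [xw, Fin.cons_succ, ← Ti_mul i, div_mul_cancel_left₀]
  exact mul_ne_zero (pow_ne_zero _ tt_ne_zero) (pow_ne_zero _ qq_ne_zero)

theorem qq_mul_xw_succ (i : Fin (nCorners μ)) :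
    qq * xw μ i.succ = tt ^ coleg μ i * qq ^ μ.rowLen (coleg μ i) := by
  have h : μ.rowLen (coleg μ i) = coarm μ i + 1 := by
    have := coarm_cast i
    omega
  rw [xw, Fin.cons_succ, h, pow_succ]
  ring

theorem qq_mul_uw_castSucc (i : Fin (nCorners μ)) :
    qq * uw μ i.castSucc = tt ^ coleg μ i * qq ^ μ.rowLen (coleg μ i + 1) := by
  rw [uw_castSucc, zpow_sub_one₀ qq_ne_zero, zpow_natCast]
  field_simp [qq_ne_zero]

theorem uw_ne_zero (s : Fin (nCorners μ + 1)) : uw μ s ≠ 0 :=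
  mul_ne_zero (zpow_ne_zero _ tt_ne_zero) (zpow_ne_zero _ qq_ne_zero)

/-- The exponent is the jump c of the row lengths at the corner; this identifies q^c in the
recursion with a ratio of corner weights. -/
theorem xw_div_uw (i : Fin (nCorners μ)) : xw μ i.succ / uw μ i.castSucc =
    qq ^ (μ.rowLen (coleg μ i) - μ.rowLen (coleg μ i + 1)) := by
  rw [div_eq_iff (uw_ne_zero _)]
  apply mul_left_cancel₀ qq_ne_zero
  rw [mul_left_comm, qq_mul_xw_succ, qq_mul_uw_castSucc, mul_left_comm, ← pow_add,
    Nat.sub_add_cancel (rowLen_succ_coleg_lt μ i).le]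

/-! ### Solution of the recursion -/

theorem ratFunc_factor_ne_zero (a : QT) : (1 - RatFunc.C a * RatFunc.X : RatFunc QT) ≠ 0 := by
  have h : (1 - C a * X : QT[X]) ≠ 0 := fun h => by
    have := congrArg (eval 0) h
    simp at this
  have h2 := RatFunc.algebraMap_ne_zero h
  simpa using h2

theorem X_div_C (a : QT) : (RatFunc.X / RatFunc.C a : RatFunc QT) = RatFunc.C a⁻¹ * RatFunc.X := by
  rw [map_inv₀, div_eq_inv_mul]

theorem algebraMap_cornerPoly : algebraMap QT[X] (RatFunc QT) (cornerPoly μ) =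
    ∏ j, (1 - RatFunc.C (Ti μ j)⁻¹ * RatFunc.X) := by
  simp [cornerPoly, map_prod]

/-- The factor attached to the `s`-th corner. -/
noncomputable def cornerFactor (μ : YoungDiagram) (s : Fin (nCorners μ)) : RatFunc QT :=
  (1 - RatFunc.C (uw μ s.castSucc / Tw μ) * RatFunc.X) /
    (1 - RatFunc.C (xw μ s.succ / Tw μ) * RatFunc.X)

/-- The corners in the `k` top rows. -/
def topCorners (μ : YoungDiagram) (k : ℕ) : Finset (Fin (nCorners μ)) :=
  Finset.univ.filter fun s => nRows μ - k ≤ coleg μ s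

theorem topCorners_zero : topCorners μ 0 = ∅ := by
  refine Finset.filter_eq_empty_iff.2 fun s _ => ?_
  have := coleg_lt μ s
  omega

theorem topCorners_top : topCorners μ (nRows μ) = Finset.univ := by
  refine Finset.filter_true_of_mem fun s _ => ?_
  omega

/-- Either the next row ends in a corner, or it has the same length as the row above it. -/
theorem corner_or_eq {k : ℕ} (hk : k < nRows μ) :
    (∃ i, coleg μ i = nRows μ - (k + 1) ∧ i ∉ topCorners μ k ∧
      topCorners μ (k + 1) = insert i (topCorners μ k)) ∨
    (μ.rowLen (nRows μ - (k + 1)) = μ.rowLen (nRows μ - k) ∧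
      topCorners μ (k + 1) = topCorners μ k) := by
  by_cases h : ∃ i, coleg μ i = nRows μ - (k + 1)
  · obtain ⟨i, hi⟩ := h
    refine Or.inl ⟨i, hi, ?_, ?_⟩
    · rw [topCorners, Finset.mem_filter]
      omega
    · ext s
      simp only [topCorners, Finset.mem_filter, Finset.mem_univ, true_and, Finset.mem_insert]
      constructor
      · intro hs
        by_cases hsi : s = i
        · exact Or.inl hsi
        · have : coleg μ s ≠ coleg μ i := fun he => hsi ((coleg_strictAnti μ).injective he)
          right; omega
      · rintro (rfl | hs) <;> omega
  · push Not at h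
    have h1 : ∀ i, nRows μ - (k + 1) ≤ coleg μ i → nRows μ - k ≤ coleg μ i := fun i hi => by
      have := h i
      omega
    refine Or.inr ⟨rowLen_eq_of_no_corner (by omega) (by omega) h1, ?_⟩
    exact Finset.filter_congr fun i _ => ⟨h1 i, fun h2 => by omega⟩

theorem one_sub_mul_geom_sum (c : ℕ) :
    (1 - qq) * ∑ s ∈ Finset.range c, qq ^ s = 1 - qq ^ c := by
  rw [mul_comm, geom_sum_mul_neg]

theorem qq_sub_one_ne_zero : qq - 1 ≠ 0 := fun h =>
  tt_pow_mul_qq_pow_ne_one (a := 0) (b := 1) (Or.inr one_ne_zero)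
    (by simpa using sub_eq_zero.1 h)

theorem one_sub_qq_ne_zero : 1 - qq ≠ 0 := fun h =>
  qq_sub_one_ne_zero (by rw [← neg_sub, h, neg_zero])

theorem tt_sub_one_ne_zero : tt - 1 ≠ 0 := fun h =>
  tt_pow_mul_qq_pow_ne_one (a := 1) (b := 0) (Or.inl one_ne_zero)
    (by simpa using sub_eq_zero.1 h)

theorem rowPoly_zero : rowPoly μ 0 = 0 := by
  rw [rowPoly, Nat.sub_zero, rowLen_nRows, Finset.range_zero, Finset.sum_empty]

theorem algebraMap_rowPoly_succ {k : ℕ} (hk : k < nRows μ) {i : Fin (nCorners μ)}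
    (hi : coleg μ i = nRows μ - (k + 1)) :
    (1 - RatFunc.C (Ti μ i)⁻¹ * RatFunc.X) * algebraMap QT[X] (RatFunc QT) (rowPoly μ (k + 1)) =
      (RatFunc.C (qq ^ (μ.rowLen (coleg μ i) - μ.rowLen (coleg μ i + 1))) -
        RatFunc.C (Ti μ i)⁻¹ * RatFunc.X) * algebraMap QT[X] (RatFunc QT) (rowPoly μ k) +
      RatFunc.C (∑ s ∈ Finset.range (μ.rowLen (coleg μ i) - μ.rowLen (coleg μ i + 1)), qq ^ s) *
        algebraMap QT[X] (RatFunc QT) (cornerPoly μ) := by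
  have hr : coleg μ i + 1 = nRows μ - k := by omega
  have hlt := rowLen_succ_coleg_lt μ i
  have h := congrArg (algebraMap QT[X] (RatFunc QT)) (rowPoly_succ hk hi
    (c := μ.rowLen (coleg μ i) - μ.rowLen (coleg μ i + 1)) (by rw [← hi, ← hr]; omega))
  simpa only [map_mul, map_sub, map_add, map_one, map_sum, RatFunc.algebraMap_C,
    RatFunc.algebraMap_X] using h

/-- Substitute (1−q)Π = D(1 − G), D being `cornerPoly`. Since (q^c − z/T_i) + (1 − q^c) = 1 − z/T_i,
the inhomogeneous term is absorbed and G is multiplied by (q^c − z/T_i)/(1 − z/T_i) at each corner,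
starting from G = 1. -/
theorem algebraMap_rowPoly {k : ℕ} (hk : k ≤ nRows μ) :
    RatFunc.C (1 - qq) * algebraMap QT[X] (RatFunc QT) (rowPoly μ k) =
      algebraMap QT[X] (RatFunc QT) (cornerPoly μ) *
        (1 - ∏ s ∈ topCorners μ k,
          RatFunc.C (xw μ s.succ / uw μ s.castSucc) * cornerFactor μ s) := by
  induction k with
  | zero => rw [topCorners_zero, Finset.prod_empty, rowPoly_zero, map_zero, sub_self, mul_zero,
      mul_zero]
  | succ k ih =>
    have ih := ih (by omega)
    rcases corner_or_eq (μ := μ) (k := k) (by omega) with ⟨i, hi, hni, htop⟩ | ⟨hlen, htop⟩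
    · have hrec := algebraMap_rowPoly_succ (μ := μ) (by omega) hi
      have hgeom := congrArg (RatFunc.C (K := QT)) (one_sub_mul_geom_sum
        (μ.rowLen (coleg μ i) - μ.rowLen (coleg μ i + 1)))
      rw [htop, Finset.prod_insert hni]
      set R := algebraMap QT[X] (RatFunc QT) (rowPoly μ k)
      set R' := algebraMap QT[X] (RatFunc QT) (rowPoly μ (k + 1))
      set D := algebraMap QT[X] (RatFunc QT) (cornerPoly μ)
      set G := ∏ s ∈ topCorners μ k, RatFunc.C (xw μ s.succ / uw μ s.castSucc) * cornerFactor μ s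
      have hw := ratFunc_factor_ne_zero (Ti μ i)⁻¹
      -- Uses q^c = x/u and x/T_μ = 1/T_i, so that q^c · u/T_μ = 1/T_i.
      have hfac : (1 - RatFunc.C (Ti μ i)⁻¹ * RatFunc.X) *
          (RatFunc.C (xw μ i.succ / uw μ i.castSucc) * cornerFactor μ i) =
          RatFunc.C (qq ^ (μ.rowLen (coleg μ i) - μ.rowLen (coleg μ i + 1))) -
            RatFunc.C (Ti μ i)⁻¹ * RatFunc.X := by
        rw [cornerFactor, xw_succ_div, mul_left_comm, mul_div_cancel₀ _ hw, mul_sub, mul_one,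
          ← mul_assoc, ← map_mul, ← xw_succ_div, ← xw_div_uw]
        congr 3
        field_simp [uw_ne_zero, Tw_ne_zero]
      apply mul_left_cancel₀ hw
      rw [map_mul, map_sub, map_sub, map_one] at hgeom
      rw [map_sub, map_one] at ih ⊢
      linear_combination (1 - RatFunc.C qq) * hrec + (RatFunc.C (qq ^ (μ.rowLen (coleg μ i) -
        μ.rowLen (coleg μ i + 1))) - RatFunc.C (Ti μ i)⁻¹ * RatFunc.X) * ih + D * hgeom +
        D * G * hfac
    · rw [htop, rowPoly_succ_of_eq hlen, ih]

theorem topCorners_eq {r : ℕ} {i : Fin (nCorners μ)} (hr : r < nRows μ)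
    (h : μ.rowLen r = μ.rowLen (coleg μ i)) :
    topCorners μ (nRows μ - r) = Finset.univ.filter fun s => s ≤ i := by
  have hlt := rowLen_succ_coleg_lt μ i
  refine Finset.filter_congr fun s _ => ?_
  rw [Nat.sub_sub_self hr.le]
  constructor
  · intro hs
    by_contra! hlt'
    have h1 := μ.rowLen_anti _ _ (coleg_strictAnti μ hlt')
    have h2 := rowLen_succ_coleg_lt μ s
    have h3 := μ.rowLen_anti _ _ hs
    simp only [Nat.succ_eq_add_one] at h1
    omega
  · intro hs
    have h1 := (coleg_strictAnti μ).antitone hs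
    by_contra! hlt'
    have h2 := μ.rowLen_anti (coleg μ i + 1) r (by omega)
    omega

/-! ### The sum over all the rows -/

/-- The exponents are the jumps of the row lengths, which add up from the empty row above the
diagram. -/
theorem prod_xw_div_uw_topCorners {k : ℕ} (hk : k ≤ nRows μ) :
    ∏ s ∈ topCorners μ k, xw μ s.succ / uw μ s.castSucc = qq ^ μ.rowLen (nRows μ - k) := by
  induction k with
  | zero => rw [topCorners_zero, Finset.prod_empty, Nat.sub_zero, rowLen_nRows, pow_zero]
  | succ k ih =>
    rcases corner_or_eq (μ := μ) (k := k) (by omega) with ⟨i, hi, hni, htop⟩ | ⟨hlen, htop⟩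
    · have hr : coleg μ i + 1 = nRows μ - k := by omega
      have hlt := rowLen_succ_coleg_lt μ i
      rw [htop, Finset.prod_insert hni, ih (by omega), xw_div_uw, ← hr, ← pow_add, ← hi,
        Nat.sub_add_cancel hlt.le]
    · rw [htop, ih (by omega), hlen]

theorem algebraMap_C_mul (a : QT) (P : QT[X]) :
    algebraMap QT[X] (RatFunc QT) (C a * P) = RatFunc.C a * algebraMap QT[X] (RatFunc QT) P := by
  rw [map_mul, RatFunc.algebraMap_C]

/-- Let H_k be the product of the corner factors of the top k rows. The increment of the bracket on
the right equals the new summand exactly when H_k(1 − u z/T_μ) = H_{k+1}(1 − x z/T_μ) at a corner, x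
and u being the weights t^r q^{b−1} and t^r q^{a−1} for the new row r of length b below a row of
length a. This is the definition of the corner factor; without a corner, a = b and H does not
change. -/
theorem telescoped_sum {k : ℕ} (hk : k ≤ nRows μ) :
    RatFunc.C ((tt - 1) * (1 - qq) / Tw μ) * RatFunc.X *
      algebraMap QT[X] (RatFunc QT)
        (∑ j ∈ Finset.range k, C (tt ^ (nRows μ - (j + 1))) * rowPoly μ (j + 1)) =
      algebraMap QT[X] (RatFunc QT) (cornerPoly μ) *
        (RatFunc.C (tt * qq) * (1 - ∏ s ∈ topCorners μ k, cornerFactor μ s) -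
          RatFunc.C (tt ^ (nRows μ - k) / Tw μ) * RatFunc.X *
            (1 - RatFunc.C (qq ^ μ.rowLen (nRows μ - k)) *
              ∏ s ∈ topCorners μ k, cornerFactor μ s)) := by
  induction k with
  | zero =>
    simp only [topCorners_zero, Nat.sub_zero, rowLen_nRows, Finset.prod_empty, Finset.range_zero,
      Finset.sum_empty, map_zero, pow_zero, map_one, mul_zero, mul_one, sub_self]
  | succ k ih =>
    have ih := ih (by omega)
    have hrow := algebraMap_rowPoly hk
    rw [Finset.prod_mul_distrib, ← map_prod, prod_xw_div_uw_topCorners hk] at hrow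
    rw [Finset.sum_range_succ, map_add, mul_add, ih, algebraMap_C_mul]
    have hpow : tt ^ (nRows μ - k) = tt * tt ^ (nRows μ - (k + 1)) := by
      rw [← pow_succ']
      congr 1
      omega
    have hT : RatFunc.C (Tw μ) ≠ (0 : RatFunc QT) := by
      rw [Ne, map_eq_zero]; exact Tw_ne_zero μ
    rcases corner_or_eq (μ := μ) (k := k) (by omega) with ⟨i, hi, hni, htop⟩ | ⟨hlen, htop⟩
    · have hr : coleg μ i + 1 = nRows μ - k := by omega
      have hx := congrArg (RatFunc.C (K := QT)) (qq_mul_xw_succ i)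
      have hu := congrArg (RatFunc.C (K := QT)) (qq_mul_uw_castSucc i)
      have hw := ratFunc_factor_ne_zero (xw μ i.succ / Tw μ)
      have hfac : (1 - RatFunc.C (xw μ i.succ / Tw μ) * RatFunc.X) * cornerFactor μ i =
          1 - RatFunc.C (uw μ i.castSucc / Tw μ) * RatFunc.X := by
        rw [cornerFactor, mul_div_cancel₀ _ hw]
      rw [htop, Finset.prod_insert hni] at hrow ⊢
      rw [hr, hi] at hu
      rw [hi] at hx
      rw [hpow]
      set R' := algebraMap QT[X] (RatFunc QT) (rowPoly μ (k + 1))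
      set D := algebraMap QT[X] (RatFunc QT) (cornerPoly μ)
      set H := ∏ s ∈ topCorners μ k, cornerFactor μ s
      set f := cornerFactor μ i
      rw [map_mul, map_mul] at hx hu
      rw [map_sub, map_one] at hrow
      rw [map_div₀, map_div₀] at hfac
      rw [map_div₀, map_div₀, map_div₀, map_mul, map_mul, map_mul, map_sub, map_sub, map_one]
      linear_combination (RatFunc.C tt - 1) / RatFunc.C (Tw μ) * RatFunc.X *
        RatFunc.C (tt ^ (nRows μ - (k + 1))) * hrow + D * RatFunc.C tt * H * RatFunc.C qq * hfac +
        D * RatFunc.C tt * H * RatFunc.X / RatFunc.C (Tw μ) * f * hx -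
        D * RatFunc.C tt * H * RatFunc.X / RatFunc.C (Tw μ) * hu
    · rw [htop] at hrow ⊢
      rw [hlen] at hrow ⊢
      rw [hpow]
      rw [map_sub, map_one] at hrow
      rw [map_div₀, map_div₀, map_div₀, map_mul, map_mul, map_mul, map_sub, map_sub, map_one]
      set R' := algebraMap QT[X] (RatFunc QT) (rowPoly μ (k + 1))
      set D := algebraMap QT[X] (RatFunc QT) (cornerPoly μ)
      set H := ∏ s ∈ topCorners μ k, cornerFactor μ s
      linear_combination (RatFunc.C tt - 1) / RatFunc.C (Tw μ) * RatFunc.X *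
        RatFunc.C (tt ^ (nRows μ - (k + 1))) * hrow

/-- Both products equal 1 at z = 0, so `divX` is an exact division. -/
theorem X_mul_finalPoly : X * finalPoly μ =
    C (Tw μ / ((1 - 1 / tt) * (1 - 1 / qq))) *
      ((∏ s, (1 - C (uw μ s / Tw μ) * X)) - ∏ s, (1 - C (xw μ s / Tw μ) * X)) := by
  set p : QT[X] := (∏ s, (1 - C (uw μ s / Tw μ) * X)) - ∏ s, (1 - C (xw μ s / Tw μ) * X)
    with hp
  have h0 : p.coeff 0 = 0 := by
    rw [coeff_zero_eq_eval_zero, hp, eval_sub, eval_prod, eval_prod]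
    simp
  have h1 := p.divX_mul_X_add
  rw [h0, C_0, add_zero] at h1
  rw [finalPoly, ← hp]
  conv_rhs => rw [← h1]
  ring

theorem nRows_pos (hμ : 0 < μ.card) : 0 < nRows μ := by
  obtain ⟨⟨a, b⟩, hc⟩ := Finset.card_pos.1 hμ
  have h1 := YoungDiagram.mem_iff_lt_colLen.1 (μ.mem_cells _ |>.1 hc)
  exact (Nat.zero_le a).trans_lt (h1.trans_le (μ.colLen_anti 0 b (Nat.zero_le b)))

theorem nCorners_pos (h : 0 < nRows μ) : 0 < nCorners μ := by
  refine Finset.card_pos.2 ⟨nRows μ - 1, ?_⟩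
  rw [cornerRows, Finset.mem_filter, Finset.mem_range, Nat.sub_add_cancel h, rowLen_nRows]
  exact ⟨by omega, rowLen_pos (by omega)⟩

/-- At the bottom row the bracket becomes tq{(1 − x_0 z/T_μ) − (1 − u_m z/T_μ)H}, because 1 = tq·x_0
and q^{rowLen 0} = tq·u_m. Multiplied by D it is the difference of the full products over x and u,
as D and DH are the products over x_1, …, x_m and u_0, …, u_{m−1}. -/
theorem sum_rowPoly_eq_finalPoly (hN : 0 < nRows μ) :
    ∑ j ∈ Finset.range (nRows μ), C (tt ^ (nRows μ - (j + 1))) * rowPoly μ (j + 1) =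
      finalPoly μ := by
  have htel := telescoped_sum (μ := μ) le_rfl
  rw [topCorners_top, Nat.sub_self, pow_zero] at htel
  have hfin := congrArg (algebraMap QT[X] (RatFunc QT)) (X_mul_finalPoly (μ := μ))
  rw [Fin.prod_univ_castSucc, Fin.prod_univ_succ, uw_last (nCorners_pos hN)] at hfin
  have hD : algebraMap QT[X] (RatFunc QT) (cornerPoly μ) =
      ∏ i, (1 - RatFunc.C (xw μ (Fin.succ i) / Tw μ) * RatFunc.X) := by
    rw [algebraMap_cornerPoly]
    exact Finset.prod_congr rfl fun i _ => by rw [xw_succ_div]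
  have hDH : algebraMap QT[X] (RatFunc QT) (cornerPoly μ) * ∏ s, cornerFactor μ s =
      ∏ i, (1 - RatFunc.C (uw μ (Fin.castSucc i) / Tw μ) * RatFunc.X) := by
    rw [hD, ← Finset.prod_mul_distrib]
    refine Finset.prod_congr rfl fun i _ => ?_
    rw [cornerFactor, mul_div_cancel₀ _ (ratFunc_factor_ne_zero _)]
  have hx0 : xw μ 0 = (tt * qq)⁻¹ := rfl
  simp only [map_mul, map_sub, map_prod, map_one, RatFunc.algebraMap_C, RatFunc.algebraMap_X]
    at hfin
  rw [← hD, ← hDH, hx0] at hfin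
  apply RatFunc.algebraMap_injective QT
  have hc : RatFunc.C ((tt - 1) * (1 - qq) / Tw μ) * RatFunc.X ≠ (0 : RatFunc QT) := by
    refine mul_ne_zero ?_ RatFunc.X_ne_zero
    rw [Ne, map_eq_zero]
    exact div_ne_zero (mul_ne_zero tt_sub_one_ne_zero one_sub_qq_ne_zero) (Tw_ne_zero μ)
  apply mul_left_cancel₀ hc
  rw [htel, mul_assoc _ RatFunc.X (algebraMap _ _ (finalPoly μ)), hfin]
  -- The minus sign comes from 1 − q against q − 1, and matches the opposite order of the two
  -- products in `finalPoly`.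
  have e1 : RatFunc.C ((tt - 1) * (1 - qq) / Tw μ) *
      RatFunc.C (Tw μ / ((1 - 1 / tt) * (1 - 1 / qq))) = -RatFunc.C (tt * qq) := by
    rw [← map_mul, ← map_neg]
    congr 1
    have h1 := tt_sub_one_ne_zero
    have h2 := qq_sub_one_ne_zero
    have h3 := tt_ne_zero
    have h4 := qq_ne_zero
    have h5 := Tw_ne_zero μ
    have h6 : 1 - 1 / tt = (tt - 1) / tt := by field_simp
    have h7 : 1 - 1 / qq = (qq - 1) / qq := by field_simp
    rw [h6, h7]
    field_simp
    ring
  have e2 : RatFunc.C (tt * qq) * RatFunc.C ((tt * qq)⁻¹ / Tw μ) = RatFunc.C (1 / Tw μ) := by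
    rw [← map_mul, ← mul_div_assoc, mul_inv_cancel₀ (mul_ne_zero tt_ne_zero qq_ne_zero)]
  have e3 : RatFunc.C (tt * qq) * RatFunc.C (tt⁻¹ * qq ^ ((μ.rowLen 0 : ℤ) - 1) / Tw μ) =
      RatFunc.C (1 / Tw μ) * RatFunc.C (qq ^ μ.rowLen 0) := by
    rw [← map_mul, ← map_mul]
    congr 1
    rw [zpow_sub_one₀ qq_ne_zero, zpow_natCast]
    have h3 := tt_ne_zero
    have h4 := qq_ne_zero
    have h5 := Tw_ne_zero μ
    field_simp
  rw [← mul_assoc, e1]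
  set D := algebraMap QT[X] (RatFunc QT) (cornerPoly μ)
  set H := ∏ s, cornerFactor μ s
  linear_combination D * RatFunc.X * e2 - D * H * RatFunc.X * e3

variable {n : ℕ} {B : Set (XY n)} {Bi : Fin (nCorners μ) → Set (XY n)}

theorem bhSum_eq_sum_rowL : bhSum n μ = ∑ r ∈ Finset.range (nRows μ), tt ^ r • rowL n μ r := by
  simp only [rowL, Finset.smul_sum, smul_smul]
  rw [bhSum, Finset.sum_sigma']
  refine Finset.sum_nbij' (fun c => ⟨c.1, c.2⟩) (fun c => (c.1, c.2)) ?_ ?_ ?_ ?_ ?_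
  · rintro ⟨a, b⟩ hc
    rw [YoungDiagram.mem_cells] at hc
    rw [Finset.mem_sigma, Finset.mem_range, Finset.mem_range]
    exact ⟨(YoungDiagram.mem_iff_lt_colLen.1 hc).trans_le (μ.colLen_anti 0 b (Nat.zero_le b)),
      YoungDiagram.mem_iff_lt_rowLen.1 hc⟩
  · rintro ⟨a, b⟩ hc
    rw [Finset.mem_sigma, Finset.mem_range, Finset.mem_range] at hc
    exact (YoungDiagram.mem_cells _).2 (YoungDiagram.mem_iff_lt_rowLen.2 hc.2)
  · intro c _; rfl
  · intro c _; rfl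
  · intro c _; rfl

theorem IsSFBasis.bhSum_eq (h : IsSFBasis n μ B Bi) (hμ : μ.card = n + 1)
    (hCH : ∀ i, frob n (ghM n (predec μ i)) = Ht (predec μ i)) :
    bhSum n μ = aeval nabla (finalPoly μ) (PhiMu μ) := by
  rw [bhSum_eq_sum_rowL, ← sum_rowPoly_eq_finalPoly (nRows_pos (by omega)), map_sum,
    LinearMap.sum_apply, ← Finset.sum_range_reflect]
  refine Finset.sum_congr rfl fun j hj => ?_
  have hj := Finset.mem_range.1 hj
  have h1 : nRows μ - 1 - j = nRows μ - (j + 1) := by omega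
  rw [h1, ← (h.isRowPoly hμ hCH (r := nRows μ - (j + 1)) (by omega)).2,
    Nat.sub_sub_self (by omega), ← smul_eq_C_mul, map_smul, LinearMap.smul_apply]

theorem rowPoly_recursion {r : ℕ} {i : Fin (nCorners μ)} (hr : r + 1 < nRows μ)
    (hi : coleg μ i = r) :
    algebraMap QT[X] (RatFunc QT) (rowPoly μ (nRows μ - r)) =
      algebraMap QT[X] (RatFunc QT) (rowPoly μ (nRows μ - (r + 1))) *
          ((RatFunc.C (qq ^ (μ.rowLen r - μ.rowLen (r + 1))) -
              RatFunc.X / RatFunc.C (Ti μ i)) /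
            (1 - RatFunc.X / RatFunc.C (Ti μ i))) +
        RatFunc.C ((qq ^ (μ.rowLen r - μ.rowLen (r + 1)) - 1) / (qq - 1)) *
          ∏ j ∈ Finset.univ.erase i, (1 - RatFunc.X / RatFunc.C (Ti μ j)) := by
  have hk : nRows μ - (r + 1) + 1 = nRows μ - r := by omega
  have hrec := algebraMap_rowPoly_succ (μ := μ) (k := nRows μ - (r + 1)) (by omega) (i := i)
    (by omega)
  rw [hk, geom_sum_eq (sub_ne_zero.1 qq_sub_one_ne_zero), hi, algebraMap_cornerPoly,
    ← Finset.mul_prod_erase Finset.univ _ (Finset.mem_univ i)] at hrec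
  simp only [X_div_C]
  have hw := ratFunc_factor_ne_zero (Ti μ i)⁻¹
  apply mul_left_cancel₀ hw
  rw [hrec, mul_add, mul_left_comm _ (algebraMap _ _ _) (_ / _), mul_div_cancel₀ _ hw]
  ring

theorem rowPoly_solution {r : ℕ} {i : Fin (nCorners μ)} (hr : r < nRows μ)
    (hlen : μ.rowLen r = μ.rowLen (coleg μ i)) :
    algebraMap QT[X] (RatFunc QT) (rowPoly μ (nRows μ - r)) =
      (∏ j, (1 - RatFunc.X / RatFunc.C (Ti μ j))) * RatFunc.C (1 / (1 - qq)) *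
        (1 - ∏ s ∈ Finset.univ.filter (fun s => s ≤ i),
          RatFunc.C (xw μ s.succ / uw μ s.castSucc) *
            ((1 - RatFunc.C (uw μ s.castSucc / Tw μ) * RatFunc.X) /
              (1 - RatFunc.C (xw μ s.succ / Tw μ) * RatFunc.X))) := by
  have h1 := algebraMap_rowPoly (μ := μ) (Nat.sub_le (nRows μ) r)
  rw [topCorners_eq hr hlen, algebraMap_cornerPoly] at h1
  have hq : RatFunc.C (1 - qq) ≠ (0 : RatFunc QT) := by
    rw [Ne, map_eq_zero]; exact one_sub_qq_ne_zero
  have h2 : RatFunc.C (1 - qq) * RatFunc.C (1 / (1 - qq)) = (1 : RatFunc QT) := by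
    rw [← map_mul, one_div, mul_inv_cancel₀ one_sub_qq_ne_zero, map_one]
  simp only [X_div_C]
  apply mul_left_cancel₀ hq
  rw [h1, mul_assoc _ (RatFunc.C _), mul_left_comm, ← mul_assoc (RatFunc.C (1 - qq)), h2, one_mul]
  rfl

end ScienceFiction

/-! ### Assembly of the statement -/

open ScienceFiction
theorem proposition4p2 (n : ℕ) (μ : YoungDiagram) (hμ : μ.card = n + 1)
    (B : Set (XY n)) (Bi : Fin (nCorners μ) → Set (XY n)) (hSF : IsSFBasis n μ B Bi)
    (hCH : ∀ i, frob n (ghM n (predec μ i)) = Ht (predec μ i)) :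
    -- the polynomials attached to the rows are well defined
    (∀ r < nRows μ, ∃! P : Polynomial QT, IsRowPoly n μ r P) ∧
    -- the recursion, for `A` the row `r + 1` and `B` the row `r` below it
    (∀ (r : ℕ) (i : Fin (nCorners μ)) (PA PB : Polynomial QT),
      r + 1 < nRows μ → coleg μ i = r → IsRowPoly n μ (r + 1) PA → IsRowPoly n μ r PB →
      algebraMap (Polynomial QT) (RatFunc QT) PB =
        algebraMap (Polynomial QT) (RatFunc QT) PA *
            ((RatFunc.C (qq ^ (μ.rowLen r - μ.rowLen (r + 1))) -
                RatFunc.X / RatFunc.C (Ti μ i)) /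
              (1 - RatFunc.X / RatFunc.C (Ti μ i))) +
          RatFunc.C ((qq ^ (μ.rowLen r - μ.rowLen (r + 1)) - 1) / (qq - 1)) *
            ∏ j ∈ Finset.univ.erase i, (1 - RatFunc.X / RatFunc.C (Ti μ j))) ∧
    -- its solution, for every row `r` of the same length as the row of the corner `i`
    (∀ (r : ℕ) (i : Fin (nCorners μ)) (P : Polynomial QT),
      r < nRows μ → μ.rowLen r = μ.rowLen (coleg μ i) → IsRowPoly n μ r P →
      algebraMap (Polynomial QT) (RatFunc QT) P =
        (∏ j, (1 - RatFunc.X / RatFunc.C (Ti μ j))) * RatFunc.C (1 / (1 - qq)) *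
          (1 - ∏ s ∈ Finset.univ.filter (fun s => s ≤ i),
            RatFunc.C (xw μ s.succ / uw μ s.castSucc) *
              ((1 - RatFunc.C (uw μ s.castSucc / Tw μ) * RatFunc.X) /
                (1 - RatFunc.C (xw μ s.succ / Tw μ) * RatFunc.X)))) ∧
    -- the resulting sum over all the cells
    bhSum n μ = Polynomial.aeval nabla (finalPoly μ) (PhiMu μ) ∧
    -- the resulting formula for `∂_{p₁} H̃_μ`
    (frob (n + 1) (ghM (n + 1) μ) = Ht μ → dp1 (frob (n + 1) (ghM (n + 1) μ)) = bhSum n μ →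
      dp1 (Ht μ) = Polynomial.aeval nabla (finalPoly μ) (PhiMu μ)) := by
  -- By uniqueness the remaining claims about row polynomials need checking only for `rowPoly`.
  have hiff : ∀ {r : ℕ} {P : Polynomial QT}, r < nRows μ → IsRowPoly n μ r P →
      P = rowPoly μ (nRows μ - r) := fun hr h => (hSF.isRowPoly_iff hμ hCH hr).1 h
  refine ⟨fun r hr => ⟨_, hSF.isRowPoly hμ hCH hr, fun P hP => hiff hr hP⟩, ?_, ?_,
    hSF.bhSum_eq hμ hCH, fun h1 h2 => ?_⟩
  · intro r i PA PB hr hi hA hB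
    rw [hiff hr hA, hiff (by omega) hB]
    exact rowPoly_recursion hr hi
  · intro r i P hr hlen hP
    rw [hiff hr hP]
    exact rowPoly_solution hr hlen
  · rw [← h1, h2]
    exact hSF.bhSum_eq hμ hCH
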